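/- Let $n\ge 2$, let $\Phi^+$ be the set of positive roots of type $D_{n+1}$ with simple roots $\alpha_1,\dots,\alpha_{n+1}$, Weyl group $W=\langle s_1,\dots,s_{n+1}\rangle$ and longest element $w_0$ (for $n=2$, $D_3=A_3$, with node $1$ joined to nodes $2$ and $3$), and let $\vee$ be the diagram automorphism exchanging the end nodes $n$ and $n+1$ and fixing the other nodes. The *commutation class* $[\mathbf j]$ of a reduced word $\mathbf j$ of $w_0$ consists of the words obtained from it by commutations $s_is_j=s_js_i$. The *reflection functors* send $[i_1i_2\cdots i_N]$ to $[i_2\cdots i_N i_1^*]$ and to $[i_N^* i_1\cdots i_{N-1}]$, where $w_0(\alpha_i)=-\alpha_{i^*}$. A *twisted adapted class* $[Q^\leftarrow]$ of $D_{n+1}$ is a commutation class obtained by reflection functors from the class of $\prod_{k=0}^{n}(1\,2\cdots n)^{k\vee}$, where $k\vee$ means that $\vee$ is applied $k$ times to every letter. For $\gamma=\sum_i m_i\alpha_i\in\Phi^+$, the *folded multiplicity* $\overline{\mathsf m}(\gamma)$ is the maximum of $\sum_{j\in\bar\imath}m_j$ over the $\vee$-orbits $\bar\imath$ of indices. A *sequence*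 is a function $m:\Phi^+\to\mathbb Z_{\ge0}$; its weight is $\mathrm{wt}(m)=\sum_\beta m(\beta)\beta$. A *pair* $(\alpha,\beta)$ is the sequence with value $1$ at two distinct positive roots $\alpha,\beta$ and $0$ elsewhere. A reduced word $\mathbf j=i_1\cdots i_N$ of $w_0$ orders $\Phi^+$ by $\beta_k<_{\mathbf j}\beta_l\iff k<l$, where $\beta_k=s_{i_1}\cdots s_{i_{k-1}}(\alpha_{i_k})$. Write $m\prec m'$ if $\mathrm{wt}(m)=\mathrm{wt}(m')$ and, for every $\mathbf j\in[Q^\leftarrow]$, $m\ne m'$ and $m$ has the smaller value both at the $<_{\mathbf j}$-first and at the $<_{\mathbf j}$-last root where $m$ and $m'$ differ. A pair is *simple* if no sequence is $\prec$ it; a sequence is simple if every pair of distinct roots at which it is positive is simple. The *generalized distance* $\mathrm{gdist}(m)$ is $0$ if $m$ is simple, and otherwise the largest $k$ for which there is a chain $m^{(1)}\prec\cdots\prec m^{(k)}=m$ of non-simple sequences. The *radius* $\mathrm{rds}(\gamma)$ of a non-simple positive root $\gamma$ is the maximum of $\mathrm{gdist}(p)$ over the pairs $p$ with $\gamma\prec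 p$. The *socle* of a pair $p$ is the simple sequence $s$ with $s\prec p$ or $s=p$, and is well defined if exactly one such $s$ exists. **Theorem.** For every twisted adapted class $[Q^\leftarrow]$ of $D_{n+1}$: 1. For every pair $(\alpha,\beta)$ the generalized distance is well defined; it satisfies $\mathrm{gdist}(\alpha,\beta)\le\max\{\overline{\mathsf m}(\alpha),\overline{\mathsf m}(\beta)\}$ if $\alpha+\beta\notin\Phi^+$, and $\mathrm{gdist}(\alpha,\beta)\le\overline{\mathsf m}(\alpha+\beta)$ if $\alpha+\beta\in\Phi^+$. Moreover $\max_{\gamma\in\Phi^+}\overline{\mathsf m}(\gamma)=2$, so that $\mathrm{gdist}(\alpha,\beta)\le 2$ always. 2. For every non-simple $\gamma\in\Phi^+$, $\mathrm{rds}(\gamma)=\overline{\mathsf m}(\gamma)$. 3. For every pair, the socle is well defined. -/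

import Mathlib

noncomputable section

namespace TwistedD

/-! ## The root system of type `D_{n+1}`

The index set `{1, …, n+1}` is `Fin (n+1)`, shifted by one: the usual index `i` is `i - 1` here,
so that the two exchanged end nodes `n`, `n+1` are `n - 1`, `n`. -/

/-- The root lattice, in coordinates with respect to the simple roots:
`v` stands for `∑ i, v i • α_i`. -/
abbrev RootLattice (n : ℕ) : Type := Fin (n + 1) → ℤ

/-- The simple root `α_i`. -/
def simpleRoot (n : ℕ) (i : Fin (n + 1)) : RootLattice n := Pi.single i 1

/-- The simple reflection `s_i(v) = v - ⟨α_i^∨, v⟩ α_i`. -/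
def simpleRefl (n : ℕ) (i : Fin (n + 1)) (v : RootLattice n) : RootLattice n :=
  v - ((CartanMatrix.D (n + 1)).mulVec v i) • simpleRoot n i

/-- A word in the index set. -/
abbrev Word (n : ℕ) : Type := List (Fin (n + 1))

/-- The Weyl group element `s_{i_1} s_{i_2} ⋯ s_{i_l}` of the word `i_1 i_2 ⋯ i_l`, as a
transformation of the root lattice (on which the Weyl group acts faithfully). -/
def wordAct (n : ℕ) (w : Word n) (v : RootLattice n) : RootLattice n :=
  w.foldr (simpleRefl n) v

/-- Roots: the Weyl group images of the simple roots. -/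
def IsRoot (n : ℕ) (v : RootLattice n) : Prop :=
  ∃ (u : Word n) (i : Fin (n + 1)), v = wordAct n u (simpleRoot n i)

/-- Positive roots: the roots with non-negative coordinates in the simple roots. -/
def IsPosRoot (n : ℕ) (v : RootLattice n) : Prop :=
  IsRoot n v ∧ ∀ i, 0 ≤ v i

/-- The set `Φ⁺` of positive roots. -/
abbrev PosRoot (n : ℕ) : Type := {v : RootLattice n // IsPosRoot n v}

/-! ## Reduced words, commutation classes, reflection functors -/

/-- `w` is a reduced word (of the Weyl group element it represents). -/
def IsReduced (n : ℕ) (w : Word n) : Prop :=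
  ∀ u : Word n, wordAct n u = wordAct n w → w.length ≤ u.length

/-- `w` is a reduced word of the longest element `w₀`. -/
def IsLongestWord (n : ℕ) (w : Word n) : Prop :=
  IsReduced n w ∧ ∀ u : Word n, IsReduced n u → u.length ≤ w.length

/-- One commutation `s_i s_j = s_j s_i` (with `i`, `j` not adjacent in the Dynkin diagram). -/
def CommStep (n : ℕ) (w w' : Word n) : Prop :=
  ∃ (u v : Word n) (i j : Fin (n + 1)), CartanMatrix.D (n + 1) i j = 0 ∧
    w = u ++ i :: j :: v ∧ w' = u ++ j :: i :: v

/-- Commutation equivalence. The commutation class `[w]` is `{w' | CommEquiv n w w'}`. -/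
def CommEquiv (n : ℕ) : Word n → Word n → Prop := Relation.EqvGen (CommStep n)

/-- The reflection functor `r_i` on a reduced word `i i_2 ⋯ i_N` of `w₀`: it is sent to
`i_2 ⋯ i_N i^*`, where `w₀(α_i) = -α_{i^*}`. -/
def ReflStep (n : ℕ) (w w' : Word n) : Prop :=
  ∃ (i j : Fin (n + 1)) (u : Word n), w = i :: u ∧ IsLongestWord n w ∧
    wordAct n w (simpleRoot n i) = -simpleRoot n j ∧ w' = u ++ [j]

/-- Reflection equivalence of (the commutation classes of) reduced words of `w₀`. The left
reflection functors are the inverses of the right ones, so they are covered by taking the generated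
equivalence relation. -/
def ReflEquiv (n : ℕ) : Word n → Word n → Prop :=
  Relation.EqvGen fun w w' => CommStep n w w' ∨ ReflStep n w w'

/-! ## The twisted adapted cluster point -/

/-- The diagram automorphism `∨`, which exchanges the end nodes `n` and `n+1`
and fixes all the others. -/
def vee (n : ℕ) : Equiv.Perm (Fin (n + 1)) :=
  Equiv.swap ⟨n - 1, by omega⟩ (Fin.last n)

/-- The word `∏_{k=0}^{n} (1 2 ⋯ n)^{k∨}`. -/
def baseWord (n : ℕ) : Word n :=
  (List.range (n + 1)).flatMap fun k =>
    (List.finRange n).map fun q => ((vee n) ^ k) q.castSucc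

/-- `[w]` is a twisted adapted class of type `D_{n+1}`: it belongs to the `r`-cluster point of
`∏_{k=0}^{n} (1 2 ⋯ n)^{k∨}`. -/
def IsTwistedAdapted (n : ℕ) (w : Word n) : Prop := ReflEquiv n (baseWord n) w

/-- The folded multiplicity of `γ = ∑ m_i α_i`: the maximum over the orbits `{i, i^∨}` of
the sum of the `m_j` over the orbit. -/
def foldedMult (n : ℕ) (γ : PosRoot n) : ℕ :=
  Finset.univ.sup fun i : Fin (n + 1) =>
    ∑ j ∈ ({i, vee n i} : Finset (Fin (n + 1))), (γ.1 j).toNat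

/-! ## Sequences and their orders -/

/-- The root `β_k = s_{i_1} ⋯ s_{i_{k-1}}(α_{i_k})` of the word `w = i_1 i_2 ⋯` (the index `k`
starts at `0` here). -/
def wordRoot (n : ℕ) (w : Word n) (k : Fin w.length) : RootLattice n :=
  wordAct n (w.take k) (simpleRoot n (w.get k))

/-- The total order `<_w` on positive roots given by a reduced word `w` of `w₀`:
`β_k <_w β_l` when `k < l`. -/
def rootLT (n : ℕ) (w : Word n) (β γ : PosRoot n) : Prop :=
  ∃ k l : Fin w.length, k < l ∧ wordRoot n w k = β.1 ∧ wordRoot n w l = γ.1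

/-- A sequence `m`: a non-negative integer for every positive root. (For a reduced word of `w₀`
with roots `β_1, …, β_N`, this is `(m_1, …, m_N)` with `m_k = m β_k`; thus passing to another
reduced word is the rearrangement of the multiset of roots.) -/
abbrev RootSeq (n : ℕ) : Type := PosRoot n →₀ ℕ

/-- The weight `∑ m_i β_i`. -/
def wt (n : ℕ) (m : RootSeq n) : RootLattice n :=
  m.sum fun β k => k • β.1

/-- The sequence consisting of one root, once. -/
def single (n : ℕ) (α : PosRoot n) : RootSeq n := Finsupp.single α 1

/-- The sequence `(α, β)`; it is a pair when `α ≠ β`. -/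
def pair (n : ℕ) (α β : PosRoot n) : RootSeq n := single n α + single n β

/-- The bi-lexicographical order `m <^b_w m'`: with respect to `<_w`, at the first root `a` and at
the last root `b` where they differ, `m` is smaller than `m'`. -/
def bilexLT (n : ℕ) (w : Word n) (m m' : RootSeq n) : Prop :=
  (∃ a, m a < m' a ∧ ∀ γ, rootLT n w γ a → m γ = m' γ) ∧
  (∃ b, m b < m' b ∧ ∀ γ, rootLT n w b γ → m γ = m' γ)

/-- The order `m ≺^b_{[w]} m'`. -/
def precB (n : ℕ) (w : Word n) (m m' : RootSeq n) : Prop :=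
  wt n m = wt n m' ∧ ∀ w', CommEquiv n w w' → bilexLT n w' m m'

/-- A pair is `[w]`-simple if nothing is `≺^b_{[w]}`-below it; a sequence is `[w]`-simple if all
pairs of distinct roots that occur in it are. (If the sequence is one root, or is itself a pair,
this is the usual convention.) -/
def IsSimpleSeq (n : ℕ) (w : Word n) (m : RootSeq n) : Prop :=
  ∀ α β : PosRoot n, α ≠ β → 0 < m α → 0 < m β → ¬ ∃ m', precB n w m' (pair n α β)

/-! ## Generalized distance, radius, socle

They are relations, so that no junk value of a supremum is involved. -/

/-- `k` is the length of a chain `m⁽¹⁾ ≺^b_{[w]} ⋯ ≺^b_{[w]} m⁽ᵏ⁾ = m` of non-simple sequences. -/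
def IsChainLength (n : ℕ) (w : Word n) (m : RootSeq n) (k : ℕ) : Prop :=
  ∃ l : List (RootSeq n), (l ++ [m]).length = k ∧ (l ++ [m]).IsChain (precB n w) ∧
    ∀ x ∈ l ++ [m], ¬ IsSimpleSeq n w x

/-- The generalized `[w]`-distance of `m` is (defined and equal to) `d`. -/
def HasGDist (n : ℕ) (w : Word n) (m : RootSeq n) (d : ℕ) : Prop :=
  (IsSimpleSeq n w m ∧ d = 0) ∨
  (¬ IsSimpleSeq n w m ∧ IsGreatest {k | IsChainLength n w m k} d)

/-- The `[w]`-radius of `γ` is (defined and equal to) `r`: it is the maximum of the generalized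
distances of the pairs `p` with `γ ≺^b_{[w]} p`. -/
def HasRadius (n : ℕ) (w : Word n) (γ : PosRoot n) (r : ℕ) : Prop :=
  IsGreatest {d | ∃ α β : PosRoot n, α ≠ β ∧ precB n w (single n γ) (pair n α β) ∧
    HasGDist n w (pair n α β) d} r

/-- `s` is a `[w]`-simple sequence with `s ⪯^b_{[w]} p`. The socle of `p` is well defined if there
is exactly one such `s`. -/
def IsSocle (n : ℕ) (w : Word n) (p s : RootSeq n) : Prop :=
  IsSimpleSeq n w s ∧ (precB n w s p ∨ s = p)

end TwistedD

end

open TwistedD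

noncomputable section

namespace TwistedD

/-! ## Orthonormal coordinates -/

/-! Idea of the proof. In coordinates ε_0, …, ε_n the roots are vectors ±ε_a ± ε_b. Consider
vertices (l, x) with n levels l and integer positions x, ordered by x ≤ x' and x + l ≤ x' + l'. A
section cuts this poset, and a turn is a word that reads the vertices between a section and its
translate by n + 1; on the last level the letters n - 1 and n (counted from 0) alternate. The base
word is a turn, and commutations and reflection functors preserve turns (`IsTwistedAdapted.isTurn`).
All readings of one strip are commutation equivalent (`Reads.commEquiv`).

A section determines signed basis vectors e_x, x ∈ ℤ, with e_{x+n+1} = -e_x (`Frame`). Reading a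
vertex changes coordinates by one simple reflection (`Frame.rel_flip`), so the root of (l, x) is e_x
- e_{x+l+1} = e_P + e_R with P = x and R = x + l - n (`reads_root`). Positive roots thus become
pairs R < P < R + n + 1 with the componentwise order; `Chart` records this. The class has enough
readings to ensure that, for α ≤ β in this order, m ≺ (α, β) holds exactly when m has the weight of
the pair and is supported strictly between α and β (`precB_iff_below`). Incomparable pairs are
simple.

View a root as a chord from R to P, and let α ≤ β. Suppose R α < P α < R β < P β < R α + n + 1.
Nothing cancels, and the four endpoints have three matchings: separate (the pair itself), crossing
and nested, each ≺ the previous one. The distance is 2 and the nested matching is the socle. If P β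
= R α + n + 1, the outer chord of the nested matching has weight zero, so the single root α + β
takes its place. If P β is larger, the outer chord is no root; only the crossing matching, or a
single root after a cancellation, can lie below the pair. Chords that already cross have at most one
sequence below them. This is `pair_cases`, which yields the socle and the values 0, 1, 2 of the
distance.

Folded multiplicity 2 is detected by the two end nodes, whose total multiplicity is a sum of
contributions 0 or ±1 of e_P and e_R, with 0 only for index n (`endSum_eq`). When the distance is 2,
positivity of the intermediate roots forces the required multiplicity (`two_le_of_short`,
`two_le_of_middle`). Conversely, a root of multiplicity 2 is split as (e_R + e_y) + (e_{y+n+1} +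
e_P) with e_y of index n, a pair of distance 2 (`exists_twoBelow_of_endSum`). A non-simple root of
multiplicity 1 is a sum of two distinct positive roots (`exists_decomposition`) and lies below that
pair (`precB_single_of_add_eq`). -/

/-- Coordinates in the simple roots, extended by zero. -/
def coord (n : ℕ) (v : RootLattice n) (k : ℕ) : ℤ := if h : k < n + 1 then v ⟨k, h⟩ else 0

/-- Coordinates in the orthonormal basis `ε_0, …, ε_n`, in which the simple roots are
`ε_i - ε_{i+1}` (`i < n`) and `ε_{n-1} + ε_n`. -/
def eps (n : ℕ) (v : RootLattice n) (k : ℕ) : ℤ :=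
  if k = n then coord n v n - coord n v (n - 1)
  else if k + 1 = n then coord n v (n - 1) + coord n v n - coord n v (n - 2)
  else if k < n then coord n v k - (if k = 0 then 0 else coord n v (k - 1)) else 0

/-- The simple reflections in orthonormal coordinates. -/
def refl (n : ℕ) (i : ℕ) (f : ℕ → ℤ) (k : ℕ) : ℤ :=
  if i < n then (if k = i then f (i + 1) else if k = i + 1 then f i else f k)
  else (if k + 1 = n then -f n else if k = n then -f (n - 1) else f k)

variable {n : ℕ}

lemma coord_fin (v : RootLattice n) (i : Fin (n + 1)) : coord n v i = v i := by
  simp only [coord, i.2, dif_pos]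

lemma coord_add (v w : RootLattice n) (k : ℕ) :
    coord n (v + w) k = coord n v k + coord n w k := by
  unfold coord; split_ifs <;> simp

lemma coord_neg (v : RootLattice n) (k : ℕ) : coord n (-v) k = -coord n v k := by
  unfold coord; split_ifs <;> simp

lemma coord_sub_smul (v w : RootLattice n) (c : ℤ) (k : ℕ) :
    coord n (v - c • w) k = coord n v k - c * coord n w k := by
  unfold coord; split_ifs <;> simp

lemma coord_simpleRoot (i : Fin (n + 1)) (k : ℕ) :
    coord n (simpleRoot n i) k = if k = i then 1 else 0 := by
  unfold coord simpleRoot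
  split_ifs with h1 h2 h2
  · subst h2; simp
  · rw [Pi.single_eq_of_ne]; intro h; apply h2; rw [← h]
  · omega
  · rfl

lemma eps_add (v w : RootLattice n) (k : ℕ) : eps n (v + w) k = eps n v k + eps n w k := by
  unfold eps; simp only [coord_add]; split_ifs <;> ring

lemma eps_neg (v : RootLattice n) (k : ℕ) : eps n (-v) k = -eps n v k := by
  unfold eps; simp only [coord_neg]; split_ifs <;> ring

lemma sum_indicator (v : RootLattice n) (a : ℕ) (p : Prop) [Decidable p] :
    ∑ j : Fin (n + 1), (if j.val = a ∧ p then v j else 0) = if p then coord n v a else 0 := by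
  by_cases hp : p
  · simp only [hp, and_true, if_true]
    unfold coord
    split_ifs with h
    · rw [Finset.sum_eq_single ⟨a, h⟩]
      · simp
      · intro b _ hb
        rw [if_neg]
        intro h'
        exact hb (Fin.ext h')
      · simp
    · apply Finset.sum_eq_zero
      intro j _
      rw [if_neg]
      have := j.2
      omega
  · simp [hp]

/-- The row is split into indicator terms so that `sum_indicator` evaluates each sum; the trivial `∧
True` gives the diagonal term the same shape. -/
lemma cartan_apply (hn : 2 ≤ n) (i j : Fin (n + 1)) (x : ℤ) : CartanMatrix.D (n + 1) i j * x =
    2 * (if j.val = i.val ∧ True then x else 0)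
    - (if j.val = i.val - 1 ∧ (1 ≤ i.val ∧ i.val < n) then x else 0)
    - (if j.val = i.val + 1 ∧ i.val + 1 < n then x else 0)
    - (if j.val = n - 2 ∧ i.val = n then x else 0)
    - (if j.val = n ∧ i.val + 2 = n then x else 0) := by
  have hi := i.2
  have hj := j.2
  simp only [CartanMatrix.D, Matrix.of_apply, Fin.ext_iff, and_true]
  split_ifs <;> omega

lemma cartan_mulVec (hn : 2 ≤ n) (v : RootLattice n) (i : Fin (n + 1)) :
    (CartanMatrix.D (n + 1)).mulVec v i =
      if i.val < n then eps n v i - eps n v (i + 1) else eps n v (n - 1) + eps n v n := by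
  have hi := i.2
  simp only [Matrix.mulVec, dotProduct, cartan_apply hn, Finset.sum_sub_distrib,
    ← Finset.mul_sum, sum_indicator]
  unfold eps
  rcases i with ⟨i, hi'⟩
  simp only at *
  by_cases h1 : i = n
  · subst h1
    have e1 : i - 1 + 1 = i := by omega
    have e2 : ¬ (i - 1 = i) := by omega
    have e3 : ¬ (i + 2 = i) := by omega
    simp [e1, e2]; ring
  by_cases h2 : i + 1 = n
  · subst h2
    have : 1 ≤ i := by omega
    simp [this]; ring
  by_cases h3 : i + 2 = n
  · subst h3
    by_cases h0 : i = 0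
    · subst h0; simp; ring
    · have : 1 ≤ i := by omega
      simp [this, h0]; ring
  have e1 : i < n := by omega
  have e2 : i + 1 < n := by omega
  by_cases h0 : i = 0
  · subst h0; simp [h1, h2, h3, e1, e2]; ring
  · have : 1 ≤ i := by omega
    simp [h1, h2, h3, e1, e2, this, h0]; ring

lemma eps_simpleRoot (hn : 2 ≤ n) (i : Fin (n + 1)) (k : ℕ) : eps n (simpleRoot n i) k =
    if i.val < n then (if k = i then 1 else if k = i + 1 then -1 else 0)
    else (if k + 1 = n then 1 else if k = n then 1 else 0) := by
  have hi := i.2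
  unfold eps
  simp only [coord_simpleRoot]
  split_ifs <;> omega

lemma eps_simpleRefl (hn : 2 ≤ n) (i : Fin (n + 1)) (v : RootLattice n) (k : ℕ) :
    eps n (simpleRefl n i v) k = refl n i (eps n v) k := by
  have hi := i.2
  have h : eps n (simpleRefl n i v) k = eps n v k -
      (CartanMatrix.D (n + 1)).mulVec v i * eps n (simpleRoot n i) k := by
    unfold simpleRefl eps
    simp only [coord_sub_smul]
    split_ifs <;> ring
  rw [h, cartan_mulVec hn, eps_simpleRoot hn]
  unfold refl
  by_cases h1 : i.val < n
  · simp only [h1, if_true]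
    split_ifs with h2 h3
    · rw [h2]; ring
    · rw [h3]; ring
    · ring
  · simp only [h1, if_false]
    split_ifs with h2 h3
    · have : k = n - 1 := by omega
      rw [this]; ring
    · rw [h3]; ring
    · ring

/-- A word acting in orthonormal coordinates. -/
def reflWord (n : ℕ) (w : Word n) (f : ℕ → ℤ) : ℕ → ℤ := w.foldr (fun i : Fin (n + 1) => refl n i) f

lemma eps_wordAct (hn : 2 ≤ n) (w : Word n) (v : RootLattice n) :
    eps n (wordAct n w v) = reflWord n w (eps n v) := by
  induction w with
  | nil => rfl
  | cons i w ih =>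
    funext k
    simp only [wordAct, reflWord, List.foldr_cons] at ih ⊢
    rw [eps_simpleRefl hn, ih]

lemma wordAct_cons (i : Fin (n + 1)) (w : Word n) (v : RootLattice n) :
    wordAct n (i :: w) v = simpleRefl n i (wordAct n w v) := rfl

/-! ### Partial sums -/

/-- Up to n - 2 the ε-coordinates are successive differences of coefficients, so the sum telescopes.
Coefficients of roots, and hence positivity, are read off from these sums. -/
lemma sum_eps (hn : 2 ≤ n) (v : RootLattice n) (k : ℕ) (hk : k + 2 ≤ n) :
    ∑ j ∈ Finset.range (k + 1), eps n v j = coord n v k := by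
  induction k with
  | zero =>
    have h1 : ¬ (0 = n) := by omega
    have h2 : ¬ (1 = n) := by omega
    have h3 : 0 < n := by omega
    simp [eps, h1, h2, h3]
  | succ k ih =>
    rw [Finset.sum_range_succ, ih (by omega)]
    have h1 : ¬ (k + 1 = n) := by omega
    have h2 : ¬ (k + 1 + 1 = n) := by omega
    have h3 : k + 1 < n := by omega
    simp [eps, h1, h2, h3]

/-- The sum of the coefficients of the two exchanged end nodes. -/
def endSum (n : ℕ) (v : RootLattice n) : ℤ := coord n v (n - 1) + coord n v n

lemma sum_eps_eq_endSum (hn : 2 ≤ n) (v : RootLattice n) :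
    ∑ j ∈ Finset.range n, eps n v j = endSum n v := by
  obtain ⟨k, rfl⟩ : ∃ k, n = k + 2 := ⟨n - 2, by omega⟩
  rw [Finset.sum_range_succ, sum_eps hn v k (by omega)]
  have h1 : ¬ (k + 1 = k + 2) := by omega
  simp [eps, endSum]

lemma eps_last (v : RootLattice n) : eps n v n = coord n v n - coord n v (n - 1) := by
  simp [eps]

lemma ext_of_eps (hn : 2 ≤ n) {v w : RootLattice n} (h : ∀ k, k ≤ n → eps n v k = eps n w k) :
    v = w := by
  have h1 : endSum n v = endSum n w := by
    rw [← sum_eps_eq_endSum hn, ← sum_eps_eq_endSum hn]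
    exact Finset.sum_congr rfl fun j hj => h j (by have := Finset.mem_range.1 hj; omega)
  have h2 := h n le_rfl
  rw [eps_last, eps_last] at h2
  unfold endSum at h1
  funext i
  rw [← coord_fin v, ← coord_fin w]
  have hi := i.2
  by_cases h3 : i.val = n
  · rw [h3]; omega
  by_cases h4 : i.val = n - 1
  · rw [h4]; omega
  rw [← sum_eps hn v i (by omega), ← sum_eps hn w i (by omega)]
  exact Finset.sum_congr rfl fun j hj => h j (by have := Finset.mem_range.1 hj; omega)

/-! ### Roots in orthonormal coordinates -/

/-- The vector `s ε_a + t ε_b`. -/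
def signedPair (a b : ℕ) (s t : ℤ) (k : ℕ) : ℤ :=
  (if k = a then s else 0) + (if k = b then t else 0)

/-- The index of the image of `±ε_a` under a simple reflection. -/
def reflIdx (n j a : ℕ) : ℕ :=
  if j < n then (if a = j then j + 1 else if a = j + 1 then j else a)
  else (if a + 1 = n then n else if a = n then n - 1 else a)

/-- The sign of the image of `s ε_a` under a simple reflection. -/
def reflSign (n j a : ℕ) (s : ℤ) : ℤ := if ¬ j < n ∧ (a + 1 = n ∨ a = n) then -s else s

lemma refl_indicator (hn : 2 ≤ n) (j a : ℕ) (s : ℤ) (k : ℕ) :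
    refl n j (fun k => if k = a then s else 0) k =
      if k = reflIdx n j a then reflSign n j a s else 0 := by
  by_cases h : j < n
  · simp only [refl, reflIdx, reflSign, h, if_true, not_true, false_and, if_false]
    split_ifs <;> omega
  · simp only [refl, reflIdx, reflSign, h, not_false_eq_true, true_and, if_false]
    split_ifs <;> omega

lemma refl_add (j : ℕ) (f g : ℕ → ℤ) (k : ℕ) :
    refl n j (fun k => f k + g k) k = refl n j f k + refl n j g k := by
  unfold refl; split_ifs <;> ring

lemma refl_signedPair (hn : 2 ≤ n) (j a b : ℕ) (s t : ℤ) :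
    refl n j (signedPair a b s t) =
      signedPair (reflIdx n j a) (reflIdx n j b) (reflSign n j a s) (reflSign n j b t) := by
  funext k
  rw [signedPair, ← refl_indicator hn, ← refl_indicator hn, ← refl_add]
  rfl

lemma reflIdx_le {j a : ℕ} (ha : a ≤ n) : reflIdx n j a ≤ n := by
  unfold reflIdx; split_ifs <;> omega

lemma reflIdx_ne (hn : 2 ≤ n) {j a b : ℕ} (h : a ≠ b) : reflIdx n j a ≠ reflIdx n j b := by
  by_cases h : j < n <;> simp only [reflIdx, h, if_true, if_false] <;> split_ifs <;> omega

lemma reflSign_eq {j a : ℕ} {s : ℤ} (h : s = 1 ∨ s = -1) :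
    reflSign n j a s = 1 ∨ reflSign n j a s = -1 := by
  unfold reflSign; split_ifs <;> omega

/-- Each simple reflection permutes the ε-basis up to sign, so the shape survives induction on the
word. Only this inclusion is needed. -/
lemma isRoot_eps (hn : 2 ≤ n) {v : RootLattice n} (hv : IsRoot n v) :
    ∃ a b s t, a ≠ b ∧ a ≤ n ∧ b ≤ n ∧ (s = 1 ∨ s = -1) ∧ (t = 1 ∨ t = -1) ∧
      eps n v = signedPair a b s t := by
  obtain ⟨w, i, rfl⟩ := hv
  rw [eps_wordAct hn]
  induction w with
  | nil =>
    have hi := i.2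
    by_cases h : i.val < n
    · refine ⟨i, i + 1, 1, -1, by omega, by omega, by omega, by omega, by omega, ?_⟩
      funext k
      simp only [reflWord, List.foldr_nil, eps_simpleRoot hn, signedPair, h, if_true]
      split_ifs <;> omega
    · refine ⟨n - 1, n, 1, 1, by omega, by omega, by omega, by omega, by omega, ?_⟩
      funext k
      simp only [reflWord, List.foldr_nil, eps_simpleRoot hn, signedPair, h, if_false]
      split_ifs <;> omega
  | cons j w ih =>
    obtain ⟨a, b, s, t, hab, ha, hb, hs, ht, e⟩ := ih
    refine ⟨reflIdx n j a, reflIdx n j b, reflSign n j a s, reflSign n j b t, reflIdx_ne hn hab,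
      reflIdx_le ha, reflIdx_le hb, reflSign_eq hs, reflSign_eq ht, ?_⟩
    rw [← refl_signedPair hn, ← e]
    rfl

lemma sum_range_signedPair (a b : ℕ) (s t : ℤ) (k : ℕ) :
    ∑ j ∈ Finset.range k, signedPair a b s t j = (if a < k then s else 0) + (if b < k then t else 0) := by
  simp only [signedPair, Finset.sum_add_distrib, Finset.sum_ite_eq', Finset.mem_range]

/-- The partial sum ending at the first nonzero coordinate equals its sign and is a coefficient, or
the sum of the two end coefficients; so the sign is positive. -/
lemma isPosRoot_eps (hn : 2 ≤ n) {v : RootLattice n} (hv : IsPosRoot n v) :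
    ∃ a b t, a < b ∧ b ≤ n ∧ (t = 1 ∨ t = -1) ∧ eps n v = signedPair a b 1 t := by
  obtain ⟨a, b, s, t, hab, ha, hb, hs, ht, e⟩ := isRoot_eps hn hv.1
  wlog h : a < b generalizing a b s t
  · refine this b a t s hab.symm hb ha ht hs ?_ (by omega)
    rw [e]; funext k; simp only [signedPair]; ring
  refine ⟨a, b, t, h, hb, ht, ?_⟩
  have hp : ∀ k, 0 ≤ coord n v k := by
    intro k; unfold coord; split_ifs
    · exact hv.2 _
    · exact le_rfl
  have key : s = 1 := by
    rcases hs with hs | hs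
    · exact hs
    exfalso
    by_cases h1 : a + 2 ≤ n
    · have h2 := sum_eps hn v a h1
      rw [e, sum_range_signedPair, if_pos (by omega), if_neg (by omega)] at h2
      have := hp a
      omega
    · have h2 := sum_eps_eq_endSum hn v
      rw [e, sum_range_signedPair, if_pos (by omega), if_neg (by omega)] at h2
      have := hp (n - 1)
      have := hp n
      unfold endSum at h2
      omega
  rw [e, key]

lemma coord_of_eps (hn : 2 ≤ n) {v : RootLattice n} {a b : ℕ} {s t : ℤ}
    (e : eps n v = signedPair a b s t) :
    (∀ k, k + 2 ≤ n → coord n v k = (if a ≤ k then s else 0) + (if b ≤ k then t else 0)) ∧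
    coord n v (n - 1) + coord n v n = (if a < n then s else 0) + (if b < n then t else 0) ∧
    coord n v n - coord n v (n - 1) = (if n = a then s else 0) + (if n = b then t else 0) := by
  refine ⟨fun k hk => ?_, ?_, ?_⟩
  · rw [← sum_eps hn v k hk, e, sum_range_signedPair]
    simp only [Nat.lt_succ_iff]
  · have := sum_eps_eq_endSum hn v
    rw [e, sum_range_signedPair] at this
    exact this.symm
  · rw [← eps_last, e]; rfl

lemma nonneg_of_eps (hn : 2 ≤ n) {v : RootLattice n} {a b : ℕ} {t : ℤ} (hab : a < b) (hb : b ≤ n)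
    (ht : t = 1 ∨ t = -1) (e : eps n v = signedPair a b 1 t) (i : Fin (n + 1)) : 0 ≤ v i := by
  obtain ⟨h1, h2, h3⟩ := coord_of_eps hn e
  have hi := i.2
  rw [← coord_fin v]
  by_cases h4 : i.val + 2 ≤ n
  · rw [h1 _ h4]; split_ifs <;> omega
  · have : i.val = n - 1 ∨ i.val = n := by omega
    rcases this with h | h <;> rw [h] <;> split_ifs at h2 h3 <;> omega

/-! ### Folded multiplicities -/

lemma vee_of_lt (i : Fin (n + 1)) (h : i.val + 1 < n) : vee n i = i := by
  unfold vee
  apply Equiv.swap_apply_of_ne_of_ne <;> (simp only [ne_eq, Fin.ext_iff, Fin.val_last]; omega)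

lemma toNat_sum_orbit (hn : 2 ≤ n) (γ : PosRoot n) (i : Fin (n + 1)) :
    ((∑ j ∈ ({i, vee n i} : Finset (Fin (n + 1))), (γ.1 j).toNat : ℕ) : ℤ) =
      if i.val + 1 < n then γ.1 i else endSum n γ.1 := by
  have hi := i.2
  have hp := γ.2.2
  split_ifs with h
  · rw [vee_of_lt i h]; simp [hp i]
  · have e1 : endSum n γ.1 = γ.1 ⟨n - 1, by omega⟩ + γ.1 (Fin.last n) := by
      unfold endSum
      rw [← coord_fin γ.1, ← coord_fin γ.1]; rfl
    have hne : (⟨n - 1, by omega⟩ : Fin (n + 1)) ≠ Fin.last n := by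
      simp only [ne_eq, Fin.ext_iff, Fin.val_last]; omega
    have h2 : i = ⟨n - 1, by omega⟩ ∨ i = Fin.last n := by
      simp only [Fin.ext_iff, Fin.val_last]; omega
    rcases h2 with h2 | h2
    · have : vee n i = Fin.last n := by rw [h2]; exact Equiv.swap_apply_left _ _
      rw [this, h2, Finset.sum_pair hne, e1]; simp [hp]
    · have : vee n i = ⟨n - 1, by omega⟩ := by rw [h2]; exact Equiv.swap_apply_right _ _
      rw [this, h2, Finset.sum_pair hne.symm, e1]; simp [hp, add_comm]

lemma endSum_le_foldedMult (hn : 2 ≤ n) (γ : PosRoot n) : endSum n γ.1 ≤ foldedMult n γ := by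
  have h := toNat_sum_orbit hn γ (Fin.last n)
  rw [if_neg (by simp)] at h
  rw [← h]
  exact_mod_cast Finset.le_sup (f := fun i : Fin (n + 1) =>
    ∑ j ∈ ({i, vee n i} : Finset (Fin (n + 1))), (γ.1 j).toNat) (Finset.mem_univ (Fin.last n))

lemma foldedMult_le (hn : 2 ≤ n) (γ : PosRoot n) {d : ℕ}
    (h : ∀ i, i + 2 ≤ n → coord n γ.1 i ≤ d) (h' : endSum n γ.1 ≤ d) : foldedMult n γ ≤ d := by
  apply Finset.sup_le
  intro i _
  have := toNat_sum_orbit hn γ i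
  have h3 : (if i.val + 1 < n then γ.1 i else endSum n γ.1) ≤ d := by
    split_ifs with h4
    · rw [← coord_fin γ.1]; exact h _ (by omega)
    · exact h'
  omega

lemma foldedMult_le_two (hn : 2 ≤ n) (γ : PosRoot n) : foldedMult n γ ≤ 2 := by
  obtain ⟨a, b, t, hab, hb, ht, e⟩ := isPosRoot_eps hn γ.2
  obtain ⟨h1, h2, h3⟩ := coord_of_eps hn e
  apply foldedMult_le hn
  · intro i hi; rw [h1 i hi]; split_ifs <;> push_cast <;> omega
  · unfold endSum; rw [h2]; split_ifs <;> push_cast <;> omega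

/-- An inner coefficient 2 occurs only for ε_a + ε_b with b < n, and then the end orbit has sum 2 as
well. Hence the end orbit alone detects multiplicity 2. -/
lemma foldedMult_le_one (hn : 2 ≤ n) (γ : PosRoot n) (h : endSum n γ.1 ≤ 1) :
    foldedMult n γ ≤ 1 := by
  obtain ⟨a, b, t, hab, hb, ht, e⟩ := isPosRoot_eps hn γ.2
  obtain ⟨h1, h2, h3⟩ := coord_of_eps hn e
  apply foldedMult_le hn
  · intro i hi; rw [h1 i hi]; unfold endSum at h; rw [h2] at h; split_ifs at h ⊢ <;> push_cast <;> omega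
  · exact_mod_cast h

lemma one_le_foldedMult (hn : 2 ≤ n) (γ : PosRoot n) : 1 ≤ foldedMult n γ := by
  obtain ⟨a, b, t, hab, hb, ht, e⟩ := isPosRoot_eps hn γ.2
  obtain ⟨h1, h2, h3⟩ := coord_of_eps hn e
  by_cases ha : a + 2 ≤ n
  · have h4 := h1 a ha
    rw [if_pos le_rfl, if_neg (by omega)] at h4
    have h5 := toNat_sum_orbit hn γ ⟨a, by omega⟩
    rw [if_pos (by simp; omega), ← coord_fin γ.1] at h5
    have h6 := Finset.le_sup (f := fun i : Fin (n + 1) =>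
      ∑ j ∈ ({i, vee n i} : Finset (Fin (n + 1))), (γ.1 j).toNat)
      (Finset.mem_univ (⟨a, by omega⟩ : Fin (n + 1)))
    simp only [h4] at h5
    unfold foldedMult
    omega
  · have := endSum_le_foldedMult hn γ
    unfold endSum at this
    rw [h2, if_pos (by omega), if_neg (by omega)] at this
    omega

/-- A non-simple positive root whose end nodes have total multiplicity at most one is the sum of
two different positive roots. -/
lemma exists_decomposition (hn : 2 ≤ n) (γ : PosRoot n) (hγ : ∀ i, γ.1 ≠ simpleRoot n i)
    (h : endSum n γ.1 ≤ 1) : ∃ α β : PosRoot n, α ≠ β ∧ γ.1 = α.1 + β.1 := by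
  obtain ⟨a, b, t, hab, hb, ht, e⟩ := isPosRoot_eps hn γ.2
  obtain ⟨-, h2, -⟩ := coord_of_eps hn e
  unfold endSum at h
  rw [h2] at h
  have simple : ∀ i, IsPosRoot n (simpleRoot n i) := by
    refine fun i => ⟨⟨[], i, rfl⟩, fun j => ?_⟩
    rw [← coord_fin (simpleRoot n i), coord_simpleRoot]; split_ifs <;> omega
  have hasEps : ∀ i : Fin (n + 1), eps n (γ.1 - simpleRoot n i) =
      fun k => eps n γ.1 k - eps n (simpleRoot n i) k := by
    intro i; funext k; rw [sub_eq_add_neg, eps_add, eps_neg]; ring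
  have root : ∀ i : Fin (n + 1), (CartanMatrix.D (n + 1)).mulVec γ.1 i = 1 →
      IsRoot n (γ.1 - simpleRoot n i) := by
    intro i hi
    obtain ⟨u, j, hu⟩ := γ.2.1
    refine ⟨i :: u, j, ?_⟩
    rw [wordAct_cons, ← hu, simpleRefl, hi, one_smul]
  suffices hs : ∃ i : Fin (n + 1), IsPosRoot n (γ.1 - simpleRoot n i) by
    obtain ⟨i, hi⟩ := hs
    refine ⟨⟨_, hi⟩, ⟨_, simple i⟩, ?_, by simp⟩
    intro h'
    have h' : γ.1 - simpleRoot n i = simpleRoot n i := congrArg Subtype.val h'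
    -- Equal summands would make this coordinate even, but it is 1.
    have h3 : eps n γ.1 a = eps n (simpleRoot n i) a + eps n (simpleRoot n i) a := by
      rw [← eps_add, ← sub_eq_iff_eq_add.1 h']
    rw [e, signedPair, if_pos rfl, if_neg (by omega)] at h3
    omega
  rcases ht with rfl | rfl
  · have hbn : b = n := by split_ifs at h <;> omega
    have han : a + 1 ≠ n := by
      intro han
      apply hγ (Fin.last n)
      apply ext_of_eps hn
      intro k hk
      rw [e, eps_simpleRoot hn, signedPair]
      simp only [Fin.val_last, lt_irrefl, if_false]
      split_ifs <;> omega
    -- Removing ε_{n-1} + ε_n from ε_a + ε_n leaves ε_a - ε_{n-1}.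
    refine ⟨Fin.last n, root _ ?_, ?_⟩
    · rw [cartan_mulVec hn, e]
      simp only [signedPair, Fin.val_last, lt_irrefl, if_false]
      split_ifs <;> omega
    · refine nonneg_of_eps hn (a := a) (b := n - 1) (t := -1) (by omega) (by omega) (by omega) ?_
      rw [hasEps, e]
      funext k
      simp only [eps_simpleRoot hn, signedPair, Fin.val_last, lt_irrefl, if_false]
      split_ifs <;> omega
  · have han : a + 1 ≠ b := by
      intro han
      apply hγ ⟨a, by omega⟩
      apply ext_of_eps hn
      intro k hk
      rw [e, eps_simpleRoot hn, signedPair]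
      simp only
      split_ifs <;> omega
    -- Removing ε_{b-1} - ε_b from ε_a - ε_b leaves ε_a - ε_{b-1}.
    refine ⟨⟨b - 1, by omega⟩, root _ ?_, ?_⟩
    · rw [cartan_mulVec hn, e]
      simp only [signedPair]
      split_ifs <;> omega
    · refine nonneg_of_eps hn (a := a) (b := b - 1) (t := -1) (by omega) (by omega) (by omega) ?_
      rw [hasEps, e]
      funext k
      simp only [eps_simpleRoot hn, signedPair]
      split_ifs <;> omega

/-! ## Sections of the repetition quiver and their readings

Vertices are pairs `(l, x)` of a level `l < n` and a position `x`; the vertex `(l, x)` precedes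
`(l', x')` when `x ≤ x'` and `x + l ≤ x' + l'`. -/

/-- A section: `c l` is the position of the section on level `l`. -/
def IsSection (n : ℕ) (c : ℕ → ℤ) : Prop :=
  ∀ l, l + 1 < n → c (l + 1) = c l ∨ c (l + 1) = c l - 1

/-- The vertex of the section on level `l` is a source of the section. -/
def Flippable (n : ℕ) (c : ℕ → ℤ) (l : ℕ) : Prop :=
  l < n ∧ (0 < l → c (l - 1) = c l + 1) ∧ (l + 1 < n → c (l + 1) = c l)

/-- Move the section forward on level `l`. -/
def flip (c : ℕ → ℤ) (l : ℕ) : ℕ → ℤ := Function.update c l (c l + 1)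

/-- The list of vertices passed when the section `c` is moved to the section `d`. -/
inductive Reads (n : ℕ) : (ℕ → ℤ) → List (ℕ × ℤ) → (ℕ → ℤ) → Prop
  | nil {c d : ℕ → ℤ} (h : ∀ l, l < n → c l = d l) : Reads n c [] d
  | cons {c d : ℕ → ℤ} {l : ℕ} {x : ℤ} {L : List (ℕ × ℤ)} (h : Flippable n c l) (hx : x = c l)
      (h' : Reads n (flip c l) L d) : Reads n c ((l, x) :: L) d

/-- Translation of a section. -/
def shift (c : ℕ → ℤ) (t : ℤ) : ℕ → ℤ := fun l => c l + t

lemma flip_self (c : ℕ → ℤ) (l : ℕ) : flip c l l = c l + 1 := by simp [flip]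

lemma flip_of_ne (c : ℕ → ℤ) {l k : ℕ} (h : k ≠ l) : flip c l k = c k := by simp [flip, h]

lemma flip_apply (c : ℕ → ℤ) (l k : ℕ) : flip c l k = if k = l then c l + 1 else c k := by
  split_ifs with h
  · rw [h, flip_self]
  · exact flip_of_ne c h

lemma flip_comm (c : ℕ → ℤ) {l k : ℕ} (h : k ≠ l) : flip (flip c l) k = flip (flip c k) l := by
  funext j
  simp only [flip_apply]
  split_ifs <;> omega

lemma flip_shift (c : ℕ → ℤ) (t : ℤ) (l : ℕ) : flip (shift c t) l = shift (flip c l) t := by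
  funext j
  simp only [flip_apply, shift]
  split_ifs <;> omega

lemma IsSection.flip {c : ℕ → ℤ} {l : ℕ} (hc : IsSection n c) (h : Flippable n c l) :
    IsSection n (flip c l) := by
  intro k hk
  have := hc k hk
  obtain ⟨h1, h2, h3⟩ := h
  simp only [flip_apply]
  split_ifs with e1 e2 e2
  · omega
  · subst e1; have := h2 (by omega); simp only [Nat.add_sub_cancel] at this; omega
  · subst e2; have := h3 hk; omega
  · exact this

lemma Flippable.congr {c d : ℕ → ℤ} {l : ℕ} (h : Flippable n c l) (e : ∀ l, l < n → c l = d l) :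
    Flippable n d l := by
  obtain ⟨h1, h2, h3⟩ := h
  refine ⟨h1, fun h => ?_, fun h => ?_⟩
  · rw [← e _ (by omega), ← e _ h1]; exact h2 h
  · rw [← e _ h, ← e _ h1]; exact h3 h

lemma Flippable.shift {c : ℕ → ℤ} {l : ℕ} (h : Flippable n c l) (t : ℤ) :
    Flippable n (shift c t) l := by
  obtain ⟨h1, h2, h3⟩ := h
  refine ⟨h1, fun h => ?_, fun h => ?_⟩
  · simp only [TwistedD.shift, h2 h]; ring
  · simp only [TwistedD.shift, h3 h]

lemma IsSection.shift {c : ℕ → ℤ} (hc : IsSection n c) (t : ℤ) : IsSection n (shift c t) := by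
  intro l hl
  have := hc l hl
  simp only [TwistedD.shift]
  omega

lemma Flippable.not_adjacent {c : ℕ → ℤ} {k l : ℕ} (hk : Flippable n c k) (hl : Flippable n c l)
    (hne : k ≠ l) : k + 1 < l ∨ l + 1 < k := by
  by_contra hcon
  have h : k + 1 = l ∨ l + 1 = k := by omega
  obtain ⟨k1, k2, k3⟩ := hk
  obtain ⟨l1, l2, l3⟩ := hl
  rcases h with rfl | rfl
  · have h1 := k3 l1; have h2 := l2 (by omega); simp only [Nat.add_sub_cancel] at h2; omega
  · have h1 := l3 k1; have h2 := k2 (by omega); simp only [Nat.add_sub_cancel] at h2; omega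

lemma Flippable.flip_iff {c : ℕ → ℤ} {k l : ℕ} (h : k + 1 < l ∨ l + 1 < k) :
    Flippable n (TwistedD.flip c k) l ↔ Flippable n c l := by
  unfold Flippable
  rw [flip_of_ne _ (show l ≠ k by omega), flip_of_ne _ (show l + 1 ≠ k by omega)]
  by_cases h0 : 0 < l
  · rw [flip_of_ne _ (show l - 1 ≠ k by omega)]
  · simp [h0]

/-- A flip breaks the equation with a neighbouring level, which exists because there are at least
two levels. Consequently the commuting letters n - 1 and n of the last level are never consecutive
in a reading. -/
lemma Flippable.not_flip_self (hn : 2 ≤ n) {c : ℕ → ℤ} {l : ℕ} (h : Flippable n c l) :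
    ¬ Flippable n (TwistedD.flip c l) l := by
  rintro ⟨-, h2, h3⟩
  obtain ⟨h1, g2, g3⟩ := h
  by_cases h0 : 0 < l
  · have := h2 h0
    rw [flip_self, flip_of_ne _ (by omega)] at this
    have := g2 h0
    omega
  · have h4 : l + 1 < n := by omega
    have := h3 h4
    rw [flip_self, flip_of_ne _ (by omega)] at this
    have := g3 h4
    omega

/-! ### Basic properties of readings -/

namespace Reads

lemma congr_left {c c' d : ℕ → ℤ} {L : List (ℕ × ℤ)} (h : Reads n c L d)
    (e : ∀ l, l < n → c l = c' l) : Reads n c' L d := by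
  induction h generalizing c' with
  | nil h => exact .nil fun l hl => by rw [← e l hl, h l hl]
  | @cons c d l x L hf hx h' ih =>
    refine .cons (hf.congr e) (by rw [hx, e l hf.1]) (ih ?_)
    intro k hk
    simp only [flip_apply]
    rw [e l hf.1, e k hk]

lemma congr_right {c d d' : ℕ → ℤ} {L : List (ℕ × ℤ)} (h : Reads n c L d)
    (e : ∀ l, l < n → d l = d' l) : Reads n c L d' := by
  induction h with
  | nil h => exact .nil fun l hl => by rw [← e l hl, h l hl]
  | cons hf hx h' ih => exact .cons hf hx (ih e)

lemma append {c d e : ℕ → ℤ} {L L' : List (ℕ × ℤ)} (h : Reads n c L d) (h' : Reads n d L' e) :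
    Reads n c (L ++ L') e := by
  induction h with
  | nil h => exact h'.congr_left fun l hl => (h l hl).symm
  | cons hf hx _ ih => exact .cons hf hx (ih h')

lemma of_append {c e : ℕ → ℤ} {L L' : List (ℕ × ℤ)} (h : Reads n c (L ++ L') e) :
    ∃ d, Reads n c L d ∧ Reads n d L' e := by
  induction L generalizing c with
  | nil => exact ⟨c, .nil fun _ _ => rfl, h⟩
  | cons v L ih =>
    cases h with
    | cons hf hx h' =>
      obtain ⟨d, h1, h2⟩ := ih h'
      exact ⟨d, .cons hf hx h1, h2⟩

lemma isSection {c d : ℕ → ℤ} {L : List (ℕ × ℤ)} (h : Reads n c L d) (hc : IsSection n c) :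
    IsSection n d := by
  induction h with
  | nil h => intro l hl; rw [← h _ hl, ← h l (by omega)]; exact hc l hl
  | cons hf _ _ ih => exact ih (hc.flip hf)

lemma le {c d : ℕ → ℤ} {L : List (ℕ × ℤ)} (h : Reads n c L d) : ∀ l, l < n → c l ≤ d l := by
  induction h with
  | nil h => exact fun l hl => (h l hl).le
  | cons hf _ _ ih =>
    intro k hk
    have := ih k hk
    rw [flip_apply] at this
    split_ifs at this with h
    · subst h; omega
    · exact this

lemma mem_iff {c d : ℕ → ℤ} {L : List (ℕ × ℤ)} (h : Reads n c L d) (k : ℕ) (y : ℤ) :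
    (k, y) ∈ L ↔ k < n ∧ c k ≤ y ∧ y < d k := by
  induction h with
  | nil h =>
    simp only [List.not_mem_nil, false_iff, not_and, not_lt]
    intro hk hy; rw [← h k hk]; exact hy
  | @cons c d l x L hf hx h' ih =>
    have hle := h'.le l hf.1
    rw [flip_self] at hle
    have hl := hf.1
    rw [List.mem_cons, ih, Prod.mk.injEq, hx]
    by_cases h : k = l
    · subst h; rw [flip_self]; omega
    · rw [flip_of_ne _ h]; omega

lemma nodup {c d : ℕ → ℤ} {L : List (ℕ × ℤ)} (h : Reads n c L d) : L.Nodup := by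
  induction h with
  | nil h => exact List.nodup_nil
  | cons hf hx h' ih =>
    refine List.nodup_cons.2 ⟨fun hm => ?_, ih⟩
    have := (h'.mem_iff _ _).1 hm
    rw [flip_self] at this
    omega

lemma length {c d : ℕ → ℤ} {L : List (ℕ × ℤ)} (h : Reads n c L d) :
    (L.length : ℤ) = ∑ l ∈ Finset.range n, (d l - c l) := by
  induction h with
  | nil h =>
    symm
    simp only [List.length_nil, Nat.cast_zero]
    exact Finset.sum_eq_zero fun l hl => by rw [h l (Finset.mem_range.1 hl)]; ring
  | @cons c d l x L hf hx h' ih =>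
    rw [List.length_cons, Nat.cast_add, ih, ← eq_sub_iff_add_eq', ← Finset.sum_sub_distrib,
      Finset.sum_eq_single l]
    · rw [flip_self]; push_cast; ring
    · intro k _ hk; rw [flip_of_ne _ hk]; ring
    · intro hl; exact absurd (Finset.mem_range.2 hf.1) hl

end Reads

lemma IsSection.mono {c : ℕ → ℤ} (hc : IsSection n c) {k l : ℕ} (hkl : k ≤ l) (hl : l < n) :
    c l ≤ c k ∧ c k + k ≤ c l + l := by
  induction l, hkl using Nat.le_induction with
  | base => exact ⟨le_rfl, le_rfl⟩
  | succ l hkl ih =>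
    have := ih (by omega)
    have := hc l hl
    push_cast
    omega

/-- A section can be moved to any later section. -/
lemma exists_reads {c d : ℕ → ℤ} (hc : IsSection n c) (hd : IsSection n d)
    (h : ∀ l, l < n → c l ≤ d l) : ∃ L, Reads n c L d := by
  induction hN : ∑ l ∈ Finset.range n, (d l - c l).toNat generalizing c with
  | zero =>
    refine ⟨[], .nil fun l hl => ?_⟩
    have := Finset.sum_eq_zero_iff.1 hN l (Finset.mem_range.2 hl)
    have := h l hl
    omega
  | succ N ih =>
    have hne : ((Finset.range n).filter fun l => c l < d l).Nonempty := by
      by_contra hcon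
      rw [Finset.not_nonempty_iff_eq_empty, Finset.filter_eq_empty_iff] at hcon
      have : ∑ l ∈ Finset.range n, (d l - c l).toNat = 0 := by
        refine Finset.sum_eq_zero fun l hl => ?_
        have := hcon hl
        omega
      omega
    -- The value 2x + l = x + (x + l) increases strictly along the vertex order, so a vertex
    -- minimising it among those still to be read is a source.
    obtain ⟨l, hl, hmin⟩ := Finset.exists_min_image _ (fun l => 2 * c l + (l : ℤ)) hne
    simp only [Finset.mem_filter, Finset.mem_range, and_imp] at hl hmin
    have hf : Flippable n c l := by
      refine ⟨hl.1, fun h0 => ?_, fun h1 => ?_⟩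
      · obtain ⟨k, rfl⟩ : ∃ k, l = k + 1 := ⟨l - 1, by omega⟩
        simp only [Nat.add_sub_cancel]
        by_contra hcon
        have h2 := hc k hl.1
        have h3 := hd k hl.1
        have h4 := h k (by omega)
        have h5 := hmin k (by omega)
        push_cast at h5
        omega
      · by_contra hcon
        have h2 := hc l h1
        have h3 := hd l h1
        have h4 := h (l + 1) h1
        have h5 := hmin (l + 1) h1
        push_cast at h5
        omega
    obtain ⟨L, hL⟩ := ih (hc.flip hf) (by
      intro k hk
      have := h k hk
      rw [flip_apply]
      split_ifs with e
      · subst e; omega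
      · exact this) (by
      have h1 := Finset.add_sum_erase _ (fun k => (d k - c k).toNat) (Finset.mem_range.2 hl.1)
      have h2 := Finset.add_sum_erase _ (fun k => (d k - flip c l k).toNat)
        (Finset.mem_range.2 hl.1)
      have h3 : ∑ k ∈ (Finset.range n).erase l, (d k - flip c l k).toNat =
          ∑ k ∈ (Finset.range n).erase l, (d k - c k).toNat :=
        Finset.sum_congr rfl fun k hk => by rw [flip_of_ne _ (Finset.ne_of_mem_erase hk)]
      simp only [flip_self] at h2
      omega)
    exact ⟨_, .cons hf rfl hL⟩

/-- In a reading, every vertex comes after all vertices below it. -/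
lemma Reads.mem_of_le {c d : ℕ → ℤ} {A B : List (ℕ × ℤ)} {l k : ℕ} {x y : ℤ} (hc : IsSection n c)
    (h : Reads n c (A ++ (l, x) :: B) d) (hk : k < n) (hcy : c k ≤ y) (h1 : y ≤ x)
    (h2 : y + k ≤ x + l) (hne : (k, y) ≠ (l, x)) : (k, y) ∈ A := by
  obtain ⟨m, hA, hB⟩ := h.of_append
  have hm := hA.isSection hc
  rw [hA.mem_iff]
  refine ⟨hk, hcy, ?_⟩
  cases hB with
  | cons hf hx _ =>
    obtain ⟨hl, f2, f3⟩ := hf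
    rcases lt_trichotomy k l with hlt | rfl | hlt
    · have := f2 (by omega)
      have := (hm.mono (show k ≤ l - 1 by omega) (by omega)).1
      omega
    · have : y ≠ x := fun e => hne (by rw [e])
      omega
    · have := f3 (by omega)
      have := (hm.mono (show l + 1 ≤ k by omega) hk).2
      push_cast at this
      omega

/-- The section just above the vertices below `(l, x)`. -/
def coneSection (l : ℕ) (x : ℤ) (k : ℕ) : ℤ := min x (x + l - k) + 1

/-- A reading in which two given vertices come before a third one which is below neither. -/
lemma exists_reads_split {c : ℕ → ℤ} (hc : IsSection n c) {l₁ l₂ k : ℕ} {x₁ x₂ y M : ℤ}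
    (h₁ : l₁ < n ∧ c l₁ ≤ x₁ ∧ x₁ < c l₁ + M) (h₂ : l₂ < n ∧ c l₂ ≤ x₂ ∧ x₂ < c l₂ + M)
    (hk : k < n ∧ c k ≤ y ∧ y < c k + M)
    (n₁ : ¬ (y ≤ x₁ ∧ y + k ≤ x₁ + l₁)) (n₂ : ¬ (y ≤ x₂ ∧ y + k ≤ x₂ + l₂)) :
    ∃ A B, Reads n c (A ++ B) (shift c M) ∧ (l₁, x₁) ∈ A ∧ (l₂, x₂) ∈ A ∧ (k, y) ∈ B := by
  -- The vertices read first form the union of the two ideals below the given vertices; (k, y) lies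
  -- in neither.
  let d : ℕ → ℤ := fun j => max (c j) (max (coneSection l₁ x₁ j) (coneSection l₂ x₂ j))
  have hd : IsSection n d := by
    intro j hj
    have := hc j hj
    simp only [d, coneSection]
    push_cast
    omega
  have hle : ∀ (l : ℕ) (x : ℤ), l < n ∧ c l ≤ x ∧ x < c l + M → ∀ j, j < n →
      coneSection l x j ≤ c j + M := by
    intro l x h j hj
    unfold coneSection
    rcases le_total j l with hjl | hjl
    · have := (hc.mono hjl h.1).1; omega
    · have := (hc.mono hjl hj).2; omega
  obtain ⟨A, hA⟩ := exists_reads hc hd (fun j _ => le_max_left _ _)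
  obtain ⟨B, hB⟩ := exists_reads hd (hc.shift M) (by
    intro j hj
    have := hle _ _ h₁ j hj
    have := hle _ _ h₂ j hj
    simp only [d, shift]
    omega)
  refine ⟨A, B, hA.append hB, (hA.mem_iff _ _).2 ?_, (hA.mem_iff _ _).2 ?_, (hB.mem_iff _ _).2 ?_⟩
  · simp only [d, coneSection]; omega
  · simp only [d, coneSection]; omega
  · simp only [d, coneSection, shift]; omega

/-! ### Uniqueness of readings up to commutations -/

/-- One swap of neighbouring vertices of non-adjacent levels. -/
def SwapStep (L L' : List (ℕ × ℤ)) : Prop :=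
  ∃ A B u v, (u.1 + 1 < v.1 ∨ v.1 + 1 < u.1) ∧ L = A ++ u :: v :: B ∧ L' = A ++ v :: u :: B

lemma SwapStep.eqvGen_cons {L L' : List (ℕ × ℤ)} (v : ℕ × ℤ) (h : Relation.EqvGen SwapStep L L') :
    Relation.EqvGen SwapStep (v :: L) (v :: L') := by
  induction h with
  | rel _ _ h =>
    obtain ⟨A, B, u, w, h, rfl, rfl⟩ := h
    exact .rel _ _ ⟨v :: A, B, u, w, h, rfl, rfl⟩
  | refl => exact .refl _
  | symm _ _ _ ih => exact .symm _ _ ih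
  | trans _ _ _ _ _ ih1 ih2 => exact .trans _ _ _ ih1 ih2

/-- A source stays a source until it is read, and two sources never have adjacent levels. So
everything read before (l, x) can be moved past it. -/
lemma Reads.bring_front {c d : ℕ → ℤ} {l : ℕ} {x : ℤ} {A B : List (ℕ × ℤ)}
    (hf : Flippable n c l) (hx : x = c l) (hA : (l, x) ∉ A)
    (h : Reads n c (A ++ (l, x) :: B) d) :
    Reads n (flip c l) (A ++ B) d ∧
      Relation.EqvGen SwapStep (A ++ (l, x) :: B) ((l, x) :: (A ++ B)) := by
  induction A generalizing c with
  | nil =>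
    cases h with
    | cons _ _ h' => exact ⟨h', .refl _⟩
  | cons v A ih =>
    cases h with
    | @cons _ _ k y _ hk hy h' =>
      have hne : k ≠ l := by
        rintro rfl; apply hA; rw [hx, hy]; exact List.mem_cons_self
      have hna := hk.not_adjacent hf hne
      obtain ⟨h1, h2⟩ := ih ((Flippable.flip_iff hna).2 hf) (by rw [flip_of_ne _ hne.symm, hx])
        (fun h => hA (List.mem_cons_of_mem _ h)) h'
      refine ⟨.cons ((Flippable.flip_iff hna.symm).2 hk) (by rw [flip_of_ne _ hne, hy]) ?_, ?_⟩
      · rw [flip_comm _ hne]; exact h1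
      · refine .trans _ _ _ (SwapStep.eqvGen_cons _ h2) (.rel _ _ ⟨[], A ++ B, _, _, ?_, rfl, rfl⟩)
        exact hna

lemma Reads.eqvGen {c d : ℕ → ℤ} {L L' : List (ℕ × ℤ)} (h : Reads n c L d) (h' : Reads n c L' d) :
    Relation.EqvGen SwapStep L L' := by
  induction h generalizing L' with
  | nil h =>
    cases h' with
    | nil => exact .refl _
    | @cons _ _ l x L hf hx h' =>
      have h1 := h'.le l hf.1
      rw [flip_self] at h1
      have := h l hf.1
      omega
  | @cons c d l x L hf hx hL ih =>
    have hm : (l, x) ∈ L' := by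
      rw [h'.mem_iff]
      have := hL.le l hf.1
      rw [flip_self] at this
      exact ⟨hf.1, by omega, by omega⟩
    obtain ⟨A, B, rfl, hA⟩ := List.eq_append_cons_of_mem hm
    obtain ⟨h1, h2⟩ := Reads.bring_front hf hx hA h'
    exact .trans _ _ _ (SwapStep.eqvGen_cons _ (ih h1)) (.symm _ _ h2)

/-! ### Words of readings -/

/-- The letter of a vertex. On the last level the letters `n - 1` and `n` alternate. -/
def letter (n : ℕ) (v : ℕ × ℤ) : Fin (n + 1) :=
  if v.1 + 1 = n ∧ Odd v.2 then Fin.last n else Fin.ofNat (n + 1) v.1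

lemma letter_val {v : ℕ × ℤ} (hv : v.1 < n) :
    (letter n v).val = if v.1 + 1 = n ∧ Odd v.2 then n else v.1 := by
  unfold letter
  split_ifs
  · rfl
  · simp only [Fin.ofNat]; exact Nat.mod_eq_of_lt (by omega)

lemma letter_val_cases {v : ℕ × ℤ} (hv : v.1 < n) :
    (letter n v).val = v.1 ∨ (v.1 + 1 = n ∧ (letter n v).val = n) := by
  rw [letter_val hv]; split_ifs with h <;> simp [h]

lemma cartan_eq_zero_iff (hn : 2 ≤ n) (i j : Fin (n + 1)) : CartanMatrix.D (n + 1) i j = 0 ↔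
    i ≠ j ∧ ¬ (i.val + 1 = j.val ∧ j.val < n) ∧ ¬ (j.val + 1 = i.val ∧ i.val < n) ∧
      ¬ (i.val + 2 = n ∧ j.val = n) ∧ ¬ (j.val + 2 = n ∧ i.val = n) := by
  have hi := i.2
  have hj := j.2
  simp only [CartanMatrix.D, Matrix.of_apply, ne_eq, Fin.ext_iff]
  split_ifs <;> constructor <;> intro h <;> first | omega | (exfalso; revert h; norm_num)

lemma SwapStep.commStep (hn : 2 ≤ n) {L L' : List (ℕ × ℤ)} (hL : ∀ v ∈ L, v.1 < n)
    (h : SwapStep L L') : CommStep n (L.map (letter n)) (L'.map (letter n)) := by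
  obtain ⟨A, B, u, v, h, rfl, rfl⟩ := h
  have hu : u.1 < n := hL u (by simp)
  have hv : v.1 < n := hL v (by simp)
  refine ⟨A.map (letter n), B.map (letter n), letter n u, letter n v, ?_, by simp, by simp⟩
  rw [cartan_eq_zero_iff hn, ne_eq, Fin.ext_iff]
  have := letter_val_cases hu
  have := letter_val_cases hv
  omega

lemma SwapStep.commEquiv (hn : 2 ≤ n) {L L' : List (ℕ × ℤ)} (h : Relation.EqvGen SwapStep L L') :
    ((∀ v ∈ L, v.1 < n) ↔ (∀ v ∈ L', v.1 < n)) ∧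
    ((∀ v ∈ L, v.1 < n) → CommEquiv n (L.map (letter n)) (L'.map (letter n))) := by
  induction h with
  | rel L L' h =>
    refine ⟨?_, fun hL => .rel _ _ (h.commStep hn hL)⟩
    obtain ⟨A, B, u, v, h, rfl, rfl⟩ := h
    simp only [List.mem_append, List.mem_cons]
    constructor <;> intro h w hw <;> apply h <;> tauto
  | refl => exact ⟨Iff.rfl, fun _ => .refl _⟩
  | symm _ _ _ ih => exact ⟨ih.1.symm, fun h => .symm _ _ (ih.2 (ih.1.2 h))⟩
  | trans _ _ _ _ _ ih1 ih2 =>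
    exact ⟨ih1.1.trans ih2.1, fun h => .trans _ _ _ (ih1.2 h) (ih2.2 (ih1.1.1 h))⟩

lemma Reads.commEquiv (hn : 2 ≤ n) {c d : ℕ → ℤ} {L L' : List (ℕ × ℤ)} (h : Reads n c L d)
    (h' : Reads n c L' d) : CommEquiv n (L.map (letter n)) (L'.map (letter n)) :=
  (SwapStep.commEquiv hn (h.eqvGen h')).2 fun v hv => ((h.mem_iff v.1 v.2).1 hv).1

/-- Two consecutive vertices with commuting letters have distinct levels by
`Flippable.not_flip_self`, and then non-adjacent ones, so both orders of reading them are
legitimate. Hence being a reading depends only on the commutation class. -/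
lemma Reads.exists_of_commStep (hn : 2 ≤ n) {c d : ℕ → ℤ} {L : List (ℕ × ℤ)} {w' : Word n}
    (h : Reads n c L d) (hw : CommStep n (L.map (letter n)) w') :
    ∃ L', Reads n c L' d ∧ w' = L'.map (letter n) := by
  obtain ⟨u, v, i, j, hij, e, rfl⟩ := hw
  obtain ⟨A, B', rfl, rfl, e1⟩ := List.map_eq_append_iff.1 e
  obtain ⟨a, B1, rfl, rfl, e2⟩ := List.map_eq_cons_iff.1 e1
  obtain ⟨b, B, rfl, rfl, rfl⟩ := List.map_eq_cons_iff.1 e2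
  refine ⟨A ++ b :: a :: B, ?_, by simp⟩
  obtain ⟨m, hA, hB⟩ := h.of_append
  refine hA.append ?_
  cases hB with
  | @cons _ _ k x _ hk hx h1 =>
    cases h1 with
    | @cons _ _ l y _ hl hy h2 =>
      have hne : l ≠ k := by
        rintro rfl; exact hk.not_flip_self hn hl
      have hna : k + 1 < l ∨ l + 1 < k := by
        by_contra hcon
        rw [cartan_eq_zero_iff hn, ne_eq, Fin.ext_iff] at hij
        have := letter_val_cases (v := (k, x)) hk.1
        have := letter_val_cases (v := (l, y)) hl.1
        have := hk.1
        have := hl.1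
        simp only at *
        omega
      refine .cons ((Flippable.flip_iff hna).1 hl) (by rw [hy, flip_of_ne _ hne])
        (.cons ((Flippable.flip_iff hna.symm).2 hk) (by rw [hx, flip_of_ne _ hne.symm]) ?_)
      rw [flip_comm _ hne.symm]
      exact h2

lemma CommStep.symm {w w' : Word n} (h : CommStep n w w') (hn : 2 ≤ n) : CommStep n w' w := by
  obtain ⟨u, v, i, j, hij, e, e'⟩ := h
  refine ⟨u, v, j, i, ?_, e', e⟩
  rw [cartan_eq_zero_iff hn] at hij ⊢
  obtain ⟨h1, h2, h3, h4, h5⟩ := hij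
  exact ⟨h1.symm, h3, h2, h5, h4⟩

/-- The words of readings of a given pair of sections. -/
def IsReadingWord (n : ℕ) (c d : ℕ → ℤ) (w : Word n) : Prop :=
  ∃ L, Reads n c L d ∧ w = L.map (letter n)

lemma isReadingWord_of_commEquiv (hn : 2 ≤ n) {c d : ℕ → ℤ} {w w' : Word n}
    (h : CommEquiv n w w') : IsReadingWord n c d w ↔ IsReadingWord n c d w' := by
  have key : ∀ w w' : Word n, CommStep n w w' → IsReadingWord n c d w → IsReadingWord n c d w' := by
    rintro w w' h ⟨L, hL, rfl⟩
    exact hL.exists_of_commStep hn h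
  induction h with
  | rel _ _ h => exact ⟨key _ _ h, key _ _ (h.symm hn)⟩
  | refl => exact Iff.rfl
  | symm _ _ _ ih => exact ih.symm
  | trans _ _ _ _ _ ih1 ih2 => exact ih1.trans ih2

/-- The words which read a section and its translate by `n + 1`. -/
def IsTurn (n : ℕ) (w : Word n) : Prop :=
  ∃ c, IsSection n c ∧ IsReadingWord n c (shift c (n + 1)) w

lemma vee_pow_castSucc (hn : 2 ≤ n) (k : ℕ) (q : Fin n) :
    (vee n ^ k) q.castSucc = letter n (q.val, (k : ℤ)) := by
  have hq := q.2
  have h2 : vee n ^ 2 = 1 := by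
    rw [pow_two]; exact Equiv.swap_mul_self _ _
  have hlet : ∀ x : ℤ, ¬ (q.val + 1 = n ∧ Odd x) → letter n (q.val, x) = q.castSucc := by
    intro x h
    rw [letter, if_neg h]
    apply Fin.ext
    simp only [Fin.ofNat, Fin.val_castSucc]
    exact Nat.mod_eq_of_lt (by omega)
  rcases Nat.even_or_odd' k with ⟨r, rfl | rfl⟩
  · rw [pow_mul, h2, one_pow, hlet]
    · rfl
    · rintro ⟨-, h⟩
      rw [← Int.not_even_iff_odd] at h
      exact h ⟨r, by push_cast; ring⟩
  · rw [pow_succ, pow_mul, h2, one_pow, one_mul]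
    by_cases h : q.val + 1 = n
    · rw [letter, if_pos ⟨h, ⟨r, by push_cast; ring⟩⟩]
      have : q.castSucc = ⟨n - 1, by omega⟩ := by
        apply Fin.ext; simp only [Fin.val_castSucc]; omega
      rw [this]
      exact Equiv.swap_apply_left _ _
    · rw [hlet _ fun h' => h h'.1]
      exact vee_of_lt _ (by simp only [Fin.val_castSucc]; omega)

lemma reads_row (k : ℤ) (m j : ℕ) (h : m + j = n) :
    Reads n (fun l => if l < m then k + 1 else k) ((List.range' m j).map fun q => (q, k))
      (fun _ => k + 1) := by
  induction j generalizing m with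
  | zero => exact .nil fun l hl => by rw [if_pos (by omega)]
  | succ j ih =>
    rw [List.range'_succ, List.map_cons]
    refine .cons ⟨by omega, fun _ => ?_, fun _ => ?_⟩ (by simp) ((ih (m + 1) (by omega)).congr_left ?_)
    · simp only; rw [if_pos (by omega), if_neg (by omega)]
    · simp only; rw [if_neg (by omega), if_neg (by omega)]
    · intro l _
      simp only [flip_apply]
      split_ifs <;> omega

/-- The base word reads the constant section row by row: block k consists of the vertices (q, k),
and the twist by ∨ is the alternation of letters on the last level. -/
lemma isTurn_baseWord (hn : 2 ≤ n) : IsTurn n (baseWord n) := by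
  have row : ∀ k : ℕ, Reads n (fun _ => (k : ℤ)) ((List.range n).map fun q => (q, (k : ℤ)))
      (fun _ => ((k + 1 : ℕ) : ℤ)) := by
    intro k
    rw [List.range_eq_range']
    have := (reads_row (n := n) (k : ℤ) 0 n (by omega)).congr_left (c' := fun _ => (k : ℤ))
      (fun l _ => by rw [if_neg (by omega)])
    push_cast
    exact this
  have rows : ∀ k : ℕ, Reads n (fun _ => 0)
      ((List.range k).flatMap fun k : ℕ => (List.range n).map fun q => (q, (k : ℤ)))
      (fun _ => (k : ℤ)) := by
    intro k
    induction k with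
    | zero => exact .nil fun _ _ => by simp
    | succ k ih =>
      rw [List.range_succ, List.flatMap_append]
      refine ih.append ?_
      simpa using row k
  refine ⟨fun _ => 0, fun _ _ => Or.inl rfl, _, (rows (n + 1)).congr_right ?_, ?_⟩
  · intro l _; simp [shift]
  · unfold baseWord
    rw [List.map_flatMap]
    congr 1
    funext k
    rw [← List.map_coe_finRange_eq_range, List.map_map, List.map_map]
    apply List.map_congr_left
    intro q _
    exact vee_pow_castSucc hn k q

/-! ## Signed orthonormal vectors attached to a section -/

/-- The point added by the section `c` on level `j`. -/
def pt (c : ℕ → ℤ) (j : ℕ) : ℤ := if j = 0 ∨ c j = c (j - 1) then c j + j else c j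

lemma pt_succ (c : ℕ → ℤ) (j : ℕ) :
    pt c (j + 1) = if c (j + 1) = c j then c (j + 1) + j + 1 else c (j + 1) := by
  unfold pt
  simp only [Nat.add_sub_cancel, Nat.add_eq_zero_iff, one_ne_zero, and_false, false_or]
  push_cast
  split_ifs <;> ring

lemma pt_bounds (c : ℕ → ℤ) (j : ℕ) : c j ≤ pt c j ∧ pt c j ≤ c j + j := by
  unfold pt; split_ifs <;> omega

/-- The points of levels 0, …, a fill exactly the interval from c a to c a + a: the next level adds
its right neighbour if the section stays and its left neighbour if the section drops. `pt_not_mem`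
and `exists_pt` are the other halves of this fact. -/
lemma pt_mem {c : ℕ → ℤ} (hc : IsSection n c) {a b : ℕ} (hab : b ≤ a) (ha : a < n) :
    c a ≤ pt c b ∧ pt c b ≤ c a + a := by
  have := hc.mono hab ha
  have := pt_bounds c b
  omega

lemma pt_not_mem {c : ℕ → ℤ} (hc : IsSection n c) {a b : ℕ} (hab : a < b) (hb : b < n) :
    pt c b < c a ∨ c a + a < pt c b := by
  obtain ⟨d, rfl⟩ : ∃ d, b = d + 1 := ⟨b - 1, by omega⟩
  have h1 := hc.mono (show a ≤ d by omega) (by omega)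
  have h2 := hc d hb
  rw [pt_succ]
  split_ifs <;> omega

lemma exists_pt {c : ℕ → ℤ} (hc : IsSection n c) {a : ℕ} (ha : a < n) {x : ℤ} (h1 : c a ≤ x)
    (h2 : x ≤ c a + a) : ∃ b, b ≤ a ∧ pt c b = x := by
  induction a with
  | zero => exact ⟨0, le_rfl, by unfold pt; simp at h2 ⊢; omega⟩
  | succ a ih =>
    have h3 := hc a ha
    push_cast at h2
    by_cases h : c a ≤ x ∧ x ≤ c a + a
    · obtain ⟨b, hb, e⟩ := ih (by omega) h.1 h.2
      exact ⟨b, by omega, e⟩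
    · refine ⟨a + 1, le_rfl, ?_⟩
      rw [pt_succ]
      split_ifs <;> omega

lemma pt_injective {c : ℕ → ℤ} (hc : IsSection n c) {a b : ℕ} (ha : a < n) (hb : b < n)
    (h : pt c a = pt c b) : a = b := by
  rcases lt_trichotomy a b with hlt | h' | hlt
  · have := pt_not_mem hc hlt hb
    have := pt_bounds c a
    omega
  · exact h'
  · have := pt_not_mem hc hlt ha
    have := pt_bounds c b
    omega

/-- The sign `(-1)^x`. -/
def par (x : ℤ) : ℤ := if Even x then 1 else -1

lemma par_cases (x : ℤ) : par x = 1 ∨ par x = -1 := by unfold par; split_ifs <;> simp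

lemma par_odd (x : ℤ) : par x = if Odd x then -1 else 1 := by
  simp only [par, ← Int.not_even_iff_odd]
  split_ifs <;> rfl

lemma par_add_one (x : ℤ) : par (x + 1) = -par x := by
  unfold par
  simp only [Int.even_add_one]
  split_ifs <;> simp_all

lemma par_add (x y : ℤ) : par (x + y) = par x * par y := by
  unfold par
  simp only [Int.even_add]
  split_ifs <;> simp_all

/-- Signed orthonormal basis vectors `e_x = sgn x • ε_{idx x}` with `e_{x + n + 1} = -e_x`, such
that the first `n` basis vectors are read off the section `c`. -/
structure Frame (n : ℕ) (c : ℕ → ℤ) where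
  sgn : ℤ → ℤ
  idx : ℤ → ℕ
  sgn_cases : ∀ x, sgn x = 1 ∨ sgn x = -1
  sgn_add : ∀ x t, sgn (x + t * (n + 1)) = par t * sgn x
  idx_add : ∀ x t, idx (x + t * (n + 1)) = idx x
  idx_inj : ∀ x y, idx x = idx y → ∃ t, y = x + t * (n + 1)
  sgn_pt : ∀ j, j < n → sgn (pt c j) = 1
  idx_pt : ∀ j, j < n → idx (pt c j) = j
  sgn_last : sgn (c (n - 1) + n) = par (c (n - 1))
  idx_last : idx (c (n - 1) + n) = n

lemma ediv_emod_shift (x t A M : ℤ) (hM : 0 < M) :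
    (x + t * M - A) / M = (x - A) / M + t ∧ (x + t * M - A) % M = (x - A) % M := by
  have : x + t * M - A = (x - A) + t * M := by ring
  rw [this]
  exact ⟨Int.add_mul_ediv_right _ _ hM.ne', Int.add_mul_emod_self_right _ _ _⟩

/-- The points of the section together with c (n - 1) + n are n + 1 consecutive integers. Index and
sign are prescribed on them and extended by e_{x+n+1} = -e_x, using quotient and remainder modulo n
+ 1. -/
lemma exists_frame (hn : 2 ≤ n) {c : ℕ → ℤ} (hc : IsSection n c) : Nonempty (Frame n c) := by
  have hM : (0 : ℤ) < (n : ℤ) + 1 := by omega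
  let A := c (n - 1)
  have hex : ∀ r : ℤ, ∃ j : ℕ, 0 ≤ r → r < n → j < n ∧ pt c j = A + r := by
    intro r
    by_cases h : 0 ≤ r ∧ r < n
    · obtain ⟨b, hb, e⟩ := exists_pt hc (show n - 1 < n by omega) (x := A + r)
        (by simp only [A]; omega) (by simp only [A]; omega)
      exact ⟨b, fun _ _ => ⟨by omega, e⟩⟩
    · exact ⟨0, fun h1 h2 => absurd ⟨h1, h2⟩ h⟩
  choose J hJ using hex
  let q : ℤ → ℤ := fun x => (x - A) / (n + 1)
  let r : ℤ → ℤ := fun x => (x - A) % (n + 1)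
  have hr0 : ∀ x, 0 ≤ r x := fun x => Int.emod_nonneg _ hM.ne'
  have hr1 : ∀ x, r x < n + 1 := fun x => Int.emod_lt_of_pos _ hM
  have hqr : ∀ x, x = A + r x + q x * (n + 1) := by
    intro x
    have := Int.emod_add_mul_ediv (x - A) (n + 1)
    simp only [r, q]
    linarith
  have hsmall : ∀ x, A ≤ x → x ≤ A + n → q x = 0 ∧ r x = x - A := by
    intro x h1 h2
    exact ⟨Int.ediv_eq_zero_of_lt (by omega) (by omega), Int.emod_eq_of_lt (by omega) (by omega)⟩
  have hqs : ∀ x t, q (x + t * (n + 1)) = q x + t := fun x t => (ediv_emod_shift x t A _ hM).1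
  have hrs : ∀ x t, r (x + t * (n + 1)) = r x := fun x t => (ediv_emod_shift x t A _ hM).2
  have hpt : ∀ j, j < n → q (pt c j) = 0 ∧ r (pt c j) = pt c j - A ∧ pt c j < A + n := by
    intro j hj
    have h1 := pt_mem hc (show j ≤ n - 1 by omega) (by omega)
    have h2 := hsmall (pt c j) h1.1 (by simp only [A]; omega)
    exact ⟨h2.1, h2.2, by simp only [A]; omega⟩
  refine ⟨⟨fun x => par (q x) * (if r x = n then par A else 1),
    fun x => if r x < n then J (r x) else n, ?_, ?_, ?_, ?_, ?_, ?_, ?_, ?_⟩⟩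
  · intro x
    have h1 := par_cases (q x)
    have h2 := par_cases A
    split_ifs <;> rcases h1 with h1 | h1 <;> rcases h2 with h2 | h2 <;> simp [h1, h2]
  · intro x t
    rw [hqs, hrs, par_add]
    ring
  · intro x t
    rw [hrs]
  · intro x y h
    have hxy : r x = r y := by
      have a1 := hr0 x
      have a2 := hr1 x
      have a3 := hr0 y
      have a4 := hr1 y
      split_ifs at h with h1 h2 h2
      · have b1 := (hJ _ a1 h1).2
        have b2 := (hJ _ a3 h2).2
        rw [h] at b1
        omega
      · have := (hJ _ a1 h1).1; omega
      · have := (hJ _ a3 h2).1; omega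
      · omega
    refine ⟨q y - q x, ?_⟩
    have h1 := hqr x
    have h2 := hqr y
    rw [hxy] at h1
    linarith
  · intro j hj
    obtain ⟨h1, h2, h3⟩ := hpt j hj
    rw [h1, if_neg (by omega)]
    simp [par]
  · intro j hj
    obtain ⟨h1, h2, h3⟩ := hpt j hj
    rw [if_pos (by omega)]
    have h4 := hJ (r (pt c j)) (hr0 _) (by omega)
    exact pt_injective hc h4.1 hj (by rw [h4.2, h2]; ring)
  · obtain ⟨h1, h2⟩ := hsmall (A + n) (by omega) (by omega)
    rw [show c (n - 1) = A from rfl, h1, h2, if_pos (by ring)]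
    simp [par]
  · obtain ⟨h1, h2⟩ := hsmall (A + n) (by omega) (by omega)
    rw [show c (n - 1) = A from rfl, h2, if_neg (by omega)]

/-! ### Coefficients and scalar products in a frame -/

namespace Frame

variable {c : ℕ → ℤ} (E : Frame n c)

/-- The coefficient at `e_x`. -/
def coef (x : ℤ) (F : ℕ → ℤ) : ℤ := E.sgn x * F (E.idx x)

/-- The scalar product of `e_x` and `e_y`. -/
def chi (x y : ℤ) : ℤ := if E.idx x = E.idx y then E.sgn x * E.sgn y else 0

lemma sgn_sq (x : ℤ) : E.sgn x * E.sgn x = 1 := by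
  rcases E.sgn_cases x with h | h <;> rw [h] <;> rfl

lemma chi_comm (x y : ℤ) : E.chi x y = E.chi y x := by
  unfold chi; simp only [eq_comm, mul_comm]

lemma chi_self (x : ℤ) : E.chi x x = 1 := by simp [chi, E.sgn_sq]

lemma chi_shift (x y t : ℤ) : E.chi x (y + t * (n + 1)) = par t * E.chi x y := by
  unfold chi; rw [E.idx_add, E.sgn_add]; split_ifs <;> ring

lemma chi_shift_left (x y t : ℤ) : E.chi (x + t * (n + 1)) y = par t * E.chi x y := by
  rw [chi_comm, chi_shift, chi_comm]

lemma coef_shift (x t : ℤ) (F : ℕ → ℤ) : E.coef (x + t * (n + 1)) F = par t * E.coef x F := by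
  unfold coef; rw [E.idx_add, E.sgn_add]; ring

lemma chi_add (x y : ℤ) : E.chi x (y + (n + 1)) = -E.chi x y := by
  have := E.chi_shift x y 1
  rw [one_mul] at this
  rw [this]; simp [par]

lemma coef_add (x : ℤ) (F : ℕ → ℤ) : E.coef (x + (n + 1)) F = -E.coef x F := by
  have := E.coef_shift x 1 F
  rw [one_mul] at this
  rw [this]; simp [par]

lemma idx_ne {x y : ℤ} (h : x ≠ y) (h1 : x - y < n + 1) (h2 : y - x < n + 1) :
    E.idx x ≠ E.idx y := by
  intro e
  obtain ⟨t, ht⟩ := E.idx_inj x y e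
  have hM : (0 : ℤ) < (n : ℤ) + 1 := by omega
  rcases lt_trichotomy t 0 with h0 | h0 | h0
  · nlinarith
  · subst h0; apply h; rw [ht]; ring
  · nlinarith

lemma chi_eq_zero {x y : ℤ} (h : x ≠ y) (h1 : x - y < n + 1) (h2 : y - x < n + 1) :
    E.chi x y = 0 := if_neg (E.idx_ne h h1 h2)

lemma chi_eq {k p : ℤ} (h1 : p - k < 2 * (n + 1)) (h2 : k - p < 2 * (n + 1)) :
    E.chi k p = if p = k then 1 else if p = k + (n + 1) ∨ k = p + (n + 1) then -1 else 0 := by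
  split_ifs with h3 h4
  · rw [h3, chi_self]
  · rcases h4 with h4 | h4
    · rw [h4, chi_add, chi_self]
    · rw [h4, chi_comm, chi_add, chi_self]
  · rcases lt_trichotomy (p - k) (-(n + 1)) with h | h | h
    · have := E.chi_add k p
      rw [E.chi_eq_zero (by omega) (by omega) (by omega)] at this
      omega
    · omega
    · by_cases h' : p - k < n + 1
      · exact E.chi_eq_zero (Ne.symm h3) (by omega) (by omega)
      · have := E.chi_add k (p - (n + 1))
        rw [sub_add_cancel, E.chi_eq_zero (x := k) (y := p - (n + 1))
          (by omega) (by omega) (by omega)] at this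
        omega

/-- The vector with coordinates `f` in the frame of the section `d` has coordinates `F` in the
frame of the section `c`. -/
def Rel (d : ℕ → ℤ) (f F : ℕ → ℤ) : Prop :=
  (∀ j, j < n → E.coef (pt d j) F = f j) ∧ par (d (n - 1)) * E.coef (d (n - 1) + n) F = f n

lemma rel_base (F : ℕ → ℤ) : E.Rel c F F := by
  refine ⟨fun j hj => ?_, ?_⟩
  · rw [coef, E.sgn_pt j hj, E.idx_pt j hj, one_mul]
  · rw [coef, E.sgn_last, E.idx_last]
    rcases par_cases (c (n - 1)) with h | h <;> rw [h] <;> ring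

end Frame

lemma pt_flip_of_ne (d : ℕ → ℤ) {l j : ℕ} (h1 : j ≠ l) (h2 : j ≠ l + 1) :
    pt (flip d l) j = pt d j := by
  unfold pt
  by_cases h0 : j = 0
  · simp only [h0, true_or, if_true]; rw [flip_of_ne]; omega
  · rw [flip_of_ne _ h1, flip_of_ne _ (show j - 1 ≠ l by omega)]

lemma Flippable.pt_flip {d : ℕ → ℤ} {l : ℕ} (h : Flippable n d l) :
    pt (flip d l) l = d l + l + 1 := by
  unfold pt
  rw [flip_self, if_pos]
  · ring
  · by_cases h0 : l = 0
    · exact Or.inl h0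
    · right; rw [flip_of_ne _ (by omega), h.2.1 (by omega)]

lemma Flippable.pt_flip_succ {d : ℕ → ℤ} {l : ℕ} (h : Flippable n d l) (hl : l + 1 < n) :
    pt (flip d l) (l + 1) = d l := by
  unfold pt
  rw [flip_of_ne _ (by omega), h.2.2 hl, if_neg]
  simp only [Nat.add_sub_cancel, flip_self]
  omega

lemma Flippable.pt_eq {d : ℕ → ℤ} {l : ℕ} (h : Flippable n d l) : pt d l = d l := by
  unfold pt
  by_cases h0 : l = 0
  · subst h0; simp
  · rw [if_neg]
    have := h.2.1 (by omega)
    omega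

lemma Flippable.pt_succ {d : ℕ → ℤ} {l : ℕ} (h : Flippable n d l) (hl : l + 1 < n) :
    pt d (l + 1) = d l + l + 1 := by
  unfold pt
  rw [if_pos, h.2.2 hl]
  · push_cast; ring
  · right; simp only [Nat.add_sub_cancel]; exact h.2.2 hl

/-- Below the last level, a flip exchanges the points of levels l and l + 1, just as s_l exchanges
two coordinates. This is the inductive step that converts words into translations of indices. -/
lemma Frame.rel_flip (hn : 2 ≤ n) {c : ℕ → ℤ} (E : Frame n c) {d : ℕ → ℤ} {l : ℕ}
    (h : Flippable n d l) {f F : ℕ → ℤ} (hR : E.Rel d (refl n (letter n (l, d l)) f) F) :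
    E.Rel (flip d l) f F := by
  obtain ⟨h1, h2⟩ := hR
  have hl := h.1
  have hval := letter_val (n := n) (v := (l, d l)) hl
  by_cases hl' : l + 1 < n
  · rw [if_neg (by simp only; omega)] at hval
    rw [hval] at h1 h2
    simp only at h1 h2
    simp only [refl, hl, if_true] at h1 h2
    refine ⟨fun j hj => ?_, ?_⟩
    · by_cases j1 : j = l
      · subst j1
        rw [h.pt_flip, ← h.pt_succ hl', h1 _ hl', if_neg (by omega), if_pos rfl]
      by_cases j2 : j = l + 1
      · subst j2
        rw [h.pt_flip_succ hl', ← h.pt_eq, h1 _ hl, if_pos rfl]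
      rw [pt_flip_of_ne _ j1 j2, h1 j hj, if_neg j1, if_neg j2]
    · rw [flip_of_ne _ (by omega), h2, if_neg (by omega), if_neg (by omega)]
  -- On the last level the point d l is replaced by d l + n, and the extra vector becomes e_{d l + n
  -- + 1} = -e_{d l}. The parity sign of the extra vector changes at each flip, which is why the
  -- letters n - 1 and n must alternate.
  · have hln : n = l + 1 := by omega
    have g1 := h1 l hl
    rw [h.pt_eq] at g1
    have hcast : (n : ℤ) = l + 1 := by omega
    have key : E.coef (d l + n) F = f l ∧ par (d l) * E.coef (d l) F = f n := by
      have hpar := par_odd (d l)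
      have e1 : n - 1 = l := by omega
      rw [e1] at h2
      by_cases ho : Odd (d l)
      · rw [if_pos ⟨hln.symm, ho⟩] at hval
        rw [hval] at g1 h2
        simp only [refl, lt_irrefl, if_false, e1] at g1 h2
        rw [if_pos hln.symm] at g1
        rw [if_neg (by omega), if_true] at h2
        rw [hpar, if_pos ho] at h2 ⊢
        omega
      · rw [if_neg (by simp only; tauto)] at hval
        rw [hval] at g1 h2
        simp only [refl, hl, if_true] at g1 h2
        rw [← hln] at g1 h2
        rw [if_neg (by omega), if_pos rfl] at h2
        rw [hpar, if_neg ho] at h2 ⊢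
        omega
    refine ⟨fun j hj => ?_, ?_⟩
    · by_cases j1 : j = l
      · subst j1
        rw [h.pt_flip, ← key.1]; congr 1; omega
      · rw [pt_flip_of_ne _ j1 (by omega), h1 j hj]
        rcases letter_val_cases (n := n) (v := (l, d l)) hl with e | ⟨-, e⟩ <;> rw [e] <;>
          simp only [refl, hl, lt_irrefl, if_true, if_false] <;>
          rw [if_neg (by omega), if_neg (by omega)]
    · have e1 : n - 1 = l := by omega
      rw [e1, flip_self, par_add_one, show d l + 1 + (n : ℤ) = d l + (n + 1) by ring,
        E.coef_add, ← key.2]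
      ring

lemma Frame.rel_reads (hn : 2 ≤ n) {c : ℕ → ℤ} (E : Frame n c) {d d' : ℕ → ℤ} {L : List (ℕ × ℤ)}
    (h : Reads n d L d') {f F : ℕ → ℤ} (hR : E.Rel d (reflWord n (L.map (letter n)) f) F) :
    E.Rel d' f F := by
  induction h with
  | @nil d d' h =>
    obtain ⟨h1, h2⟩ := hR
    have hpt : ∀ j, j < n → pt d j = pt d' j := by
      intro j hj; unfold pt; rw [h j hj, h (j - 1) (by omega)]
    refine ⟨fun j hj => ?_, ?_⟩
    · rw [← hpt j hj]; exact h1 j hj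
    · rw [← h _ (by omega)]; exact h2
  | cons hf hx _ ih =>
    apply ih
    apply E.rel_flip hn hf
    rw [← hx]
    exact hR

/-! ### The action of a turn -/

/-- Translating the section by n + 1 negates every e_x. The last coordinate also carries the sign
(-1)^{c (n - 1)}, which contributes the extra factor. In particular the action does not depend on
the turn. -/
lemma turn_act (hn : 2 ≤ n) {w : Word n} (hw : IsTurn n w) (f : ℕ → ℤ) :
    (∀ j, j < n → reflWord n w f j = -f j) ∧ reflWord n w f n = -par (n + 1) * f n := by
  obtain ⟨c, hc, L, hL, rfl⟩ := hw
  obtain ⟨E⟩ := exists_frame hn hc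
  obtain ⟨h1, h2⟩ := E.rel_reads hn hL (f := f) (E.rel_base _)
  obtain ⟨g1, g2⟩ := E.rel_base (reflWord n (L.map (letter n)) f)
  have hpt : ∀ j, pt (shift c (n + 1)) j = pt c j + (n + 1) := by
    intro j; unfold pt shift; simp only [add_left_inj]; split_ifs <;> ring
  refine ⟨fun j hj => ?_, ?_⟩
  · rw [← g1 j hj, ← h1 j hj, hpt, E.coef_add]; ring
  · rw [← g2, ← h2]
    simp only [shift]
    rw [par_add (c (n - 1)), show c (n - 1) + ((n : ℤ) + 1) + n = c (n - 1) + n + (n + 1) by ring, E.coef_add]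
    rcases par_cases (n + 1) with e | e <;> rw [e] <;> ring

lemma turn_eq (hn : 2 ≤ n) {w w' : Word n} (hw : IsTurn n w) (hw' : IsTurn n w') :
    wordAct n w = wordAct n w' := by
  funext v
  apply ext_of_eps hn
  intro k hk
  rw [eps_wordAct hn, eps_wordAct hn]
  rcases hk.lt_or_eq with h | rfl
  · rw [(turn_act hn hw _).1 k h, (turn_act hn hw' _).1 k h]
  · rw [(turn_act hn hw _).2, (turn_act hn hw' _).2]

lemma turn_turn (hn : 2 ≤ n) {w : Word n} (hw : IsTurn n w) (v : RootLattice n) :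
    wordAct n w (wordAct n w v) = v := by
  apply ext_of_eps hn
  intro k hk
  rw [eps_wordAct hn, eps_wordAct hn]
  rcases hk.lt_or_eq with h | rfl
  · rw [(turn_act hn hw _).1 k h, (turn_act hn hw _).1 k h]; ring
  · rw [(turn_act hn hw _).2, (turn_act hn hw _).2]
    rcases par_cases (k + 1) with e | e <;> rw [e] <;> ring

/-! ### The roots of a reading -/

/-- Just before (l, x) is read, the current section has points x and x + l + 1 on levels l and l +
1, and the simple root is the difference of their vectors. On the last level the second vector is
the extra one, whose parity sign distinguishes ε_{n-1} - ε_n from ε_{n-1} + ε_n. -/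
lemma reads_root (hn : 2 ≤ n) {c d : ℕ → ℤ} (hc : IsSection n c) (E : Frame n c)
    {A B : List (ℕ × ℤ)} {l : ℕ} {x : ℤ} (h : Reads n c (A ++ (l, x) :: B) d) (k : ℤ) :
    E.coef k (eps n (wordAct n (A.map (letter n)) (simpleRoot n (letter n (l, x))))) =
      E.chi k x - E.chi k (x + l + 1) := by
  rw [eps_wordAct hn]
  set F := reflWord n (A.map (letter n)) (eps n (simpleRoot n (letter n (l, x)))) with hF
  obtain ⟨m, hA, hB⟩ := h.of_append
  have hm := hA.isSection hc
  obtain ⟨h1, h2⟩ : E.Rel m (eps n (simpleRoot n (letter n (l, x)))) F :=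
    E.rel_reads hn hA (E.rel_base _)
  obtain ⟨hf, hx⟩ : Flippable n m l ∧ x = m l := by cases hB with | cons hf hx _ => exact ⟨hf, hx⟩
  have hl := hf.1
  -- Both sides change by the same sign under translation by multiples of n + 1, so one complete
  -- residue system suffices.
  suffices hs : ∀ k0, m (n - 1) ≤ k0 → k0 ≤ m (n - 1) + n →
      E.coef k0 F = E.chi k0 x - E.chi k0 (x + l + 1) by
    have hM : (0 : ℤ) < n + 1 := by omega
    obtain ⟨t, k0, e, a1, a2⟩ : ∃ t k0, k = k0 + t * (n + 1) ∧ m (n - 1) ≤ k0 ∧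
        k0 ≤ m (n - 1) + n := by
      refine ⟨(k - m (n - 1)) / (n + 1), m (n - 1) + (k - m (n - 1)) % (n + 1), ?_, ?_, ?_⟩
      · have := Int.emod_add_mul_ediv (k - m (n - 1)) (n + 1)
        linarith
      · have := Int.emod_nonneg (k - m (n - 1)) hM.ne'; omega
      · have := Int.emod_lt_of_pos (k - m (n - 1)) hM; omega
    rw [e, E.coef_shift, hs k0 a1 a2, E.chi_shift_left, E.chi_shift_left]
    ring
  intro k0 a1 a2
  have hval := letter_val (n := n) (v := (l, x)) hl
  have hml := hm.mono (show l ≤ n - 1 by omega) (by omega)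
  by_cases hk : k0 = m (n - 1) + n
  · rw [← hk, eps_simpleRoot hn] at h2
    have hpar := par_odd (m (n - 1))
    rw [E.chi_eq_zero (x := k0) (y := x) (by omega) (by omega) (by omega)]
    by_cases hl' : l + 1 = n
    · have e1 : n - 1 = l := by omega
      have e2 : x + l + 1 = k0 := by rw [hk, e1, hx]; omega
      rw [e2, E.chi_self]
      rw [e1, ← hx] at h2 hpar
      rw [hval] at h2
      by_cases ho : Odd x
      · simp only [hl', ho, and_self, if_true, lt_irrefl, if_false] at h2
        rw [hpar, if_pos ho, if_neg (by omega)] at h2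
        omega
      · simp only [ho, and_false, if_false, hl, if_true] at h2
        rw [hpar, if_neg ho, if_neg (by omega), if_pos hl'.symm] at h2
        omega
    · have hv : (letter n (l, x)).val = l := hval.trans (if_neg fun h => hl' h.1)
      rw [hv, if_pos hl, if_neg (show n ≠ l by omega), if_neg (show n ≠ l + 1 by omega)] at h2
      have hm1 := (hm.mono (show l + 1 ≤ n - 1 by omega) (by omega)).2
      rw [hf.2.2 (by omega)] at hm1
      rw [E.chi_eq_zero (x := k0) (y := x + l + 1) (by omega) (by omega) (by omega)]
      rcases par_cases (m (n - 1)) with e | e <;> rw [e] at h2 <;> omega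
  · obtain ⟨j, hj, rfl⟩ := exists_pt hm (show n - 1 < n by omega) a1 (by omega)
    have hjn : j < n := by omega
    rw [h1 j hjn, eps_simpleRoot hn]
    have hchi : ∀ i, i < n → E.chi (pt m j) (pt m i) = if j = i then 1 else 0 := by
      intro i hi
      split_ifs with e
      · rw [e, E.chi_self]
      · have := pt_mem hm (show i ≤ n - 1 by omega) (by omega)
        exact E.chi_eq_zero (fun h => e (pt_injective hm hjn hi h)) (by omega) (by omega)
    rw [show E.chi (pt m j) x = _ by rw [hx, ← hf.pt_eq, hchi l hl]]
    by_cases hl' : l + 1 = n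
    · have e1 : n - 1 = l := by omega
      rw [e1] at a1 a2 hk
      rw [E.chi_eq_zero (x := pt m j) (y := x + l + 1) (by omega) (by omega) (by omega), hval]
      split_ifs <;> omega
    · have hv : (letter n (l, x)).val = l := hval.trans (if_neg fun h => hl' h.1)
      rw [hv, if_pos hl, hx, ← hf.pt_succ (by omega), hchi _ (by omega)]
      split_ifs <;> omega

/-! ## Twisted adapted words are turns -/

lemma simpleRefl_simpleRefl (hn : 2 ≤ n) (i : Fin (n + 1)) (v : RootLattice n) :
    simpleRefl n i (simpleRefl n i v) = v := by
  apply ext_of_eps hn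
  intro k _
  have hi := i.2
  rw [eps_simpleRefl hn, funext fun k => eps_simpleRefl hn i v k]
  unfold refl
  by_cases h : i.val < n
  · simp only [h, if_true]
    split_ifs <;> first | omega | (subst_vars; rfl)
  · simp only [h, if_false]
    split_ifs with h1 h2 h3 <;> first | omega | (try simp only [neg_neg]; congr 1; omega)

lemma simpleRefl_neg (i : Fin (n + 1)) (v : RootLattice n) :
    simpleRefl n i (-v) = -simpleRefl n i v := by
  unfold simpleRefl
  rw [Matrix.mulVec_neg, Pi.neg_apply, neg_smul]
  abel

lemma wordAct_neg (w : Word n) (v : RootLattice n) : wordAct n w (-v) = -wordAct n w v := by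
  induction w with
  | nil => rfl
  | cons i w ih => rw [wordAct_cons, wordAct_cons, ih, simpleRefl_neg]

lemma simpleRoot_injective {i j : Fin (n + 1)} (h : simpleRoot n i = simpleRoot n j) : i = j := by
  have h1 := congrArg (fun v => coord n v i) h
  simp only [coord_simpleRoot, if_true] at h1
  apply Fin.ext
  by_contra hne
  rw [if_neg hne] at h1
  exact one_ne_zero h1

lemma simpleRefl_simpleRoot_self (i : Fin (n + 1)) :
    simpleRefl n i (simpleRoot n i) = -simpleRoot n i := by
  have : (CartanMatrix.D (n + 1)).mulVec (simpleRoot n i) i = 2 := by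
    rw [simpleRoot, Matrix.mulVec_single_one]
    simp [CartanMatrix.D]
  rw [simpleRefl, this]
  funext k
  simp only [Pi.sub_apply, Pi.smul_apply, Pi.neg_apply, smul_eq_mul]
  ring

lemma simpleRefl_simpleRoot_of_cartan {i j : Fin (n + 1)} (h : CartanMatrix.D (n + 1) i j = 0) :
    simpleRefl n i (simpleRoot n j) = simpleRoot n j := by
  have : (CartanMatrix.D (n + 1)).mulVec (simpleRoot n j) i = 0 := by
    rw [simpleRoot, Matrix.mulVec_single_one]
    exact h
  rw [simpleRefl, this, zero_smul, sub_zero]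

lemma coord_simpleRefl_of_ne (i : Fin (n + 1)) (v : RootLattice n) {k : ℕ} (hk : k ≠ i) :
    coord n (simpleRefl n i v) k = coord n v k := by
  rw [simpleRefl, coord_sub_smul, coord_simpleRoot, if_neg hk]
  ring

lemma Frame.ext_of_coef (hn : 2 ≤ n) {c : ℕ → ℤ} (E : Frame n c) {v w : RootLattice n}
    (h : ∀ k, E.coef k (eps n v) = E.coef k (eps n w)) : v = w := by
  apply ext_of_eps hn
  intro k hk
  obtain ⟨v1, v2⟩ := E.rel_base (eps n v)
  obtain ⟨w1, w2⟩ := E.rel_base (eps n w)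
  rcases hk.lt_or_eq with h1 | rfl
  · rw [← v1 k h1, ← w1 k h1, h]
  · rw [← v2, ← w2, h]

/-- The section whose only source is on level `l` at position `x`. -/
def vSection (l : ℕ) (x : ℤ) (k : ℕ) : ℤ := max x (x + l - k)

lemma isSection_vSection (l : ℕ) (x : ℤ) : IsSection n (vSection l x) := by
  intro j _
  unfold vSection
  push_cast
  omega

lemma flippable_vSection {l : ℕ} (hl : l < n) (x : ℤ) : Flippable n (vSection l x) l := by
  refine ⟨hl, fun h => ?_, fun _ => ?_⟩
  · obtain ⟨k, rfl⟩ : ∃ k, l = k + 1 := ⟨l - 1, by omega⟩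
    simp only [vSection, Nat.add_sub_cancel]
    push_cast
    omega
  · simp only [vSection]
    push_cast
    omega

lemma vSection_self (l : ℕ) (x : ℤ) : vSection l x l = x := by simp [vSection]

lemma exists_turn_of_prefix {c d : ℕ → ℤ} {L : List (ℕ × ℤ)} (hc : IsSection n c)
    (hL : Reads n c L d) (hle : ∀ l, l < n → d l ≤ c l + (n + 1)) :
    ∃ V : Word n, IsTurn n (L.map (letter n) ++ V) := by
  obtain ⟨L', h⟩ := exists_reads (hL.isSection hc) (hc.shift (n + 1)) hle
  exact ⟨L'.map (letter n), c, hc, L ++ L', hL.append h, by simp⟩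

lemma letter_surjective (hn : 2 ≤ n) (i : Fin (n + 1)) : ∃ l x, l < n ∧ letter n (l, x) = i := by
  have hi := i.2
  by_cases h : i.val = n
  · refine ⟨n - 1, 1, by omega, Fin.ext ?_⟩
    rw [letter_val (show n - 1 < n by omega), if_pos ⟨by simp only; omega, odd_one⟩, h]
  · refine ⟨i, 0, by omega, Fin.ext ?_⟩
    rw [letter_val (show i.val < n by omega), if_neg (by simp)]

lemma exists_adjacent_vertices (hn : 2 ≤ n) {i j : Fin (n + 1)} (hij : i ≠ j)
    (h : CartanMatrix.D (n + 1) i j ≠ 0) : ∃ (l m : ℕ) (x y : ℤ), l < n ∧ m < n ∧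
      letter n (l, x) = i ∧ letter n (m, y) = j ∧
      ((m = l + 1 ∧ y = x) ∨ (l = m + 1 ∧ y = x + 1)) := by
  have hi := i.2
  have hj := j.2
  rw [ne_eq, cartan_eq_zero_iff hn] at h
  have key : ∀ (k : Fin (n + 1)) (l : ℕ) (x : ℤ), l < n →
      (k.val = if l + 1 = n ∧ Odd x then n else l) → letter n (l, x) = k :=
    fun k l x hl hk => Fin.ext (by rw [letter_val hl, hk])
  have o1 : Odd (1 : ℤ) := odd_one
  have o2 : ¬ Odd (0 : ℤ) := by simp
  have o3 : ¬ Odd ((0 : ℤ) + 1 + 1) := by decide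
  have o4 : Odd ((0 : ℤ) + 1) := by decide
  by_cases h1 : i.val = n
  · refine ⟨n - 1, n - 2, 1, 1 + 1, by omega, by omega, key _ _ _ (by omega) ?_,
      key _ _ _ (by omega) ?_, Or.inr ⟨by omega, rfl⟩⟩
    · rw [if_pos ⟨by omega, o1⟩, h1]
    · rw [if_neg (by omega)]; omega
  by_cases h2 : j.val = n
  · refine ⟨n - 2, n - 1, 1, 1, by omega, by omega, key _ _ _ (by omega) ?_,
      key _ _ _ (by omega) ?_, Or.inl ⟨by omega, rfl⟩⟩
    · rw [if_neg (by omega)]; omega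
    · rw [if_pos ⟨by omega, o1⟩, h2]
  by_cases h3 : i.val + 1 = j.val
  · refine ⟨i, j, 0, 0, by omega, by omega, key _ _ _ (by omega) ?_,
      key _ _ _ (by omega) ?_, Or.inl ⟨by omega, rfl⟩⟩
    · rw [if_neg fun h => o2 h.2]
    · rw [if_neg fun h => o2 h.2]
  · refine ⟨i, j, 0, 0 + 1, by omega, by omega, key _ _ _ (by omega) ?_,
      key _ _ _ (by omega) ?_, Or.inr ⟨by omega, rfl⟩⟩
    · rw [if_neg fun h => o2 h.2]
    · rw [if_neg fun h => absurd h.1 (by omega)]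

/-- Continue the reading by the translate (l, x + (n + 1)) of its first vertex. By `reads_root` the
root of that translate is minus the root of the first vertex, and a turn acts as an involution. -/
lemma turn_simpleRoot_of_reads (hn : 2 ≤ n) {c : ℕ → ℤ} (hc : IsSection n c) {l : ℕ} {x : ℤ}
    {L : List (ℕ × ℤ)} (h : Reads n c ((l, x) :: L) (shift c (n + 1))) :
    wordAct n (((l, x) :: L).map (letter n)) (simpleRoot n (letter n (l, x))) =
      -simpleRoot n (letter n (l, x + (n + 1))) := by
  obtain ⟨E⟩ := exists_frame hn hc
  have hturn : IsTurn n (((l, x) :: L).map (letter n)) := ⟨c, hc, _, h, rfl⟩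
  obtain ⟨hf, hx⟩ : Flippable n c l ∧ x = c l := by cases h with | cons hf hx _ => exact ⟨hf, hx⟩
  have h' : Reads n c (((l, x) :: L) ++ (l, x + (n + 1)) :: []) (flip (shift c (n + 1)) l) :=
    h.append (.cons (hf.shift _) (by rw [hx]; rfl) (.nil fun _ _ => rfl))
  have key : wordAct n (((l, x) :: L).map (letter n))
      (simpleRoot n (letter n (l, x + (n + 1)))) = -simpleRoot n (letter n (l, x)) := by
    apply E.ext_of_coef hn
    intro k
    rw [reads_root hn hc E h']
    have h2 := reads_root hn hc E (A := []) h k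
    have h3 : E.coef k (eps n (-simpleRoot n (letter n (l, x)))) =
        -E.coef k (eps n (simpleRoot n (letter n (l, x)))) := by
      unfold Frame.coef; rw [eps_neg]; ring
    rw [h3]
    simp only [List.map_nil, wordAct, List.foldr_nil] at h2
    rw [h2, show x + ((n : ℤ) + 1) + l + 1 = x + l + 1 + (n + 1) by ring, E.chi_add, E.chi_add]
    ring
  rw [← turn_turn hn hturn (simpleRoot n (letter n (l, x + (n + 1)))), key, wordAct_neg, neg_neg]

/-- All turns act alike, and some turn starts with the letter i. -/
lemma turn_simpleRoot (hn : 2 ≤ n) {w : Word n} (hw : IsTurn n w) (i : Fin (n + 1)) :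
    ∃ j, wordAct n w (simpleRoot n i) = -simpleRoot n j := by
  obtain ⟨l, x, hl, rfl⟩ := letter_surjective hn i
  have hf := flippable_vSection hl x
  have hc := isSection_vSection (n := n) l x
  obtain ⟨L, hL⟩ := exists_reads (hc.flip hf) (hc.shift (n + 1)) (by
    intro k _; rw [flip_apply]; simp only [shift]; split_ifs with h
    · subst h; omega
    · omega)
  have hR : Reads n (vSection l x) ((l, x) :: L) (shift (vSection l x) (n + 1)) :=
    .cons hf (vSection_self l x).symm hL
  exact ⟨_, by rw [turn_eq hn hw ⟨_, hc, _, hR, rfl⟩]; exact turn_simpleRoot_of_reads hn hc hR⟩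

lemma turn_length {w w' : Word n} (hw : IsTurn n w) (hw' : IsTurn n w') : w.length = w'.length := by
  obtain ⟨c, -, L, hL, rfl⟩ := hw
  obtain ⟨c', -, L', hL', rfl⟩ := hw'
  have h1 := hL.length
  have h2 := hL'.length
  simp only [shift, add_sub_cancel_left] at h1 h2
  rw [List.length_map, List.length_map]
  exact_mod_cast h1.trans h2.symm

/-- If `i` and `i₀` are different, then `i u` and `i₀ u` are not both reduced words of `w₀`. -/
lemma eq_of_turn (hn : 2 ≤ n) {i i₀ j : Fin (n + 1)} {u : Word n} (h₀ : IsTurn n (i₀ :: u))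
    (hj₀ : wordAct n (i₀ :: u) (simpleRoot n i₀) = -simpleRoot n j) (hr : IsReduced n (i :: u))
    (hj : wordAct n (i :: u) (simpleRoot n i) = -simpleRoot n j) : i = i₀ := by
  by_contra hne
  have hu : ∀ v, wordAct n u v = simpleRefl n i₀ (wordAct n (i₀ :: u) v) := by
    intro v; rw [wordAct_cons, simpleRefl_simpleRefl hn]
  -- If the letters commute, let w₀ denote the action of the turn and w₀ α_i = -α_k. Then s_i s_{i₀}
  -- α_k = α_j, so positivity and the coordinate at k give k = j, and w₀ α_i = w₀ α_{i₀}.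
  by_cases hD : CartanMatrix.D (n + 1) i₀ i = 0
  · have hD' : CartanMatrix.D (n + 1) i i₀ = 0 := by
      rw [cartan_eq_zero_iff hn] at hD ⊢
      obtain ⟨h1, h2, h3, h4, h5⟩ := hD
      exact ⟨h1.symm, h3, h2, h5, h4⟩
    obtain ⟨k, hk⟩ := turn_simpleRoot hn h₀ i
    rw [wordAct_cons, hu, hk, simpleRefl_neg, simpleRefl_neg, neg_inj] at hj
    have hneg : ∀ a b : Fin (n + 1), -simpleRoot n a ≠ simpleRoot n b := by
      intro a b h
      have := congrArg (fun v => coord n v a) h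
      simp only [coord_neg, coord_simpleRoot, if_true] at this
      split_ifs at this
    by_cases h1 : k = i
    · subst h1
      rw [simpleRefl_simpleRoot_of_cartan hD, simpleRefl_simpleRoot_self] at hj
      exact hneg _ _ hj
    by_cases h2 : k = i₀
    · subst h2
      rw [simpleRefl_simpleRoot_self, simpleRefl_neg, simpleRefl_simpleRoot_of_cartan hD'] at hj
      exact hneg _ _ hj
    have h3 : coord n _ k = coord n _ k := congrArg (fun v => coord n v k) hj
    rw [coord_simpleRefl_of_ne _ _ (fun h => h1 (Fin.ext h)),
      coord_simpleRefl_of_ne _ _ (fun h => h2 (Fin.ext h)), coord_simpleRoot, coord_simpleRoot,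
      if_pos rfl] at h3
    have hkj : k = j := by
      apply Fin.ext
      by_contra h4
      rw [if_neg h4] at h3
      exact one_ne_zero h3
    rw [hkj, ← hj₀] at hk
    apply hne
    apply simpleRoot_injective
    rw [← turn_turn hn h₀ (simpleRoot n i), hk, turn_turn hn h₀]
  -- If the letters are adjacent, some turn starts i₀ i V. Then V represents the same element as i u
  -- with two letters fewer, against reducedness.
  · obtain ⟨l, m, x, y, hl, hm, rfl, rfl, hlm⟩ := exists_adjacent_vertices hn (Ne.symm hne) hD
    have hf := flippable_vSection hl x
    have hc := isSection_vSection (n := n) l x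
    have hml : m ≠ l := by omega
    have hy : y = flip (vSection l x) l m := by
      rw [flip_of_ne _ hml]
      unfold vSection
      rcases hlm with ⟨rfl, rfl⟩ | ⟨rfl, rfl⟩ <;> push_cast <;> omega
    have hg : Flippable n (flip (vSection l x) l) m := by
      refine ⟨hm, fun h0 => ?_, fun h1 => ?_⟩
      · rw [← hy]
        obtain ⟨k, rfl⟩ : ∃ k, m = k + 1 := ⟨m - 1, by omega⟩
        simp only [Nat.add_sub_cancel, flip_apply, vSection]
        rcases hlm with ⟨h1, rfl⟩ | ⟨rfl, rfl⟩
        · rw [if_pos (by omega)]; omega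
        · rw [if_neg (by omega)]; push_cast; omega
      · rw [← hy]
        simp only [flip_apply, vSection]
        rcases hlm with ⟨rfl, rfl⟩ | ⟨rfl, rfl⟩
        · rw [if_neg (by omega)]; push_cast; omega
        · rw [if_pos rfl]; omega
    obtain ⟨V, hV⟩ := exists_turn_of_prefix hc
      (.cons hf (vSection_self l x).symm (.cons hg hy (.nil fun _ _ => rfl))) (by
        intro k _
        rw [flip_apply, flip_of_ne _ hml, flip_apply]
        split_ifs with h1 h2
        · subst h1; omega
        · subst h2; omega
        · omega)
    simp only [List.map_cons, List.map_nil, List.cons_append, List.nil_append] at hV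
    have hact := turn_eq hn h₀ hV
    have hlen := turn_length h₀ hV
    have hVu : wordAct n V = wordAct n (letter n (m, y) :: u) := by
      funext v
      rw [wordAct_cons, hu, hact, wordAct_cons, wordAct_cons, simpleRefl_simpleRefl hn,
        simpleRefl_simpleRefl hn]
    have := hr V hVu
    simp only [List.length_cons] at this hlen
    omega

/-- Forwards, the first vertex is moved to the end as its translate. Backwards, moving the last
vertex to the front gives some turn i₀ u, and `eq_of_turn` identifies i₀ with the first letter of
the given word. -/
lemma IsTurn.reflStep (hn : 2 ≤ n) {w w' : Word n} (h : ReflStep n w w') :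
    IsTurn n w ↔ IsTurn n w' := by
  obtain ⟨i, j, u, rfl, hlong, hj, rfl⟩ := h
  constructor
  · rintro ⟨c, hc, L, hL, e⟩
    obtain ⟨⟨l, x⟩, L1, rfl, rfl, rfl⟩ := List.map_eq_cons_iff.1 e.symm
    have h1 := turn_simpleRoot_of_reads hn hc hL
    rw [List.map_cons, hj, neg_inj] at h1
    cases hL with
    | cons hf hx hL1 =>
      refine ⟨flip c l, hc.flip hf, L1 ++ [(l, x + (n + 1))], hL1.append ?_, ?_⟩
      · refine .cons (hf.shift _) (by rw [hx]; rfl) (.nil fun k _ => ?_)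
        rw [flip_shift]
      · rw [simpleRoot_injective h1]; simp
  · rintro ⟨c, hc, L, hL, e⟩
    obtain ⟨L1, L2, rfl, rfl, e2⟩ := List.map_eq_append_iff.1 e.symm
    obtain ⟨⟨l, x⟩, L3, rfl, rfl, e3⟩ := List.map_eq_cons_iff.1 e2
    rw [List.map_eq_nil_iff] at e3
    subst e3
    obtain ⟨d, hL1, h2⟩ := hL.of_append
    have hd := hL1.isSection hc
    cases h2 with
    | cons hf hx h3 =>
      cases h3 with
      | nil h4 =>
        have hs : shift (shift d (-(n + 1))) (n + 1) = d := by
          funext k; simp only [shift]; ring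
        have hR : Reads n (shift d (-(n + 1))) ((l, x - (n + 1)) :: L1)
            (shift (shift d (-(n + 1))) (n + 1)) := by
          rw [hs]
          refine .cons (hf.shift _) (by rw [hx]; rfl) (hL1.congr_left fun k hk => ?_)
          rw [flip_shift]
          simp only [shift, h4 k hk]
          ring
        have h₀ := turn_simpleRoot_of_reads hn (hd.shift _) hR
        rw [sub_add_cancel] at h₀
        have ht : IsTurn n (((l, x - (n + 1)) :: L1).map (letter n)) :=
          ⟨_, hd.shift _, _, hR, rfl⟩
        rw [eq_of_turn hn ht h₀ hlong.1 hj]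
        exact ht

lemma IsTwistedAdapted.isTurn (hn : 2 ≤ n) {w : Word n} (hw : IsTwistedAdapted n w) :
    IsTurn n w := by
  have key : ∀ w w' : Word n, ReflEquiv n w w' → (IsTurn n w ↔ IsTurn n w') := by
    intro w w' h
    induction h with
    | rel w w' h =>
      rcases h with h | h
      · have := fun c : ℕ → ℤ => isReadingWord_of_commEquiv (c := c) (d := shift c (n + 1)) hn
          (.rel _ _ h : CommEquiv n w w')
        simp only [IsTurn, this]
      · exact IsTurn.reflStep hn h
    | refl => exact Iff.rfl
    | symm _ _ _ ih => exact ih.symm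
    | trans _ _ _ _ _ ih1 ih2 => exact ih1.trans ih2
  exact (key _ _ hw).1 (isTurn_baseWord hn)

/-! ## Positive roots as vertices -/

lemma eps_of_gt (v : RootLattice n) {k : ℕ} (h : n < k) : eps n v k = 0 := by
  unfold eps
  rw [if_neg (by omega), if_neg (by omega), if_neg (by omega)]

lemma signedPair_comm (a b : ℕ) (s t : ℤ) : signedPair a b s t = signedPair b a t s := by
  funext k; unfold signedPair; ring

namespace Frame

variable {c : ℕ → ℤ} (E : Frame n c)

lemma idx_sub (x : ℤ) : E.idx (x - (n + 1)) = E.idx x := by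
  have := E.idx_add (x - (n + 1)) 1
  rwa [one_mul, sub_add_cancel, eq_comm] at this

lemma sgn_sub (x : ℤ) : E.sgn (x - (n + 1)) = -E.sgn x := by
  have := E.sgn_add (x - (n + 1)) 1
  rw [one_mul, sub_add_cancel] at this
  rw [this]; simp [par]

lemma chi_sub (x y : ℤ) : E.chi x (y - (n + 1)) = -E.chi x y := by
  have := E.chi_add x (y - (n + 1))
  rw [sub_add_cancel] at this
  omega

lemma exists_idx {j : ℕ} (hj : j ≤ n) : ∃ x, E.idx x = j := by
  rcases hj.lt_or_eq with h | h
  · exact ⟨_, E.idx_pt j h⟩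
  · exact ⟨_, by rw [h]; exact E.idx_last⟩

lemma exists_idx_sgn {j : ℕ} (hj : j ≤ n) {s : ℤ} (hs : s = 1 ∨ s = -1) :
    ∃ x, E.idx x = j ∧ E.sgn x = s := by
  obtain ⟨x, hx⟩ := E.exists_idx hj
  by_cases h : E.sgn x = s
  · exact ⟨x, hx, h⟩
  · refine ⟨x - (n + 1), by rw [E.idx_sub, hx], ?_⟩
    rw [E.sgn_sub]
    have := E.sgn_cases x
    omega

lemma idx_le (hn : 2 ≤ n) (hc : IsSection n c) (x : ℤ) : E.idx x ≤ n := by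
  have hM : (0 : ℤ) < n + 1 := by omega
  have h1 := Int.emod_add_mul_ediv (x - c (n - 1)) (n + 1)
  have h2 := Int.emod_nonneg (x - c (n - 1)) hM.ne'
  have h3 := Int.emod_lt_of_pos (x - c (n - 1)) hM
  set r := (x - c (n - 1)) % (n + 1)
  have h4 : x = (c (n - 1) + r) + ((x - c (n - 1)) / (n + 1)) * (n + 1) := by linarith
  rw [h4, E.idx_add]
  by_cases h : r = n
  · rw [h, E.idx_last]
  · obtain ⟨b, hb, e⟩ := exists_pt hc (show n - 1 < n by omega) (x := c (n - 1) + r)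
      (by omega) (by omega)
    rw [← e, E.idx_pt b (by omega)]
    omega

lemma eps_of_coef (hn : 2 ≤ n) (hc : IsSection n c) {v : RootLattice n} {p q : ℤ}
    (h : ∀ k, E.coef k (eps n v) = E.chi k p + E.chi k q) :
    eps n v = signedPair (E.idx p) (E.idx q) (E.sgn p) (E.sgn q) := by
  funext j
  by_cases hj : j ≤ n
  · obtain ⟨k, rfl⟩ := E.exists_idx hj
    have h1 := h k
    unfold coef chi at h1
    unfold signedPair
    have h2 := E.sgn_cases k
    split_ifs at h1 ⊢ <;> rcases h2 with h2 | h2 <;> rw [h2] at h1 <;> omega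
  · have := E.idx_le hn hc p
    have := E.idx_le hn hc q
    rw [eps_of_gt _ (by omega), signedPair, if_neg (by omega), if_neg (by omega)]
    rfl

lemma coef_signedPair {p q k : ℤ} {f : ℕ → ℤ}
    (h : f = signedPair (E.idx p) (E.idx q) (E.sgn p) (E.sgn q)) :
    E.coef k f = E.chi k p + E.chi k q := by
  rw [h]
  unfold coef chi signedPair
  split_ifs <;> ring

/-- The root of a vertex between `c` and its translate has non-negative coefficients. -/
lemma nonneg_of_vertex (hn : 2 ≤ n) (hc : IsSection n c) {l : ℕ} {x : ℤ} (hl : l < n)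
    (h1 : c l ≤ x) (h2 : x < c l + (n + 1)) {v : RootLattice n}
    (hv : ∀ k, E.coef k (eps n v) = E.chi k x + E.chi k (x + l + 1 - (n + 1)))
    (i : Fin (n + 1)) : 0 ≤ v i := by
  have e := E.eps_of_coef hn hc hv
  rw [E.idx_sub, E.sgn_sub] at e
  have hml := hc.mono (show l ≤ n - 1 by omega) (by omega)
  have hpt : ∀ y, c (n - 1) ≤ y → y < c (n - 1) + n →
      ∃ a, a < n ∧ pt c a = y ∧ E.idx y = a ∧ E.sgn y = 1 := by
    intro y a1 a2
    obtain ⟨a, ha, rfl⟩ := exists_pt hc (show n - 1 < n by omega) a1 (by omega)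
    exact ⟨a, by omega, rfl, E.idx_pt a (by omega), E.sgn_pt a (by omega)⟩
  have hgt : ∀ y, c (n - 1) + n < y → y < c (n - 1) + n + (n + 1) →
      ∃ a, a < n ∧ pt c a = y - (n + 1) ∧ E.idx y = a ∧ E.sgn y = -1 := by
    intro y a1 a2
    obtain ⟨a, ha, ea, e1, e2⟩ := hpt (y - (n + 1)) (by omega) (by omega)
    rw [E.idx_sub] at e1
    rw [E.sgn_sub] at e2
    exact ⟨a, ha, ea, e1, by omega⟩
  have hpar := par_cases (c (n - 1))
  -- Indices from c (n - 1) up to c (n - 1) + n - 1 are points with sign 1, the next one is the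
  -- extra vector, and those beyond are negatives of points. In each case the earlier ε-coordinate
  -- gets sign +1.
  rcases lt_trichotomy x (c (n - 1) + n) with hx | hx | hx
  · obtain ⟨a, ha, ea, ia, sa⟩ := hpt x (by omega) hx
    rw [ia, sa] at e
    rcases lt_trichotomy (x + l + 1) (c (n - 1) + n) with hy | hy | hy
    · obtain ⟨b, hb, eb, ib, sb⟩ := hpt (x + l + 1) (by omega) hy
      rw [ib, sb] at e
      refine nonneg_of_eps hn ?_ (by omega) (by omega) e i
      by_contra hab
      have hbl : l < b := by
        by_contra hbl
        have := pt_mem hc (show b ≤ l by omega) hl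
        omega
      have hba : b < a := by
        rcases Nat.lt_or_ge b a with h | h
        · exact h
        · have : a = b := by omega
          subst this
          omega
      have h3 := pt_not_mem hc hba ha
      have h4 := hc.mono hbl.le hb
      have h5 := pt_bounds c b
      omega
    · rw [hy, E.idx_last, E.sgn_last] at e
      exact nonneg_of_eps hn ha le_rfl (by omega) e i
    · obtain ⟨b, hb, eb, ib, sb⟩ := hgt (x + l + 1) hy (by omega)
      rw [ib, sb, neg_neg] at e
      rcases lt_trichotomy a b with hab | hab | hab
      · exact nonneg_of_eps hn hab hb.le (by omega) e i
      · subst hab; omega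
      · rw [signedPair_comm] at e
        exact nonneg_of_eps hn hab ha.le (by omega) e i
  · obtain ⟨b, hb, eb, ib, sb⟩ := hgt (x + l + 1) (by omega) (by omega)
    rw [ib, sb, neg_neg, hx, E.idx_last, E.sgn_last, signedPair_comm] at e
    exact nonneg_of_eps hn hb le_rfl (by omega) e i
  · obtain ⟨a, ha, ea, ia, sa⟩ := hgt x hx (by omega)
    obtain ⟨b, hb, eb, ib, sb⟩ := hgt (x + l + 1) (by omega) (by omega)
    rw [ia, sa, ib, sb, neg_neg, signedPair_comm] at e
    refine nonneg_of_eps hn ?_ (by omega) (by omega) e i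
    by_contra hab
    have hal : l < a := by
      by_contra hal
      have := pt_mem hc (show a ≤ l by omega) hl
      omega
    have hba : a < b := by
      rcases Nat.lt_or_ge a b with h | h
      · exact h
      · have : a = b := by omega
        subst this
        omega
    have h3 := pt_not_mem hc hba hb
    have h4 := hc.mono hal.le ha
    have h5 := pt_bounds c a
    omega

end Frame

lemma IsSection.le_of_le {c : ℕ → ℤ} (hc : IsSection n c) {l m : ℕ} {x y : ℤ} (hl : l < n)
    (hm : m < n) (h : c l ≤ x) (h1 : x ≤ y) (h2 : x + l ≤ y + m) : c m ≤ y := by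
  rcases le_total l m with h' | h'
  · have := (hc.mono h' hm).1; omega
  · have := (hc.mono h' hl).2; omega

/-- Different vertices between `c` and its translate have different roots. -/
lemma vertex_unique {c : ℕ → ℤ} (E : Frame n c) {l m : ℕ}
    {x y : ℤ} (hl : l < n) (hm : m < n) (hx : c l ≤ x ∧ x < c l + (n + 1))
    (hy : c m ≤ y ∧ y < c m + (n + 1))
    (h : ∀ k, E.chi k x + E.chi k (x + l + 1 - (n + 1)) =
      E.chi k y + E.chi k (y + m + 1 - (n + 1))) : (l, x) = (m, y) := by
  have hM : (0 : ℤ) < (n : ℤ) + 1 := by omega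
  have e1 := h x
  have e2 := h (x + l + 1 - (n + 1))
  have n1 : E.idx x ≠ E.idx (x + l + 1 - (n + 1)) := E.idx_ne (by omega) (by omega) (by omega)
  have n2 : E.idx y ≠ E.idx (y + m + 1 - (n + 1)) := E.idx_ne (by omega) (by omega) (by omega)
  rw [E.chi_self, E.chi_eq_zero (x := x) (y := x + l + 1 - (n + 1)) (by omega) (by omega)
    (by omega)] at e1
  rw [E.chi_self, E.chi_eq_zero (x := x + l + 1 - (n + 1)) (y := x) (by omega) (by omega)
    (by omega)] at e2
  by_cases h1 : E.idx x = E.idx y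
  · have h2 : E.idx (x + l + 1 - (n + 1)) = E.idx (y + m + 1 - (n + 1)) := by
      by_contra h3
      rw [Frame.chi, Frame.chi, if_neg h3, if_neg fun h4 => n1 (h1.trans h4.symm)] at e2
      omega
    obtain ⟨a, ha⟩ := E.idx_inj _ _ h1
    obtain ⟨b, hb⟩ := E.idx_inj _ _ h2
    have hab : a = b := by
      by_contra hne
      rcases lt_or_gt_of_ne hne with h' | h' <;> nlinarith
    subst hab
    have hlm : l = m := by omega
    subst hlm
    have : a = 0 := by
      rcases lt_trichotomy a 0 with h' | h' | h'
      · nlinarith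
      · exact h'
      · nlinarith
    subst this
    simp [ha]
  -- The remaining possibility is a crosswise match. The two translations then differ by exactly one
  -- step of n + 1, so the signs cannot both agree.
  · exfalso
    have h2 : E.idx x = E.idx (y + m + 1 - (n + 1)) := by
      by_contra h3
      rw [Frame.chi, Frame.chi, if_neg h3, if_neg h1] at e1
      omega
    have h3 : E.idx (x + l + 1 - (n + 1)) = E.idx y := by
      by_contra h3
      rw [Frame.chi, Frame.chi, if_neg h3, if_neg fun h4 => n1 (h2.trans h4.symm)] at e2
      omega
    obtain ⟨a, ha⟩ := E.idx_inj _ _ h2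
    obtain ⟨b, hb⟩ := E.idx_inj _ _ h3
    have hab : b = a + 1 := by
      rcases lt_trichotomy b (a + 1) with h' | h' | h'
      · nlinarith
      · exact h'
      · nlinarith
    have f1 : E.chi x (y + m + 1 - (n + 1)) = par a := by
      rw [ha, E.chi_shift, E.chi_self, mul_one]
    have f2 : E.chi (x + l + 1 - (n + 1)) y = par b := by
      rw [hb, E.chi_shift, E.chi_self, mul_one]
    have f3 : E.chi x y = 0 := if_neg h1
    have f4 : E.chi (x + l + 1 - (n + 1)) (y + m + 1 - (n + 1)) = 0 :=
      if_neg fun h4 => n1 (h2.trans h4.symm)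
    rw [f1, f3] at e1
    rw [f2, f4, hab, par_add_one] at e2
    omega

/-- The positive root of a vertex of a turn. -/
lemma isPosRoot_of_reads (hn : 2 ≤ n) {c : ℕ → ℤ} (hc : IsSection n c) (E : Frame n c)
    {A B : List (ℕ × ℤ)} {l : ℕ} {x : ℤ} (h : Reads n c (A ++ (l, x) :: B) (shift c (n + 1))) :
    IsPosRoot n (wordAct n (A.map (letter n)) (simpleRoot n (letter n (l, x)))) ∧
    ∀ k, E.coef k (eps n (wordAct n (A.map (letter n)) (simpleRoot n (letter n (l, x))))) =
      E.chi k x + E.chi k (x + l + 1 - (n + 1)) := by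
  have h1 : ∀ k, E.coef k (eps n (wordAct n (A.map (letter n)) (simpleRoot n (letter n (l, x))))) =
      E.chi k x + E.chi k (x + l + 1 - (n + 1)) := by
    intro k; rw [reads_root hn hc E h, E.chi_sub]; ring
  obtain ⟨hl, a1, a2⟩ := (h.mem_iff l x).1 (by simp)
  exact ⟨⟨⟨_, _, rfl⟩, E.nonneg_of_vertex hn hc hl a1 a2 h1⟩, h1⟩

lemma exists_posRoot_of_vertex (hn : 2 ≤ n) {c : ℕ → ℤ} (hc : IsSection n c) (E : Frame n c)
    {l : ℕ} {x : ℤ} (hl : l < n) (h1 : c l ≤ x) (h2 : x < c l + (n + 1)) :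
    ∃ γ : PosRoot n, ∀ k, E.coef k (eps n γ.1) = E.chi k x + E.chi k (x + l + 1 - (n + 1)) := by
  obtain ⟨L, hL⟩ := exists_reads hc (hc.shift (n + 1)) (by
    intro l _; simp only [shift]; omega)
  have hm := (hL.mem_iff l x).2 ⟨hl, h1, h2⟩
  obtain ⟨A, B, rfl⟩ := List.append_of_mem hm
  obtain ⟨hp, hk⟩ := isPosRoot_of_reads hn hc E hL
  exact ⟨⟨_, hp⟩, hk⟩

/-- Every vertex has a translate between `c` and its translate by `n + 1`. -/
lemma exists_lift {c : ℕ → ℤ} (l : ℕ) (x : ℤ) :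
    ∃ t : ℤ, c l ≤ x + t * (n + 1) ∧ x + t * (n + 1) < c l + (n + 1) := by
  have hM : (0 : ℤ) < n + 1 := by omega
  have h1 := Int.emod_add_mul_ediv (x - c l) (n + 1)
  have h2 := Int.emod_nonneg (x - c l) hM.ne'
  have h3 := Int.emod_lt_of_pos (x - c l) hM
  refine ⟨-((x - c l) / (n + 1)), ?_, ?_⟩ <;> linarith

/-- Write the root as e_p + e_q with 0 < p - q < n + 1, which is a vertex, and translate it into the
strip. An odd translation would make both γ and -γ non-negative. -/
lemma exists_vertex (hn : 2 ≤ n) {c : ℕ → ℤ} (hc : IsSection n c) (E : Frame n c)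
    (γ : PosRoot n) : ∃ (l : ℕ) (x : ℤ), l < n ∧ c l ≤ x ∧ x < c l + (n + 1) ∧
      ∀ k, E.coef k (eps n γ.1) = E.chi k x + E.chi k (x + l + 1 - (n + 1)) := by
  have hM : (0 : ℤ) < (n : ℤ) + 1 := by omega
  obtain ⟨a, b, s, t, hab, ha, hb, hs, ht, e⟩ := isRoot_eps hn γ.2.1
  obtain ⟨p, q, hpq1, hpq2, hcoef⟩ : ∃ p q : ℤ, q < p ∧ p < q + (n + 1) ∧
      ∀ k, E.coef k (eps n γ.1) = E.chi k p + E.chi k q := by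
    obtain ⟨p, rfl, rfl⟩ := E.exists_idx_sgn ha hs
    obtain ⟨q0, rfl, rfl⟩ := E.exists_idx_sgn hb ht
    -- Only even multiples of n + 1 preserve the sign of e_q, hence a window of length 2(n + 1).
    obtain ⟨q, e1, e2, q1, q2⟩ : ∃ q, E.idx q = E.idx q0 ∧ E.sgn q = E.sgn q0 ∧
        p - (n + 1) ≤ q ∧ q < p + (n + 1) := by
      have h1 := Int.emod_add_mul_ediv (q0 - (p - (n + 1))) (2 * (n + 1))
      have h2 := Int.emod_nonneg (q0 - (p - (n + 1))) (show 2 * ((n : ℤ) + 1) ≠ 0 by omega)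
      have h3 := Int.emod_lt_of_pos (q0 - (p - (n + 1))) (show 0 < 2 * ((n : ℤ) + 1) by omega)
      set u := (q0 - (p - (n + 1))) / (2 * (n + 1))
      refine ⟨q0 + (-2 * u) * (n + 1), E.idx_add _ _, ?_, by linarith, by linarith⟩
      rw [E.sgn_add, par, if_pos ⟨-u, by ring⟩, one_mul]
    rw [← e1, ← e2] at e
    rw [← e1] at hab
    have hne : q ≠ p - (n + 1) := by
      rintro rfl
      rw [E.idx_sub] at hab
      exact hab rfl
    have hne' : q ≠ p := by rintro rfl; exact hab rfl
    by_cases hqp : q < p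
    · exact ⟨p, q, hqp, by omega, fun k => E.coef_signedPair e⟩
    · refine ⟨q, p, by omega, by omega, fun k => ?_⟩
      rw [E.coef_signedPair e, add_comm]
  have hl : (q + (n + 1) - p - 1).toNat < n := by omega
  obtain ⟨u, hu1, hu2⟩ := exists_lift (n := n) (c := c) (q + (n + 1) - p - 1).toNat p
  obtain ⟨δ, hδ⟩ := exists_posRoot_of_vertex hn hc E hl hu1 hu2
  have hq : p + u * (n + 1) + ((q + (n + 1) - p - 1).toNat : ℤ) + 1 - (n + 1) =
      q + u * (n + 1) := by omega
  rw [hq] at hδ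
  simp only [E.chi_shift, ← mul_add, ← hcoef] at hδ
  refine ⟨_, _, hl, hu1, hu2, fun k => ?_⟩
  rw [hq, E.chi_shift, E.chi_shift, ← mul_add, ← hcoef]
  rcases par_cases u with h | h
  · rw [h, one_mul]
  · exfalso
    have h0 : δ.1 = -γ.1 := by
      apply E.ext_of_coef hn
      intro k
      rw [hδ, h]
      unfold Frame.coef
      rw [eps_neg]
      ring
    have h1 : γ.1 = 0 := by
      funext i
      have := congrFun h0 i
      have g1 := γ.2.2 i
      have g2 := δ.2.2 i
      rw [this] at g2
      simp only [Pi.neg_apply, Pi.zero_apply] at *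
      omega
    have h2 := congrFun e a
    rw [h1, signedPair, if_pos rfl, if_neg hab] at h2
    have h3 : eps n (0 : RootLattice n) a = 0 := by
      have := eps_add (0 : RootLattice n) 0 a
      rw [add_zero] at this
      omega
    omega

/-! ### Positions of roots in reading words -/

lemma wordRoot_map (L : List (ℕ × ℤ)) (k : ℕ) (hk : k < L.length) :
    wordRoot n (L.map (letter n)) ⟨k, by simpa using hk⟩ =
      wordAct n ((L.take k).map (letter n)) (simpleRoot n (letter n L[k])) := by
  unfold wordRoot
  simp [List.map_take]

lemma wordRoot_vertex (hn : 2 ≤ n) {c : ℕ → ℤ} (hc : IsSection n c) (E : Frame n c)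
    {L : List (ℕ × ℤ)} (hL : Reads n c L (shift c (n + 1))) (k : ℕ) (hk : k < L.length) (j : ℤ) :
    E.coef j (eps n (wordRoot n (L.map (letter n)) ⟨k, by simpa using hk⟩)) =
      E.chi j L[k].2 + E.chi j (L[k].2 + L[k].1 + 1 - (n + 1)) := by
  rw [wordRoot_map]
  have : L = L.take k ++ (L[k].1, L[k].2) :: L.drop (k + 1) := by simp
  rw [this] at hL
  exact (isPosRoot_of_reads hn hc E hL).2 j

/-- Coordinates of the positive roots with respect to a twisted adapted word: the root `γ` is
`e_{P γ} + e_{R γ}`, and the commutation class of the word consists of the linear extensions of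
the componentwise order on the pairs `(P γ, R γ)`. -/
structure Chart (n : ℕ) (w : Word n) where
  c : ℕ → ℤ
  isSection : IsSection n c
  E : Frame n c
  P : PosRoot n → ℤ
  R : PosRoot n → ℤ
  R_lt : ∀ γ, R γ < P γ
  P_lt : ∀ γ, P γ < R γ + (n + 1)
  coef_eq : ∀ γ k, E.coef k (eps n γ.1) = E.chi k (P γ) + E.chi k (R γ)
  dom : ∀ α β, ¬ (P α + (n + 1) ≤ P β ∧ R α + (n + 1) ≤ R β)
  conv : ∀ α β (p r : ℤ), r < p → p < r + (n + 1) → P α ≤ p → p ≤ P β → R α ≤ r → r ≤ R β →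
    ∃ γ, P γ = p ∧ R γ = r
  lift : ∀ p r : ℤ, r < p → p < r + (n + 1) →
    ∃ t γ, P γ = p + t * (n + 1) ∧ R γ = r + t * (n + 1)
  before_of_le : ∀ w' α β, CommEquiv n w w' → α ≠ β → P α ≤ P β → R α ≤ R β → rootLT n w' α β
  exists_before : ∀ α β γ, ¬ (P γ ≤ P α ∧ R γ ≤ R α) → ¬ (P γ ≤ P β ∧ R γ ≤ R β) →
    ∃ w', CommEquiv n w w' ∧ rootLT n w' α γ ∧ rootLT n w' β γ
  asymm : ∀ w' α β, CommEquiv n w w' → rootLT n w' α β → ¬ rootLT n w' β α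
  total : ∀ w' α β, CommEquiv n w w' → α ≠ β → rootLT n w' α β ∨ rootLT n w' β α

/-- P is the position of the vertex and R is position + level - n, so the vertex order is the
componentwise one. `dom`, `conv` and `lift` describe the strip between a section and its translate;
`exists_before` comes from `exists_reads_split`. -/
lemma exists_chart (hn : 2 ≤ n) {w : Word n} (hw : IsTurn n w) : Nonempty (Chart n w) := by
  obtain ⟨c, hc, L, hL, rfl⟩ := hw
  obtain ⟨E⟩ := exists_frame hn hc
  choose lev P hlev hP1 hP2 hcoef using exists_vertex hn hc E
  have hinj : ∀ α β, lev α = lev β → P α = P β → α = β := by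
    intro α β h1 h2
    apply Subtype.ext
    apply E.ext_of_coef hn
    intro k
    rw [hcoef, hcoef, h1, h2]
  have hreading : ∀ w', CommEquiv n (L.map (letter n)) w' →
      ∃ L', Reads n c L' (shift c (n + 1)) ∧ w' = L'.map (letter n) :=
    fun w' h => (isReadingWord_of_commEquiv hn h).1 ⟨L, hL, rfl⟩
  have hmem : ∀ L', Reads n c L' (shift c (n + 1)) → ∀ γ, (lev γ, P γ) ∈ L' :=
    fun L' h γ => (h.mem_iff _ _).2 ⟨hlev γ, hP1 γ, hP2 γ⟩
  have hroot : ∀ L' (hL' : Reads n c L' (shift c (n + 1))) k (hk : k < L'.length) γ,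
      wordRoot n (L'.map (letter n)) ⟨k, by simpa using hk⟩ = γ.1 ↔ L'[k] = (lev γ, P γ) := by
    intro L' hL' k hk γ
    have h1 := wordRoot_vertex hn hc E hL' k hk
    obtain ⟨a1, a2, a3⟩ := (hL'.mem_iff L'[k].1 L'[k].2).1 (List.getElem_mem hk)
    constructor
    · intro h
      exact vertex_unique E (l := L'[k].1) (x := L'[k].2) a1 (hlev γ) ⟨a2, a3⟩ ⟨hP1 γ, hP2 γ⟩
        fun j => (h1 j).symm.trans (by rw [h, hcoef])
    · intro h
      apply E.ext_of_coef hn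
      intro j
      rw [h1, hcoef, h]
  have hlt : ∀ L' (_ : Reads n c L' (shift c (n + 1))) α β,
      rootLT n (L'.map (letter n)) α β ↔ ∃ (k l : ℕ) (hk : k < L'.length) (hl : l < L'.length),
        k < l ∧ L'[k] = (lev α, P α) ∧ L'[l] = (lev β, P β) := by
    intro L' hL' α β
    constructor
    · rintro ⟨⟨k, hk⟩, ⟨l, hl⟩, hkl, h1, h2⟩
      have hk' : k < L'.length := by simpa using hk
      have hl' : l < L'.length := by simpa using hl
      exact ⟨k, l, hk', hl', hkl, (hroot L' hL' k hk' α).1 h1, (hroot L' hL' l hl' β).1 h2⟩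
    · rintro ⟨k, l, hk, hl, hkl, h1, h2⟩
      exact ⟨⟨k, by simpa using hk⟩, ⟨l, by simpa using hl⟩, hkl, (hroot L' hL' k hk α).2 h1,
        (hroot L' hL' l hl β).2 h2⟩
  have hsplit : ∀ A B (_ : Reads n c (A ++ B) (shift c (n + 1))) α β, (lev α, P α) ∈ A →
      (lev β, P β) ∈ B → rootLT n ((A ++ B).map (letter n)) α β := by
    intro A B hAB α β hα hβ
    rw [hlt _ hAB]
    obtain ⟨i, hi, ei⟩ := List.getElem_of_mem hα
    obtain ⟨j, hj, ej⟩ := List.getElem_of_mem hβ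
    refine ⟨i, A.length + j, by simp; omega, by simp; omega, by omega, ?_, ?_⟩
    · rw [List.getElem_append_left hi, ei]
    · rw [List.getElem_append_right (by omega)]
      simp [ej]
  refine ⟨⟨c, hc, E, P, fun γ => P γ + lev γ + 1 - (n + 1), ?_, ?_, hcoef, ?_, ?_, ?_, ?_, ?_, ?_,
    ?_⟩⟩
  · intro γ; have := hlev γ; omega
  · intro γ; omega
  · rintro α β ⟨h1, h2⟩
    have h3 := (hc.shift (n + 1)).le_of_le (hlev α) (hlev β) (x := P α + (n + 1)) (y := P β)
      (by have := hP1 α; simp only [shift]; omega) h1 (by omega)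
    have := hP2 β
    simp only [shift] at h3
    omega
  · intro α β p r h1 h2 h3 h4 h5 h6
    have hl : (r + (n + 1) - p - 1).toNat < n := by omega
    have g1 := hc.le_of_le (hlev α) hl (x := P α) (y := p) (hP1 α) h3 (by omega)
    have g2 : p < c (r + (n + 1) - p - 1).toNat + (n + 1) := by
      by_contra hcon
      have h3 := (hc.shift (n + 1)).le_of_le hl (hlev β) (x := p) (y := P β)
        (by simp only [shift]; omega) h4 (by omega)
      have := hP2 β
      simp only [shift] at h3
      omega
    obtain ⟨γ, hγ⟩ := exists_posRoot_of_vertex hn hc E hl g1 g2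
    have hu := vertex_unique E hl (hlev γ) ⟨g1, g2⟩ ⟨hP1 γ, hP2 γ⟩
      fun k => by rw [← hγ, hcoef]
    rw [Prod.mk.injEq] at hu
    exact ⟨γ, hu.2.symm, by omega⟩
  · intro p r h1 h2
    have hl : (r + (n + 1) - p - 1).toNat < n := by omega
    obtain ⟨t, g1, g2⟩ := exists_lift (n := n) (c := c) (r + (n + 1) - p - 1).toNat p
    obtain ⟨γ, hγ⟩ := exists_posRoot_of_vertex hn hc E hl g1 g2
    have hu := vertex_unique E hl (hlev γ) ⟨g1, g2⟩ ⟨hP1 γ, hP2 γ⟩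
      fun k => by rw [← hγ, hcoef]
    rw [Prod.mk.injEq] at hu
    exact ⟨t, γ, hu.2.symm, by omega⟩
  · intro w' α β hw' hne h1 h2
    obtain ⟨L', hL', rfl⟩ := hreading w' hw'
    obtain ⟨A, B, rfl⟩ := List.append_of_mem (hmem L' hL' β)
    have hA := hL'.mem_of_le hc (hlev α) (hP1 α) h1 (by omega) (by
      intro h
      rw [Prod.mk.injEq] at h
      exact hne (hinj α β h.1 h.2))
    exact hsplit _ _ hL' α β hA List.mem_cons_self
  · intro α β γ h1 h2
    obtain ⟨A, B, hAB, hα, hβ, hγ⟩ := exists_reads_split hc (M := n + 1)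
      ⟨hlev α, hP1 α, hP2 α⟩ ⟨hlev β, hP1 β, hP2 β⟩ ⟨hlev γ, hP1 γ, hP2 γ⟩
      (fun h => h1 (by omega)) (fun h => h2 (by omega))
    exact ⟨_, hL.commEquiv hn hAB, hsplit A B hAB α γ hα hγ, hsplit A B hAB β γ hβ hγ⟩
  · intro w' α β hw' h1 h2
    obtain ⟨L', hL', rfl⟩ := hreading w' hw'
    rw [hlt _ hL'] at h1 h2
    obtain ⟨k, l, hk, hl, hkl, e1, e2⟩ := h1
    obtain ⟨k', l', hk', hl', hkl', e1', e2'⟩ := h2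
    have i1 := (List.Nodup.getElem_inj_iff hL'.nodup).1 (e1.trans e2'.symm)
    have i2 := (List.Nodup.getElem_inj_iff hL'.nodup).1 (e2.trans e1'.symm)
    omega
  · intro w' α β hw' hne
    obtain ⟨L', hL', rfl⟩ := hreading w' hw'
    rw [hlt _ hL', hlt _ hL']
    obtain ⟨i, hi, ei⟩ := List.getElem_of_mem (hmem L' hL' α)
    obtain ⟨j, hj, ej⟩ := List.getElem_of_mem (hmem L' hL' β)
    rcases lt_trichotomy i j with h | h | h
    · exact Or.inl ⟨i, j, hi, hj, h, ei, ej⟩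
    · subst h
      rw [ei, Prod.mk.injEq] at ej
      exact absurd (hinj α β ej.1 ej.2) hne
    · exact Or.inr ⟨j, i, hj, hi, h, ej, ei⟩

/-! ## The order on sequences below a pair -/

lemma wt_add (m m' : RootSeq n) : wt n (m + m') = wt n m + wt n m' :=
  Finsupp.sum_add_index' (by simp) (by intros; rw [add_smul])

lemma wt_single (α : PosRoot n) : wt n (single n α) = α.1 := by
  simp [wt, single]

lemma wt_pair (α β : PosRoot n) : wt n (pair n α β) = α.1 + β.1 := by
  rw [pair, wt_add, wt_single, wt_single]

lemma pair_comm (α β : PosRoot n) : pair n α β = pair n β α := add_comm _ _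

lemma single_apply_self (α : PosRoot n) : single n α α = 1 := by simp [single]

lemma single_apply_of_ne {α γ : PosRoot n} (h : γ ≠ α) : single n α γ = 0 := by
  simp [single, h.symm]

lemma pair_apply_left {α β : PosRoot n} (h : α ≠ β) : pair n α β α = 1 := by
  rw [pair, Finsupp.add_apply, single_apply_self, single_apply_of_ne h]

lemma pair_apply_right {α β : PosRoot n} (h : α ≠ β) : pair n α β β = 1 := by
  rw [pair_comm, pair_apply_left h.symm]

lemma pair_apply_of_ne {α β γ : PosRoot n} (h : γ ≠ α) (h' : γ ≠ β) : pair n α β γ = 0 := by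
  rw [pair, Finsupp.add_apply, single_apply_of_ne h, single_apply_of_ne h']

lemma exists_eq_single_add {m : RootSeq n} {γ : PosRoot n} (h : 0 < m γ) :
    ∃ m', m = single n γ + m' ∧ ∀ δ, 0 < m' δ → 0 < m δ := by
  have hle : single n γ ≤ m := by
    intro δ
    by_cases hδ : δ = γ
    · subst hδ; rw [single_apply_self]; omega
    · rw [single_apply_of_ne hδ]; omega
  refine ⟨m - single n γ, (add_tsub_cancel_of_le hle).symm, fun δ hδ => ?_⟩
  rw [Finsupp.tsub_apply] at hδ
  omega

/-! ### Weights in a chart and the order below a pair -/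

namespace Chart

variable {w : Word n} (C : Chart n w)

/-- The componentwise order on positive roots. -/
def Le (α β : PosRoot n) : Prop := C.P α ≤ C.P β ∧ C.R α ≤ C.R β

/-- The coefficient of the weight of a sequence at `e_k`. -/
def wtCoef (m : RootSeq n) (k : ℤ) : ℤ := C.E.coef k (eps n (wt n m))

lemma wtCoef_add (m m' : RootSeq n) (k : ℤ) :
    C.wtCoef (m + m') k = C.wtCoef m k + C.wtCoef m' k := by
  unfold wtCoef Frame.coef
  rw [wt_add, eps_add]
  ring

lemma wtCoef_single (α : PosRoot n) (k : ℤ) :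
    C.wtCoef (single n α) k = C.E.chi k (C.P α) + C.E.chi k (C.R α) := by
  rw [wtCoef, wt_single, C.coef_eq]

lemma wtCoef_zero (k : ℤ) : C.wtCoef 0 k = 0 := by
  have := C.wtCoef_add 0 0 k
  rw [add_zero] at this
  omega

lemma wtCoef_pair (α β : PosRoot n) (k : ℤ) : C.wtCoef (pair n α β) k =
    C.E.chi k (C.P α) + C.E.chi k (C.R α) + (C.E.chi k (C.P β) + C.E.chi k (C.R β)) := by
  rw [pair, wtCoef_add, wtCoef_single, wtCoef_single]

lemma wt_eq_of_wtCoef (hn : 2 ≤ n) {m m' : RootSeq n} (h : ∀ k, C.wtCoef m k = C.wtCoef m' k) :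
    wt n m = wt n m' := C.E.ext_of_coef hn h

lemma root_ext (hn : 2 ≤ n) {α β : PosRoot n} (hP : C.P α = C.P β) (hR : C.R α = C.R β) :
    α = β := by
  apply Subtype.ext
  apply C.E.ext_of_coef hn
  intro k
  rw [C.coef_eq, C.coef_eq, hP, hR]

lemma exists_coord_pos (C : Chart n w) (γ : PosRoot n) : ∃ i, 0 < γ.1 i := by
  by_contra! h
  have h0 : γ.1 = 0 := funext fun i => le_antisymm (h i) (γ.2.2 i)
  have h1 := C.coef_eq γ (C.P γ)
  have h2 := C.R_lt γ
  have h3 := C.P_lt γ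
  rw [C.E.chi_self, C.E.chi_eq_zero (x := C.P γ) (y := C.R γ) (by omega) (by omega)
    (by omega), ← wt_single, ← wtCoef, wtCoef, wt_single, h0] at h1
  have h4 := C.wtCoef_zero (C.P γ)
  rw [wtCoef, show wt n 0 = 0 from Finsupp.sum_zero_index] at h4
  omega

lemma eq_zero_of_wt (C : Chart n w) {m : RootSeq n} (h : wt n m = 0) : m = 0 := by
  ext γ
  by_contra hγ
  obtain ⟨m', rfl, -⟩ := exists_eq_single_add (m := m) (γ := γ) (Nat.pos_of_ne_zero hγ)
  obtain ⟨i, hi⟩ := C.exists_coord_pos γ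
  have h1 := congrFun h i
  rw [wt_add, wt_single] at h1
  have h2 : 0 ≤ wt n m' i := by
    rw [wt, Finsupp.sum, Finset.sum_apply]
    exact Finset.sum_nonneg fun δ _ => by
      simpa using mul_nonneg (Int.natCast_nonneg _) (δ.2.2 i)
  simp only [Pi.add_apply, Pi.zero_apply] at h1
  omega

lemma eq_zero_of_wtCoef (hn : 2 ≤ n) {m : RootSeq n} (h : ∀ k, C.wtCoef m k = 0) : m = 0 :=
  C.eq_zero_of_wt <| (C.wt_eq_of_wtCoef hn fun k => by rw [h, C.wtCoef_zero]).trans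
    Finsupp.sum_zero_index

/-- `m` has the same weight as the pair `(α, β)` and consists of roots strictly between them. -/
def Below (α β : PosRoot n) (m : RootSeq n) : Prop :=
  wt n m = wt n (pair n α β) ∧
    ∀ γ, 0 < m γ → C.Le α γ ∧ C.Le γ β ∧ γ ≠ α ∧ γ ≠ β

/-- The first and last differences occur where the pair is positive, so at α or β. If both were at
the same root, m would be the other root alone and have too small a weight. Hence m differs from the
pair first at α and last at β. -/
lemma between_of_bilexLT (C : Chart n w) {w' : Word n} (hw' : CommEquiv n w w') {α β : PosRoot n}
    (hαβ : rootLT n w' α β) {m : RootSeq n} (hwt : wt n m = wt n (pair n α β))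
    (h : bilexLT n w' m (pair n α β)) :
    m α = 0 ∧ m β = 0 ∧ ∀ γ, 0 < m γ → rootLT n w' α γ ∧ rootLT n w' γ β := by
  have irr : ∀ γ, ¬ rootLT n w' γ γ := fun γ h => C.asymm w' γ γ hw' h h
  have hne : α ≠ β := by rintro rfl; exact irr _ hαβ
  have hmem : ∀ γ, m γ < pair n α β γ → γ = α ∨ γ = β := by
    intro γ hγ
    by_contra! hc
    rw [pair_apply_of_ne hc.1 hc.2] at hγ
    omega
  have hlone : ∀ δ δ', δ ≠ δ' → wt n m = wt n (pair n δ δ') →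
      (∀ γ, γ ≠ δ → m γ = pair n δ δ' γ) → m δ = 0 → False := by
    intro δ δ' hd hw h1 h0
    have hm : m = single n δ' := by
      ext γ
      by_cases hγ : γ = δ
      · rw [hγ, h0, single_apply_of_ne hd]
      · rw [h1 γ hγ, pair, Finsupp.add_apply, single_apply_of_ne hγ, zero_add]
    rw [hm, wt_single, wt_pair] at hw
    obtain ⟨i, hi⟩ := C.exists_coord_pos δ
    have := congrFun hw i
    simp only [Pi.add_apply] at this
    omega
  obtain ⟨⟨a, ha, ha'⟩, b, hb, hb'⟩ := h
  rcases hmem a ha with rfl | rfl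
  · rw [pair_apply_left hne] at ha
    rcases hmem b hb with rfl | rfl
    · exfalso
      refine hlone _ _ hne hwt (fun γ hγ => ?_) (by omega)
      rcases C.total w' γ _ hw' hγ with h | h
      · exact ha' _ h
      · exact hb' _ h
    · rw [pair_apply_right hne] at hb
      refine ⟨by omega, by omega, fun γ hγ => ⟨?_, ?_⟩⟩
      · rcases C.total w' a γ hw' (by rintro rfl; omega) with h | h
        · exact h
        · have := ha' γ h
          rw [pair_apply_of_ne (by rintro rfl; exact irr _ h)
            (by rintro rfl; exact C.asymm w' _ _ hw' hαβ h)] at this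
          omega
      · rcases C.total w' γ b hw' (by rintro rfl; omega) with h | h
        · exact h
        · have := hb' γ h
          rw [pair_apply_of_ne (by rintro rfl; exact C.asymm w' _ _ hw' hαβ h)
            (by rintro rfl; exact irr _ h)] at this
          omega
  · rw [pair_apply_right hne] at ha
    rcases hmem b hb with rfl | rfl
    · have := ha' _ hαβ
      omega
    · exfalso
      refine hlone _ _ hne.symm (hwt.trans (by rw [pair_comm])) (fun γ hγ => ?_) (by omega)
      rw [pair_comm]
      rcases C.total w' γ _ hw' hγ with h | h
      · exact ha' _ h
      · exact hb' _ h

lemma between_of_precB (C : Chart n w) {α β : PosRoot n} (hne : α ≠ β) {m : RootSeq n}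
    (h : precB n w m (pair n α β)) {w' : Word n} (hw' : CommEquiv n w w') :
    m α = 0 ∧ m β = 0 ∧ ∀ γ, 0 < m γ →
      (rootLT n w' α γ ∧ rootLT n w' γ β) ∨ (rootLT n w' β γ ∧ rootLT n w' γ α) := by
  have h2 := h.2 w' hw'
  rcases C.total w' α β hw' hne with hlt | hlt
  · obtain ⟨e1, e2, e3⟩ := C.between_of_bilexLT hw' hlt h.1 h2
    exact ⟨e1, e2, fun γ hγ => Or.inl (e3 γ hγ)⟩
  · rw [pair_comm] at h2
    obtain ⟨e1, e2, e3⟩ := C.between_of_bilexLT hw' hlt (by rw [h.1, pair_comm]) h2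
    exact ⟨e2, e1, fun γ hγ => Or.inr (e3 γ hγ)⟩

/-- If α and β are incomparable, any root γ of m can be placed by a suitable reading before or after
both of them, against `between_of_precB`. -/
lemma le_or_le_of_precB (C : Chart n w) {α β : PosRoot n} (hne : α ≠ β) {m : RootSeq n}
    (h : precB n w m (pair n α β)) : C.Le α β ∨ C.Le β α := by
  obtain ⟨γ, hγ⟩ : ∃ γ, 0 < m γ := by
    by_contra! hm
    have hm : m = 0 := by ext γ; have := hm γ; simpa using this
    have h1 := h.1
    rw [hm, wt_pair, show wt n 0 = 0 from Finsupp.sum_zero_index] at h1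
    obtain ⟨i, hi⟩ := C.exists_coord_pos α
    have h2 := congrFun h1 i
    have := β.2.2 i
    simp only [Pi.add_apply, Pi.zero_apply] at h2
    omega
  by_contra! hc
  have hγ' := fun (w' : Word n) (hw' : CommEquiv n w w') =>
    (C.between_of_precB hne h hw').2.2 γ hγ
  have h0 := C.between_of_precB hne h (.refl w)
  have hγα : γ ≠ α := by rintro rfl; omega
  have hγβ : γ ≠ β := by rintro rfl; omega
  by_cases h1 : C.Le γ α
  · obtain ⟨w', hw', h2, -⟩ := C.exists_before α α β hc.2 hc.2
    have h3 := C.before_of_le w' γ α hw' hγα h1.1 h1.2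
    rcases hγ' w' hw' with h4 | h4
    · exact C.asymm w' _ _ hw' h4.1 h3
    · have h5 := C.between_of_bilexLT hw' h2 h.1 (h.2 w' hw')
      exact C.asymm w' _ _ hw' (h5.2.2 γ hγ).1 h3
  by_cases h2 : C.Le γ β
  · obtain ⟨w', hw', h3, -⟩ := C.exists_before β β α hc.1 hc.1
    have h4 := C.before_of_le w' γ β hw' hγβ h2.1 h2.2
    have h5 := C.between_of_bilexLT hw' h3 (by rw [h.1, pair_comm])
      (by rw [pair_comm]; exact h.2 w' hw')
    exact C.asymm w' _ _ hw' (h5.2.2 γ hγ).1 h4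
  · obtain ⟨w', hw', h3, h4⟩ := C.exists_before α β γ h1 h2
    rcases hγ' w' hw' with h5 | h5
    · exact C.asymm w' _ _ hw' h4 h5.2
    · exact C.asymm w' _ _ hw' h3 h5.2

/-- Being between α and β in all readings is the same as being between them componentwise, since an
order not forced by the coordinates is reversed in some reading. This removes words from the rest of
the argument. -/
lemma precB_iff_below {α β : PosRoot n} (hne : α ≠ β) (hle : C.Le α β) (m : RootSeq n) :
    precB n w m (pair n α β) ↔ C.Below α β m := by
  constructor
  · intro h
    have h0 := C.between_of_precB hne h (.refl w)
    refine ⟨h.1, fun γ hγ => ?_⟩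
    have hb := fun (w' : Word n) (hw' : CommEquiv n w w') =>
      (C.between_of_bilexLT hw' (C.before_of_le w' α β hw' hne hle.1 hle.2) h.1
        (h.2 w' hw')).2.2 γ hγ
    refine ⟨?_, ?_, by rintro rfl; omega, by rintro rfl; omega⟩
    · by_contra hc
      obtain ⟨w', hw', h2, -⟩ := C.exists_before γ γ α hc hc
      exact C.asymm w' _ _ hw' h2 (hb w' hw').1
    · by_contra hc
      obtain ⟨w', hw', h2, -⟩ := C.exists_before β β γ hc hc
      exact C.asymm w' _ _ hw' h2 (hb w' hw').2
  · rintro ⟨h1, h2⟩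
    have hmα : m α = 0 := by
      by_contra hc
      exact (h2 α (Nat.pos_of_ne_zero hc)).2.2.1 rfl
    have hmβ : m β = 0 := by
      by_contra hc
      exact (h2 β (Nat.pos_of_ne_zero hc)).2.2.2 rfl
    refine ⟨h1, fun w' hw' => ?_⟩
    have hlt := C.before_of_le w' α β hw' hne hle.1 hle.2
    have irr : ∀ γ, ¬ rootLT n w' γ γ := fun γ h => C.asymm w' γ γ hw' h h
    refine ⟨⟨α, by rw [hmα, pair_apply_left hne]; omega, fun γ hγ => ?_⟩,
      β, by rw [hmβ, pair_apply_right hne]; omega, fun γ hγ => ?_⟩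
    · rw [pair_apply_of_ne (by rintro rfl; exact irr _ hγ)
        (by rintro rfl; exact C.asymm w' _ _ hw' hlt hγ)]
      by_contra hc
      obtain ⟨e1, -, e3, -⟩ := h2 γ (Nat.pos_of_ne_zero hc)
      exact C.asymm w' _ _ hw' hγ (C.before_of_le w' α γ hw' e3.symm e1.1 e1.2)
    · rw [pair_apply_of_ne (by rintro rfl; exact C.asymm w' _ _ hw' hlt hγ)
        (by rintro rfl; exact irr _ hγ)]
      by_contra hc
      obtain ⟨-, e2, -, e4⟩ := h2 γ (Nat.pos_of_ne_zero hc)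
      exact C.asymm w' _ _ hw' hγ (C.before_of_le w' γ β hw' e4 e2.1 e2.2)

end Chart

/-! ## The sequences below a pair -/

namespace Chart

variable {w : Word n} (C : Chart n w)

lemma wtCoef_eq_sum (m : RootSeq n) (k : ℤ) : C.wtCoef m k =
    m.sum fun γ a => (a : ℤ) * (C.E.chi k (C.P γ) + C.E.chi k (C.R γ)) := by
  induction m using Finsupp.induction_linear with
  | zero => rw [C.wtCoef_zero, Finsupp.sum_zero_index]
  | add f g hf hg =>
    rw [C.wtCoef_add, hf, hg, Finsupp.sum_add_index' (by simp)]
    intro γ a b; push_cast; ring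
  | single γ a =>
    rw [Finsupp.sum_single_index (by simp)]
    induction a with
    | zero => rw [Finsupp.single_zero, C.wtCoef_zero]; simp
    | succ a ih =>
      rw [Finsupp.single_add, C.wtCoef_add, ih, ← single, C.wtCoef_single]
      push_cast; ring

/-- The coordinates of the roots of `m` lie in an interval. -/
def InBox (m : RootSeq n) (lo hi : ℤ) : Prop := ∀ γ, 0 < m γ → lo ≤ C.R γ ∧ C.P γ ≤ hi

variable {C}

lemma InBox.of_add {m m' : RootSeq n} {lo hi : ℤ} (h : C.InBox (m + m') lo hi) :
    C.InBox m' lo hi := fun γ hγ => h γ (by rw [Finsupp.add_apply]; omega)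

lemma chi_spec {k p lo hi : ℤ} (hhi : hi < lo + 2 * (n + 1)) (hk : lo ≤ k ∧ k ≤ hi)
    (hp : lo ≤ p ∧ p ≤ hi) : (p = k ∧ C.E.chi k p = 1) ∨
      ((p = k + (n + 1) ∨ k = p + (n + 1)) ∧ C.E.chi k p = -1) ∨
      (p ≠ k ∧ p ≠ k + (n + 1) ∧ k ≠ p + (n + 1) ∧ C.E.chi k p = 0) := by
  have := C.E.chi_eq (k := k) (p := p) (by omega) (by omega)
  split_ifs at this <;> omega

lemma InBox.exists_of_pos {m : RootSeq n} {lo hi k : ℤ} (h : C.InBox m lo hi)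
    (hhi : hi < lo + 2 * (n + 1)) (hk : lo ≤ k ∧ k ≤ hi) (hpos : 0 < C.wtCoef m k) :
    ∃ γ, 0 < m γ ∧ (C.P γ = k ∨ C.R γ = k) := by
  by_contra! hc
  rw [wtCoef_eq_sum] at hpos
  refine absurd hpos (not_lt.2 (Finset.sum_nonpos fun γ hγ => ?_))
  have hγ : 0 < m γ := Nat.pos_of_ne_zero (Finsupp.mem_support_iff.1 hγ)
  have h1 := hc γ hγ
  have h2 := h γ hγ
  have h3 := C.R_lt γ
  have a1 := chi_spec (C := C) (p := C.P γ) hhi hk (by omega)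
  have a2 := chi_spec (C := C) (p := C.R γ) hhi hk (by omega)
  exact mul_nonpos_of_nonneg_of_nonpos (by omega) (by omega)

lemma InBox.exists_of_neg {m : RootSeq n} {lo hi k : ℤ} (h : C.InBox m lo hi)
    (hhi : hi < lo + 2 * (n + 1)) (hk : lo ≤ k ∧ k ≤ hi) (hpos : C.wtCoef m k < 0) :
    ∃ γ, 0 < m γ ∧ (C.P γ = k + (n + 1) ∨ C.R γ = k + (n + 1) ∨ k = C.P γ + (n + 1) ∨
      k = C.R γ + (n + 1)) := by
  by_contra! hc
  rw [wtCoef_eq_sum] at hpos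
  refine absurd hpos (not_lt.2 (Finset.sum_nonneg fun γ hγ => ?_))
  have hγ : 0 < m γ := Nat.pos_of_ne_zero (Finsupp.mem_support_iff.1 hγ)
  have h1 := hc γ hγ
  have h2 := h γ hγ
  have h3 := C.R_lt γ
  have a1 := chi_spec (C := C) (p := C.P γ) hhi hk (by omega)
  have a2 := chi_spec (C := C) (p := C.R γ) hhi hk (by omega)
  exact mul_nonneg (by omega) (by omega)

/-- No integer of the box is at distance n + 1 from k, so no root of m contributes negatively at k
and nothing cancels there. -/
lemma InBox.pos {m : RootSeq n} {lo hi k : ℤ} (h : C.InBox m lo hi)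
    (hhi : hi < lo + 2 * (n + 1)) (h1 : hi < k + (n + 1)) (h2 : k < lo + (n + 1)) {γ : PosRoot n}
    (hγ : 0 < m γ) (hk : C.P γ = k ∨ C.R γ = k) : 0 < C.wtCoef m k := by
  have h0 := h γ hγ
  have hk' : lo ≤ k ∧ k ≤ hi := by have := C.R_lt γ; omega
  have key : ∀ δ, 0 < m δ → 0 ≤ C.E.chi k (C.P δ) + C.E.chi k (C.R δ) ∧
      (C.P δ = k ∨ C.R δ = k → 0 < C.E.chi k (C.P δ) + C.E.chi k (C.R δ)) := by
    intro δ hδ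
    have h2 := h δ hδ
    have h3 := C.R_lt δ
    have a1 := chi_spec (C := C) (p := C.P δ) hhi hk' (by omega)
    have a2 := chi_spec (C := C) (p := C.R δ) hhi hk' (by omega)
    omega
  rw [wtCoef_eq_sum]
  refine Finset.sum_pos' (fun δ hδ => ?_) ⟨γ, Finsupp.mem_support_iff.2 hγ.ne', ?_⟩
  · exact mul_nonneg (by omega)
      (key δ (Nat.pos_of_ne_zero (Finsupp.mem_support_iff.1 hδ))).1
  · exact mul_pos (by omega) ((key γ hγ).2 hk)

lemma eq_single_of_wtCoef (hn : 2 ≤ n) {m : RootSeq n} {a b : ℤ} {γ : PosRoot n} (hγ : 0 < m γ)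
    (hP : C.P γ = a) (hR : C.R γ = b)
    (h : ∀ k, C.wtCoef m k = C.E.chi k a + C.E.chi k b) : m = single n γ := by
  obtain ⟨m', rfl, -⟩ := exists_eq_single_add hγ
  rw [C.eq_zero_of_wtCoef hn (m := m') fun k => ?_, add_zero]
  have := h k
  rw [C.wtCoef_add, C.wtCoef_single, hP, hR] at this
  omega

/-- A sequence of weight `e_a + e_b` in a short interval is a root. -/
lemma InBox.eq_single (hn : 2 ≤ n) {m : RootSeq n} {lo hi a b : ℤ} (h : C.InBox m lo hi)
    (hhi : hi < lo + (n + 1)) (hb : lo ≤ b) (hba : b ≤ a) (ha : a ≤ hi)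
    (hW : ∀ k, C.wtCoef m k = C.E.chi k a + C.E.chi k b) :
    ∃ γ, m = single n γ ∧ C.P γ = a ∧ C.R γ = b := by
  have hhi' : hi < lo + 2 * (n + 1) := by omega
  have hmem : ∀ γ, 0 < m γ → ∀ k, C.P γ = k ∨ C.R γ = k → k = a ∨ k = b := by
    intro γ hγ k hk
    have h0 := h γ hγ
    have h3 := C.R_lt γ
    have h1 := h.pos hhi' (k := k) (by omega) (by omega) hγ hk
    rw [hW] at h1
    have a1 := chi_spec (C := C) (k := k) (p := a) hhi' (by omega) (by omega)
    have a2 := chi_spec (C := C) (k := k) (p := b) hhi' (by omega) (by omega)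
    omega
  obtain ⟨γ, hγ, hk⟩ := h.exists_of_pos hhi' (k := a) (by omega) (by
    rw [hW, C.E.chi_self]
    have a2 := chi_spec (C := C) (k := a) (p := b) hhi' (by omega) (by omega)
    omega)
  have h1 := hmem γ hγ _ (Or.inl rfl)
  have h2 := hmem γ hγ _ (Or.inr rfl)
  have h3 := C.R_lt γ
  have h4 : C.P γ = a := by omega
  have h5 : C.R γ = b := by omega
  exact ⟨γ, eq_single_of_wtCoef hn hγ h4 h5 hW, h4, h5⟩

/-! ### Bounds for comparable roots -/

/-- By `dom` one of the two coordinates grows by less than n + 1, and P and R of a root differ by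
less than n + 1. So `chi_spec` applies on the whole interval from `R α` to `P β`. -/
lemma lt_of_le {α β : PosRoot n} (h : C.Le α β) : C.P β < C.R α + 2 * (n + 1) := by
  have h1 := C.dom α β
  have h2 := C.P_lt α
  have h3 := C.P_lt β
  have h4 := h.1
  have h5 := h.2
  omega

lemma Below.inBox {α β : PosRoot n} {m : RootSeq n} (h : C.Below α β m) :
    C.InBox m (C.R α) (C.P β) := fun γ hγ => ⟨(h.2 γ hγ).1.2, (h.2 γ hγ).2.1.1⟩

lemma Below.wtCoef {α β : PosRoot n} {m : RootSeq n} (h : C.Below α β m) (k : ℤ) :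
    C.wtCoef m k = C.E.chi k (C.P α) + C.E.chi k (C.R α) +
      (C.E.chi k (C.P β) + C.E.chi k (C.R β)) := by
  rw [← wtCoef_pair, Chart.wtCoef, h.1, Chart.wtCoef]

lemma Below.of_wtCoef (hn : 2 ≤ n) {α β : PosRoot n} {m : RootSeq n}
    (h : ∀ k, C.wtCoef m k = C.E.chi k (C.P α) + C.E.chi k (C.R α) +
      (C.E.chi k (C.P β) + C.E.chi k (C.R β)))
    (h' : ∀ γ, 0 < m γ → C.P α ≤ C.P γ ∧ C.R α ≤ C.R γ ∧ C.P γ ≤ C.P β ∧ C.R γ ≤ C.R β ∧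
      (C.P γ ≠ C.P α ∨ C.R γ ≠ C.R α) ∧ (C.P γ ≠ C.P β ∨ C.R γ ≠ C.R β)) :
    C.Below α β m := by
  refine ⟨C.wt_eq_of_wtCoef hn fun k => by rw [h, wtCoef_pair], fun γ hγ => ?_⟩
  obtain ⟨h1, h2, h3, h4, h5, h6⟩ := h' γ hγ
  refine ⟨⟨h1, h2⟩, ⟨h3, h4⟩, ?_, ?_⟩
  · rintro rfl; simp at h5
  · rintro rfl; simp at h6

lemma Below.mem (hn : 2 ≤ n) {α β : PosRoot n} {m : RootSeq n} (h : C.Below α β m) {γ : PosRoot n}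
    (hγ : 0 < m γ) : C.P α ≤ C.P γ ∧ C.R α ≤ C.R γ ∧ C.P γ ≤ C.P β ∧ C.R γ ≤ C.R β ∧
      (C.P γ ≠ C.P α ∨ C.R γ ≠ C.R α) ∧ (C.P γ ≠ C.P β ∨ C.R γ ≠ C.R β) ∧
      C.R γ < C.P γ ∧ C.P γ < C.R γ + (n + 1) := by
  obtain ⟨h1, h2, h3, h4⟩ := h.2 γ hγ
  refine ⟨h1.1, h1.2, h2.1, h2.2, ?_, ?_, C.R_lt γ, C.P_lt γ⟩
  · by_contra! hc; exact h3 (C.root_ext hn hc.1 hc.2)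
  · by_contra! hc; exact h4 (C.root_ext hn hc.1 hc.2)

lemma single_pos_iff {γ δ : PosRoot n} : 0 < single n γ δ ↔ δ = γ := by
  by_cases h : δ = γ
  · simp [h, single_apply_self]
  · simp [h, single_apply_of_ne]

lemma pair_pos {γ γ' δ : PosRoot n} (h : 0 < pair n γ γ' δ) : δ = γ ∨ δ = γ' := by
  by_contra! hc
  rw [pair_apply_of_ne hc.1 hc.2] at h
  omega

/-! ### Short intervals -/

lemma Below.exists_of_short (hn : 2 ≤ n) {α β : PosRoot n} {m : RootSeq n} (h : C.Below α β m)
    (hle : C.Le α β) (hs : C.P β < C.R α + (n + 1)) :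
    C.R α < C.R β ∧ C.P α < C.P β ∧ ∃ γ, 0 < m γ ∧ C.R γ = C.R α ∧
      (C.P γ = C.P β ∨ (C.P γ = C.R β ∧ C.P α < C.R β)) := by
  have b1 := C.R_lt α
  have b2 := C.R_lt β
  have b3 := hle.1
  have b4 := hle.2
  have hhi : C.P β < C.R α + 2 * (n + 1) := by omega
  have key := fun (k : ℤ) (hk : C.R α ≤ k ∧ k ≤ C.P β) => And.intro
    (And.intro (chi_spec (C := C) (p := C.P α) hhi hk (by omega))
      (chi_spec (C := C) (p := C.R α) hhi hk (by omega)))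
    (And.intro (chi_spec (C := C) (p := C.P β) hhi hk (by omega))
      (chi_spec (C := C) (p := C.R β) hhi hk (by omega)))
  obtain ⟨γ, hγ, hk⟩ := h.inBox.exists_of_pos hhi (k := C.R α) (by omega) (by
    rw [h.wtCoef]
    have := key (C.R α) (by omega)
    omega)
  obtain ⟨g1, g2, g3, g4, g5, g6, g7, g8⟩ := h.mem hn hγ
  have hR : C.R γ = C.R α := by omega
  have h1 := h.inBox.pos hhi (k := C.P γ) (by omega) (by omega) hγ (Or.inl rfl)
  rw [h.wtCoef] at h1
  have := key (C.P γ) (by omega)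
  refine ⟨by omega, by omega, γ, hγ, hR, by omega⟩

/-- The leftmost endpoint is used by some root γ, and the two endpoints left over form a single
root. The alternatives are the nested and the crossing matching. -/
lemma Below.eq_pair_of_short (hn : 2 ≤ n) {α β : PosRoot n} {m : RootSeq n} (h : C.Below α β m)
    (hle : C.Le α β) (hs : C.P β < C.R α + (n + 1)) :
    ∃ γ δ, m = pair n γ δ ∧
      ((C.R γ = C.R α ∧ C.P γ = C.P β ∧ C.R δ = min (C.P α) (C.R β) ∧
        C.P δ = max (C.P α) (C.R β)) ∨
      (C.P α < C.R β ∧ C.R γ = C.R α ∧ C.P γ = C.R β ∧ C.R δ = C.P α ∧ C.P δ = C.P β)) := by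
  obtain ⟨h1, h2, γ, hγ, hR, hP⟩ := h.exists_of_short hn hle hs
  have b1 := C.R_lt α
  have b2 := C.R_lt β
  have b3 := hle.1
  have b4 := hle.2
  obtain ⟨m', rfl, -⟩ := exists_eq_single_add hγ
  have hbox := h.inBox.of_add
  have hW := h.wtCoef
  simp only [C.wtCoef_add, C.wtCoef_single, hR] at hW
  rcases hP with hP | ⟨hP, hlt⟩
  · obtain ⟨δ, rfl, d1, d2⟩ := hbox.eq_single hn hs (a := max (C.P α) (C.R β))
      (b := min (C.P α) (C.R β)) (by omega) (by omega) (by omega) (fun k => by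
        have := hW k
        rw [hP] at this
        rcases le_total (C.P α) (C.R β) with h' | h'
        · rw [max_eq_right h', min_eq_left h']; omega
        · rw [max_eq_left h', min_eq_right h']; omega)
    exact ⟨γ, δ, rfl, Or.inl ⟨hR, hP, d2, d1⟩⟩
  · obtain ⟨δ, rfl, d1, d2⟩ := hbox.eq_single hn hs (a := C.P β)
      (b := C.P α) (by omega) (by omega) (by omega) (fun k => by
        have := hW k
        rw [hP] at this
        omega)
    exact ⟨γ, δ, rfl, Or.inr ⟨hlt, hR, hP, d2, d1⟩⟩

/-! ### Intervals of length `n + 1` -/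

/-- Here e_{P β} = -e_{R α}, so the weight is e_{P α} + e_{R β}. It is realised by one root, or by
the crossing matching, where the outer endpoints still cancel. -/
lemma Below.eq_of_middle (hn : 2 ≤ n) {α β : PosRoot n} {m : RootSeq n} (h : C.Below α β m)
    (hle : C.Le α β) (hs : C.P β = C.R α + (n + 1)) :
    (∃ γ, m = single n γ ∧ C.P γ = max (C.P α) (C.R β) ∧ C.R γ = min (C.P α) (C.R β)) ∨
    (C.P α < C.R β ∧ ∃ γ δ, m = pair n γ δ ∧ C.R γ = C.R α ∧ C.P γ = C.R β ∧ C.R δ = C.P α ∧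
      C.P δ = C.P β) := by
  have b1 := C.R_lt α
  have b2 := C.R_lt β
  have b3 := hle.1
  have b4 := hle.2
  have b5 := C.P_lt α
  have b6 := C.P_lt β
  have hhi : C.P β < C.R α + 2 * (n + 1) := by omega
  have hcan : ∀ k, C.E.chi k (C.P β) = -C.E.chi k (C.R α) := fun k => by rw [hs, C.E.chi_add]
  have hW : ∀ k, C.wtCoef m k = C.E.chi k (C.P α) + C.E.chi k (C.R β) := fun k => by
    have := h.wtCoef k; have := hcan k; omega
  have hx := fun (k : ℤ) (hk : C.R α ≤ k ∧ k ≤ C.P β) =>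
    chi_spec (C := C) (p := C.P α) hhi hk (by omega)
  have hz' := fun (k : ℤ) (hk : C.R α ≤ k ∧ k ≤ C.P β) =>
    chi_spec (C := C) (p := C.R β) hhi hk (by omega)
  have hz := fun (k : ℤ) (hk : C.R α ≤ k ∧ k ≤ C.P β) =>
    chi_spec (C := C) (p := C.R α) hhi hk (by omega)
  obtain ⟨γ, hγ, hk⟩ := h.inBox.exists_of_pos hhi (k := C.P α) (by omega) (by
    rw [hW]
    have := hx (C.P α) (by omega)
    have := hz' (C.P α) (by omega)
    omega)
  obtain ⟨g1, g2, g3, g4, g5, g6, g7, g8⟩ := h.mem hn hγ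
  rcases hk with hk | hk
  · have h1 := h.inBox.pos hhi (k := C.R γ) (by omega) (by omega) hγ (Or.inr rfl)
    rw [hW] at h1
    have := hx (C.R γ) (by omega)
    have := hz' (C.R γ) (by omega)
    have hR : C.R γ = C.R β := by omega
    exact Or.inl ⟨γ, eq_single_of_wtCoef hn hγ hk hR hW, by omega, by omega⟩
  -- If γ ends at `P β`, whose contribution cancels in the total weight, the rest of m has weight
  -- e_{R β} + e_{R α}.
  · by_cases hp : C.P γ = C.P β
    · right
      obtain ⟨m', rfl, hm'⟩ := exists_eq_single_add hγ
      have hbox := h.inBox.of_add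
      have hW' : ∀ k, C.wtCoef m' k = C.E.chi k (C.R β) + C.E.chi k (C.R α) := fun k => by
        have h1 := hW k
        have := hcan k
        rw [C.wtCoef_add, C.wtCoef_single, hp, hk] at h1
        omega
      obtain ⟨δ, hδ, hk'⟩ := hbox.exists_of_pos hhi (k := C.R β) (by omega) (by
        rw [hW']
        have := hz (C.R β) (by omega)
        have := hz' (C.R β) (by omega)
        omega)
      obtain ⟨d1, d2, d3, d4, d5, d6, d7, d8⟩ := h.mem hn (hm' δ hδ)
      have hPδ : C.P δ = C.R β := by
        by_contra hne
        have h1 := hbox.pos hhi (k := C.P δ) (by omega) (by omega) hδ (Or.inl rfl)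
        rw [hW'] at h1
        have := hz (C.P δ) (by omega)
        have := hz' (C.P δ) (by omega)
        omega
      have hRδ : C.R δ = C.R α := by
        by_contra hne
        have h1 := hbox.pos hhi (k := C.R δ) (by omega) (by omega) hδ (Or.inr rfl)
        rw [hW'] at h1
        have := hz (C.R δ) (by omega)
        have := hz' (C.R δ) (by omega)
        omega
      refine ⟨by omega, δ, γ, ?_, hRδ, hPδ, hk, hp⟩
      rw [eq_single_of_wtCoef hn hδ hPδ hRδ hW', pair, add_comm]
    · have h1 := h.inBox.pos hhi (k := C.P γ) (by omega) (by omega) hγ (Or.inl rfl)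
      rw [hW] at h1
      have := hx (C.P γ) (by omega)
      have := hz' (C.P γ) (by omega)
      have hP : C.P γ = C.R β := by omega
      refine Or.inl ⟨γ, eq_single_of_wtCoef hn hγ hP hk fun k => ?_, by omega, by omega⟩
      rw [hW, add_comm]

/-! ### Long intervals -/

/-- Unless the two vectors cancel, the coefficient at P β - (n + 1) is negative, which inside the
box only a root ending at `P β` can cause. The hypothesis on R makes `InBox.pos` applicable to its
other endpoint. -/
lemma eq_of_long_rest (hn : 2 ≤ n) {α β : PosRoot n} {m : RootSeq n} (hle : C.Le α β)
    (hs : C.R α + (n + 1) < C.P β) (hbox : C.InBox m (C.R α) (C.P β))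
    (hW : ∀ k, C.wtCoef m k = C.E.chi k (C.P α) + C.E.chi k (C.P β))
    (hR : ∀ γ, 0 < m γ → C.P γ = C.P β → C.R γ < C.R α + (n + 1)) :
    (C.P β = C.P α + (n + 1) ∧ m = 0) ∨
    (C.P β < C.P α + (n + 1) ∧ ∃ γ, m = single n γ ∧ C.P γ = C.P β ∧ C.R γ = C.P α) := by
  have b1 := C.R_lt α
  have b3 := hle.1
  have b4 := hle.2
  have b5 := C.P_lt α
  have hhi := lt_of_le hle
  have hx := fun (k : ℤ) (hk : C.R α ≤ k ∧ k ≤ C.P β) =>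
    chi_spec (C := C) (p := C.P α) hhi hk (by omega)
  have hx' := fun (k : ℤ) (hk : C.R α ≤ k ∧ k ≤ C.P β) =>
    chi_spec (C := C) (p := C.P β) hhi hk (by omega)
  by_cases hx1 : C.P β = C.P α + (n + 1)
  · exact Or.inl ⟨hx1, C.eq_zero_of_wtCoef hn fun k => by rw [hW, hx1, C.E.chi_add]; omega⟩
  obtain ⟨γ, hγ, hk⟩ := hbox.exists_of_neg hhi (k := C.P β - (n + 1)) (by omega) (by
    rw [hW]
    have := hx (C.P β - (n + 1)) (by omega)
    have := hx' (C.P β - (n + 1)) (by omega)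
    omega)
  have g1 := hbox γ hγ
  have g2 := C.R_lt γ
  have g3 := C.P_lt γ
  have hP : C.P γ = C.P β := by omega
  have g4 := hR γ hγ hP
  have h1 := hbox.pos hhi (k := C.R γ) (by omega) (by omega) hγ (Or.inr rfl)
  rw [hW] at h1
  have := hx (C.R γ) (by omega)
  have := hx' (C.R γ) (by omega)
  have hR' : C.R γ = C.P α := by omega
  refine Or.inr ⟨by omega, γ, eq_single_of_wtCoef hn hγ hP hR' fun k => ?_, hP, hR'⟩
  rw [hW, add_comm]

/-- The outer chord is too long to be a root. What remains is a single root when two P's or two R's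
cancel, or the crossing matching. -/
lemma Below.eq_of_long (hn : 2 ≤ n) {α β : PosRoot n} {m : RootSeq n} (h : C.Below α β m)
    (hle : C.Le α β) (hs : C.R α + (n + 1) < C.P β) :
    (C.P β = C.P α + (n + 1) ∧ ∃ γ, m = single n γ ∧ C.P γ = C.R β ∧ C.R γ = C.R α) ∨
    (C.R β = C.R α + (n + 1) ∧ ∃ γ, m = single n γ ∧ C.P γ = C.P β ∧ C.R γ = C.P α) ∨
    (C.P α < C.R β ∧ C.R β < C.R α + (n + 1) ∧ C.P β < C.P α + (n + 1) ∧
      ∃ γ δ, m = pair n γ δ ∧ C.P γ = C.R β ∧ C.R γ = C.R α ∧ C.P δ = C.P β ∧ C.R δ = C.P α) := by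
  have b1 := C.R_lt α
  have b2 := C.R_lt β
  have b3 := hle.1
  have b4 := hle.2
  have b5 := C.P_lt α
  have b6 := C.P_lt β
  have b7 := C.dom α β
  have hhi := lt_of_le hle
  have hx := fun (k : ℤ) (hk : C.R α ≤ k ∧ k ≤ C.P β) =>
    chi_spec (C := C) (p := C.P α) hhi hk (by omega)
  have hz := fun (k : ℤ) (hk : C.R α ≤ k ∧ k ≤ C.P β) =>
    chi_spec (C := C) (p := C.R α) hhi hk (by omega)
  have hx' := fun (k : ℤ) (hk : C.R α ≤ k ∧ k ≤ C.P β) =>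
    chi_spec (C := C) (p := C.P β) hhi hk (by omega)
  have hz' := fun (k : ℤ) (hk : C.R α ≤ k ∧ k ≤ C.P β) =>
    chi_spec (C := C) (p := C.R β) hhi hk (by omega)
  by_cases hzz : C.R β = C.R α + (n + 1)
  · refine Or.inr (Or.inl ⟨hzz, ?_⟩)
    rcases eq_of_long_rest hn hle hs h.inBox (fun k => by
      rw [h.wtCoef, hzz, C.E.chi_add]; omega) (fun γ hγ hP => by
        have := h.mem hn hγ; omega) with h' | h'
    · omega
    · exact h'.2
  · have hxx : C.P β ≤ C.P α + (n + 1) := by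
      by_contra hxx
      obtain ⟨γ, hγ, hk⟩ := h.inBox.exists_of_neg hhi (k := C.P β - (n + 1)) (by omega) (by
        rw [h.wtCoef]
        have := hx (C.P β - (n + 1)) (by omega)
        have := hx' (C.P β - (n + 1)) (by omega)
        have := hz (C.P β - (n + 1)) (by omega)
        have := hz' (C.P β - (n + 1)) (by omega)
        omega)
      obtain ⟨g1, g2, g3, g4, g5, g6, g7, g8⟩ := h.mem hn hγ
      have h1 := h.inBox.pos hhi (k := C.R γ) (by omega) (by omega) hγ (Or.inr rfl)
      rw [h.wtCoef] at h1
      have := hx (C.R γ) (by omega)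
      have := hx' (C.R γ) (by omega)
      have := hz (C.R γ) (by omega)
      have := hz' (C.R γ) (by omega)
      omega
    obtain ⟨γ, hγ, hk⟩ := h.inBox.exists_of_pos hhi (k := C.R α) (by omega) (by
      rw [h.wtCoef]
      have := hx (C.R α) (by omega)
      have := hx' (C.R α) (by omega)
      have := hz (C.R α) (by omega)
      have := hz' (C.R α) (by omega)
      omega)
    obtain ⟨g1, g2, g3, g4, g5, g6, g7, g8⟩ := h.mem hn hγ
    have hR : C.R γ = C.R α := by omega
    have h1 := h.inBox.pos hhi (k := C.P γ) (by omega) (by omega) hγ (Or.inl rfl)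
    rw [h.wtCoef] at h1
    have := hx (C.P γ) (by omega)
    have := hx' (C.P γ) (by omega)
    have := hz (C.P γ) (by omega)
    have := hz' (C.P γ) (by omega)
    have hP : C.P γ = C.R β := by omega
    have hlt : C.P α < C.R β := by omega
    obtain ⟨m', rfl, hm'⟩ := exists_eq_single_add hγ
    rcases eq_of_long_rest hn hle hs h.inBox.of_add (fun k => by
      have := h.wtCoef k
      rw [C.wtCoef_add, C.wtCoef_single, hP, hR] at this
      omega) (fun γ hγ hP => by
        have := h.mem hn (hm' γ hγ)
        omega) with ⟨h2, rfl⟩ | ⟨h2, δ, rfl, h3, h4⟩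
    · exact Or.inl ⟨h2, γ, add_zero _, hP, hR⟩
    · exact Or.inr (Or.inr ⟨hlt, by omega, h2, γ, δ, rfl, hP, hR, h3, h4⟩)

end Chart

/-! ## Generalized distances and socles -/

lemma isSimpleSeq_single (w : Word n) (γ : PosRoot n) : IsSimpleSeq n w (single n γ) := by
  intro α β hne hα hβ
  rw [Chart.single_pos_iff] at hα hβ
  exact absurd (hα.trans hβ.symm) hne

lemma isSimpleSeq_pair_iff {w : Word n} {α β : PosRoot n} (hne : α ≠ β) :
    IsSimpleSeq n w (pair n α β) ↔ ∀ m, ¬ precB n w m (pair n α β) := by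
  constructor
  · intro h m hm
    exact h α β hne (by rw [pair_apply_left hne]; omega) (by rw [pair_apply_right hne]; omega)
      ⟨m, hm⟩
  · rintro h α' β' hne' hα' hβ' ⟨m, hm⟩
    rcases Chart.pair_pos hα' with rfl | rfl <;> rcases Chart.pair_pos hβ' with rfl | rfl
    · exact hne' rfl
    · exact h m hm
    · rw [pair_comm] at hm; exact h m hm
    · exact hne' rfl

/-- The member just below m is split off, so chain lengths can be computed recursively from the
sequences below m. -/
lemma isChainLength_iff {w : Word n} {m : RootSeq n} {k : ℕ} : IsChainLength n w m k ↔
    ¬ IsSimpleSeq n w m ∧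
      (k = 1 ∨ ∃ m' k', precB n w m' m ∧ IsChainLength n w m' k' ∧ k = k' + 1) := by
  constructor
  · rintro ⟨l, rfl, hl, hs⟩
    refine ⟨hs m (by simp), ?_⟩
    rcases List.eq_nil_or_concat l with rfl | ⟨l', a, rfl⟩
    · exact Or.inl rfl
    · rw [List.concat_eq_append] at *
      obtain ⟨h1, -, h2⟩ := List.isChain_append.1 hl
      refine Or.inr ⟨a, _, h2 a (by simp) m (by simp), ⟨l', rfl, h1, fun x hx => ?_⟩, by simp⟩
      exact hs x (by simp only [List.mem_append] at *; tauto)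
  · rintro ⟨hs, rfl | ⟨m', k', hp, ⟨l, rfl, hl, hs'⟩, rfl⟩⟩
    · exact ⟨[], rfl, by simp, by simpa using hs⟩
    · refine ⟨l ++ [m'], by simp, ?_, ?_⟩
      · rw [List.isChain_append]
        exact ⟨hl, by simp, by simpa using hp⟩
      · intro x hx
        rcases List.mem_append.1 hx with hx | hx
        · exact hs' x hx
        · rw [List.mem_singleton] at hx; rwa [hx]

lemma hasGDist_unique {w : Word n} {m : RootSeq n} {d d' : ℕ} (h : HasGDist n w m d)
    (h' : HasGDist n w m d') : d = d' := by
  rcases h with ⟨h1, rfl⟩ | ⟨h1, h2⟩ <;> rcases h' with ⟨h3, rfl⟩ | ⟨h3, h4⟩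
  · rfl
  · exact absurd h1 h3
  · exact absurd h3 h1
  · exact h2.unique h4

/-- Only the simple sequence `s` is below `p`. -/
def OneBelow (w : Word n) (p s : RootSeq n) : Prop :=
  IsSimpleSeq n w s ∧ ∀ m, precB n w m p ↔ m = s

/-- Below `p` there is a chain of a simple sequence `s` and a non-simple one, and nothing else. -/
def TwoBelow (w : Word n) (p s : RootSeq n) : Prop :=
  ∃ t, ¬ IsSimpleSeq n w t ∧ OneBelow w t s ∧ ∀ m, precB n w m p ↔ m = t ∨ m = s

section

variable {w : Word n} {p s : RootSeq n}

lemma OneBelow.isChainLength_iff (h : OneBelow w p s) (hp : ¬ IsSimpleSeq n w p) {k : ℕ} :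
    IsChainLength n w p k ↔ k = 1 := by
  rw [TwistedD.isChainLength_iff]
  constructor
  · rintro ⟨-, h1 | ⟨m', k', h1, h2, -⟩⟩
    · exact h1
    · rw [h.2] at h1
      rw [TwistedD.isChainLength_iff, h1] at h2
      exact absurd h.1 h2.1
  · exact fun h1 => ⟨hp, Or.inl h1⟩

lemma OneBelow.hasGDist (h : OneBelow w p s) (hp : ¬ IsSimpleSeq n w p) :
    HasGDist n w p 1 := by
  refine Or.inr ⟨hp, ?_, ?_⟩
  · exact (h.isChainLength_iff hp).2 rfl
  · exact fun k hk => ((h.isChainLength_iff hp).1 hk).le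

lemma TwoBelow.hasGDist (h : TwoBelow w p s) (hp : ¬ IsSimpleSeq n w p) :
    HasGDist n w p 2 := by
  obtain ⟨t, ht, hts, h⟩ := h
  refine Or.inr ⟨hp, ?_, ?_⟩
  · exact isChainLength_iff.2 ⟨hp, Or.inr ⟨t, 1, (h t).2 (Or.inl rfl),
      (hts.isChainLength_iff ht).2 rfl, rfl⟩⟩
  · rintro k hk
    obtain ⟨-, rfl | ⟨m', k', h1, h2, rfl⟩⟩ := isChainLength_iff.1 hk
    · omega
    · rcases (h m').1 h1 with rfl | rfl
      · rw [(hts.isChainLength_iff ht).1 h2]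
      · exact absurd hts.1 (isChainLength_iff.1 h2).1

lemma OneBelow.existsUnique_isSocle (h : OneBelow w p s) (hp : ¬ IsSimpleSeq n w p) :
    ∃! s, IsSocle n w p s := by
  refine ⟨s, ⟨h.1, Or.inl ((h.2 s).2 rfl)⟩, ?_⟩
  rintro s' ⟨h1, h2 | rfl⟩
  · exact (h.2 s').1 h2
  · exact absurd h1 hp

lemma TwoBelow.existsUnique_isSocle (h : TwoBelow w p s) (hp : ¬ IsSimpleSeq n w p) :
    ∃! s, IsSocle n w p s := by
  obtain ⟨t, ht, hts, h⟩ := h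
  refine ⟨s, ⟨hts.1, Or.inl ((h s).2 (Or.inr rfl))⟩, ?_⟩
  rintro s' ⟨h1, h2 | rfl⟩
  · rcases (h s').1 h2 with rfl | rfl
    · exact absurd h1 ht
    · rfl
  · exact absurd h1 hp

end

namespace Chart

variable {w : Word n} {C : Chart n w}

lemma isSimpleSeq_of_incomparable (C : Chart n w) {α β : PosRoot n} (hne : α ≠ β)
    (h1 : ¬ C.Le α β) (h2 : ¬ C.Le β α) : IsSimpleSeq n w (pair n α β) := by
  rw [isSimpleSeq_pair_iff hne]
  intro m hm
  rcases C.le_or_le_of_precB hne hm with h | h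
  · exact h1 h
  · exact h2 h

lemma isSimpleSeq_of_not_below (C : Chart n w) {α β : PosRoot n} (hne : α ≠ β)
    (h1 : C.Le α β) (h2 : ∀ m, ¬ C.Below α β m) : IsSimpleSeq n w (pair n α β) := by
  rw [isSimpleSeq_pair_iff hne]
  intro m hm
  exact h2 m ((C.precB_iff_below hne h1 m).1 hm)

lemma oneBelow_of_unique (C : Chart n w) {α β : PosRoot n} (hne : α ≠ β) (hle : C.Le α β)
    {s : RootSeq n} (hs : IsSimpleSeq n w s) (h1 : C.Below α β s)
    (h2 : ∀ m, C.Below α β m → m = s) : OneBelow w (pair n α β) s :=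
  ⟨hs, fun m => by
    rw [C.precB_iff_below hne hle]
    exact ⟨h2 m, fun h => h ▸ h1⟩⟩

lemma twoBelow_of (C : Chart n w) {α β γ δ : PosRoot n} (hne : α ≠ β) (hle : C.Le α β)
    (hne' : γ ≠ δ) (hle' : C.Le γ δ) {s : RootSeq n} (hs : IsSimpleSeq n w s)
    (h1 : C.Below α β s) (h2 : C.Below γ δ s) (h3 : C.Below α β (pair n γ δ))
    (h4 : ∀ m, C.Below γ δ m → m = s) (h5 : ∀ m, C.Below α β m → m = pair n γ δ ∨ m = s) :
    TwoBelow w (pair n α β) s := by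
  have h6 := C.oneBelow_of_unique hne' hle' hs h2 h4
  refine ⟨pair n γ δ, fun h => ?_, h6, fun m => ?_⟩
  · exact (isSimpleSeq_pair_iff hne').1 h s ((h6.2 s).2 rfl)
  · rw [C.precB_iff_below hne hle]
    refine ⟨h5 m, ?_⟩
    rintro (rfl | rfl)
    · exact h3
    · exact h1

lemma ne_of_coord {α β : PosRoot n} (h : C.P α ≠ C.P β ∨ C.R α ≠ C.R β) : α ≠ β := by
  rintro rfl; simp at h

/-- Two roots of scalar product `0` with two roots in between. -/
lemma exists_twoBelow_of_short (hn : 2 ≤ n) {α β : PosRoot n}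
    (hs : C.P β < C.R α + (n + 1)) (h1 : C.P α < C.R β) :
    ∃ s, TwoBelow w (pair n α β) s := by
  have b1 := C.R_lt α
  have b2 := C.R_lt β
  have hle : C.Le α β := ⟨by omega, by omega⟩
  -- γ and δ form the crossing matching, γ' and δ' the nested one.
  obtain ⟨γ, g1, g2⟩ := C.conv α β (C.R β) (C.R α) (by omega) (by omega) (by omega) (by omega)
    (by omega) (by omega)
  obtain ⟨δ, d1, d2⟩ := C.conv α β (C.P β) (C.P α) (by omega) (by omega) (by omega) (by omega)
    (by omega) (by omega)
  obtain ⟨γ', g1', g2'⟩ := C.conv α β (C.P β) (C.R α) (by omega) (by omega) (by omega) (by omega)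
    (by omega) (by omega)
  obtain ⟨δ', d1', d2'⟩ := C.conv α β (C.R β) (C.P α) (by omega) (by omega) (by omega) (by omega)
    (by omega) (by omega)
  have key : ∀ a b, C.Le a b → (C.R a = C.R α) → C.P b = C.P β →
      ∀ m, C.Below a b m → (∃ e f, m = pair n e f ∧ ((C.R e = C.R α ∧ C.P e = C.P β ∧
        C.R f = min (C.P a) (C.R b) ∧ C.P f = max (C.P a) (C.R b)) ∨
        (C.P a < C.R b ∧ C.R e = C.R α ∧ C.P e = C.R b ∧ C.R f = C.P a ∧ C.P f = C.P β))) := by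
    intro a b hab ha hb m hm
    obtain ⟨e, f, rfl, h⟩ := hm.eq_pair_of_short hn hab (by omega)
    rw [ha, hb] at h
    exact ⟨e, f, rfl, h⟩
  refine ⟨pair n γ' δ', C.twoBelow_of (γ := γ) (δ := δ) (ne_of_coord (C := C) (by omega)) hle
    (ne_of_coord (C := C) (by omega))
    ⟨by omega, by omega⟩ ?_ ?_ ?_ ?_ ?_ ?_⟩
  · refine C.isSimpleSeq_of_incomparable (ne_of_coord (C := C) (by omega)) ?_ ?_ <;>
      · unfold Le; omega
  · refine Below.of_wtCoef hn (fun k => ?_) fun ε hε => ?_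
    · rw [wtCoef_pair, g1', g2', d1', d2']; omega
    · rcases pair_pos hε with rfl | rfl <;> omega
  · refine Below.of_wtCoef hn (fun k => ?_) fun ε hε => ?_
    · rw [wtCoef_pair, g1', g2', d1', d2', g1, g2, d1, d2]; omega
    · rcases pair_pos hε with rfl | rfl <;> omega
  · refine Below.of_wtCoef hn (fun k => ?_) fun ε hε => ?_
    · rw [wtCoef_pair, g1, g2, d1, d2]; omega
    · rcases pair_pos hε with rfl | rfl <;> omega
  · intro m hm
    obtain ⟨e, f, rfl, h⟩ := key γ δ ⟨by omega, by omega⟩ (by omega) (by omega) m hm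
    rw [C.root_ext hn (α := e) (β := γ') (by omega) (by omega),
      C.root_ext hn (α := f) (β := δ') (by omega) (by omega)]
  · intro m hm
    obtain ⟨e, f, rfl, h | h⟩ := key α β hle rfl rfl m hm
    · right
      rw [C.root_ext hn (α := e) (β := γ') (by omega) (by omega),
        C.root_ext hn (α := f) (β := δ') (by omega) (by omega)]
    · left
      rw [C.root_ext hn (α := e) (β := γ) (by omega) (by omega),
        C.root_ext hn (α := f) (β := δ) (by omega) (by omega)]

/-- Two roots whose sum is a root in the middle of the interval between them. -/
lemma twoBelow_of_middle (hn : 2 ≤ n) {α β γ : PosRoot n} (hs : C.P β = C.R α + (n + 1))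
    (h1 : C.P α < C.R β) (hP : C.P γ = C.R β) (hR : C.R γ = C.P α) :
    TwoBelow w (pair n α β) (single n γ) := by
  have b1 := C.R_lt α
  have b2 := C.R_lt β
  have hle : C.Le α β := ⟨by omega, by omega⟩
  obtain ⟨γ', g1, g2⟩ := C.conv α β (C.R β) (C.R α) (by omega) (by omega) (by omega) (by omega)
    (by omega) (by omega)
  obtain ⟨δ, d1, d2⟩ := C.conv α β (C.P β) (C.P α) (by omega) (by omega) (by omega) (by omega)
    (by omega) (by omega)
  have hcan : ∀ k, C.E.chi k (C.P β) = -C.E.chi k (C.R α) := fun k => by rw [hs, C.E.chi_add]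
  refine C.twoBelow_of (γ := γ') (δ := δ) (ne_of_coord (C := C) (by omega)) hle
    (ne_of_coord (C := C) (by omega)) ⟨by omega, by omega⟩ (isSimpleSeq_single w γ) ?_ ?_ ?_ ?_ ?_
  · refine Below.of_wtCoef hn (fun k => ?_) fun ε hε => ?_
    · rw [wtCoef_single, hP, hR, hcan]; omega
    · obtain rfl := single_pos_iff.1 hε; omega
  · refine Below.of_wtCoef hn (fun k => ?_) fun ε hε => ?_
    · rw [wtCoef_single, hP, hR, g1, g2, d1, d2, hcan]; omega
    · obtain rfl := single_pos_iff.1 hε; omega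
  · refine Below.of_wtCoef hn (fun k => ?_) fun ε hε => ?_
    · rw [wtCoef_pair, g1, g2, d1, d2]; omega
    · rcases pair_pos hε with rfl | rfl <;> omega
  · intro m hm
    rcases hm.eq_of_middle hn ⟨by omega, by omega⟩ (by omega) with ⟨e, rfl, h⟩ | h
    · rw [C.root_ext hn (α := e) (β := γ) (by omega) (by omega)]
    · omega
  · intro m hm
    rcases hm.eq_of_middle hn hle hs with ⟨e, rfl, h⟩ | ⟨h, e, f, rfl, h'⟩
    · right
      rw [C.root_ext hn (α := e) (β := γ) (by omega) (by omega)]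
    · left
      rw [C.root_ext hn (α := e) (β := γ') (by omega) (by omega),
        C.root_ext hn (α := f) (β := δ) (by omega) (by omega)]

/-- The classification of pairs of comparable roots. -/
lemma pair_cases (hn : 2 ≤ n) {α β : PosRoot n} (hne : α ≠ β) (hle : C.Le α β) :
    IsSimpleSeq n w (pair n α β) ∨ (∃ s, OneBelow w (pair n α β) s) ∨
    (C.P α < C.R β ∧ C.P β ≤ C.R α + (n + 1) ∧ ∃ s, TwoBelow w (pair n α β) s) := by
  by_cases h0 : ∃ m, C.Below α β m
  swap
  · push Not at h0
    exact Or.inl (C.isSimpleSeq_of_not_below hne hle h0)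
  obtain ⟨m, hm⟩ := h0
  right
  have b1 := C.R_lt α
  have b2 := C.R_lt β
  have b3 := C.P_lt α
  have b4 := C.P_lt β
  have b5 := hle.1
  have b6 := hle.2
  rcases lt_trichotomy (C.P β) (C.R α + (n + 1)) with hs | hs | hs
  · by_cases h1 : C.P α < C.R β
    · exact Or.inr ⟨h1, hs.le, exists_twoBelow_of_short hn hs h1⟩
    · left
      obtain ⟨e1, e2, -⟩ := hm.exists_of_short hn hle hs
      obtain ⟨γ, δ, rfl, h | h⟩ := hm.eq_pair_of_short hn hle hs
      swap
      · omega
      refine ⟨_, C.oneBelow_of_unique hne hle ?_ hm fun m' hm' => ?_⟩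
      · have := C.R_lt δ
        refine C.isSimpleSeq_of_incomparable (ne_of_coord (C := C) (by omega)) ?_ ?_ <;>
          · unfold Le; omega
      · obtain ⟨γ', δ', rfl, h' | h'⟩ := hm'.eq_pair_of_short hn hle hs
        · rw [C.root_ext hn (α := γ') (β := γ) (by omega) (by omega),
            C.root_ext hn (α := δ') (β := δ) (by omega) (by omega)]
        · omega
  · by_cases h1 : C.P α < C.R β
    · obtain ⟨γ, g1, g2⟩ := C.conv α β (C.R β) (C.P α) (by omega) (by omega) (by omega)
        (by omega) (by omega) (by omega)
      exact Or.inr ⟨h1, hs.le, _, twoBelow_of_middle hn hs h1 g1 g2⟩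
    · left
      rcases hm.eq_of_middle hn hle hs with ⟨γ, rfl, h⟩ | h
      swap
      · omega
      refine ⟨_, C.oneBelow_of_unique hne hle (isSimpleSeq_single w γ) hm fun m' hm' => ?_⟩
      rcases hm'.eq_of_middle hn hle hs with ⟨γ', rfl, h'⟩ | h'
      · rw [C.root_ext hn (α := γ') (β := γ) (by omega) (by omega)]
      · omega
  · left
    have b7 := C.dom α β
    rcases hm.eq_of_long hn hle hs with ⟨h, γ, rfl, h1⟩ | ⟨h, γ, rfl, h1⟩ |
      ⟨h1, h2, h3, γ, δ, rfl, h4⟩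
    · refine ⟨_, C.oneBelow_of_unique hne hle (isSimpleSeq_single w γ) hm fun m' hm' => ?_⟩
      rcases hm'.eq_of_long hn hle hs with ⟨h', γ', rfl, h1'⟩ | ⟨h', γ', rfl, h1'⟩ |
        ⟨h1', h2', h3', γ', δ', rfl, h4'⟩
      · rw [C.root_ext hn (α := γ') (β := γ) (by omega) (by omega)]
      · omega
      · omega
    · refine ⟨_, C.oneBelow_of_unique hne hle (isSimpleSeq_single w γ) hm fun m' hm' => ?_⟩
      rcases hm'.eq_of_long hn hle hs with ⟨h', γ', rfl, h1'⟩ | ⟨h', γ', rfl, h1'⟩ |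
        ⟨h1', h2', h3', γ', δ', rfl, h4'⟩
      · omega
      · rw [C.root_ext hn (α := γ') (β := γ) (by omega) (by omega)]
      · omega
    · refine ⟨_, C.oneBelow_of_unique hne hle ?_ hm fun m' hm' => ?_⟩
      -- This interval is again long, but γ and δ already cross, and a cancellation between them
      -- would violate `P_lt` for α or β.
      · have hle' : C.Le γ δ := ⟨by omega, by omega⟩
        refine C.isSimpleSeq_of_not_below (ne_of_coord (C := C) (by omega)) hle' fun m' hm' => ?_
        rcases hm'.eq_of_long hn hle' (by omega) with ⟨h', -⟩ | ⟨h', -⟩ | ⟨h', -⟩ <;> omega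
      · rcases hm'.eq_of_long hn hle hs with ⟨h', γ', rfl, h1'⟩ | ⟨h', γ', rfl, h1'⟩ |
          ⟨h1', h2', h3', γ', δ', rfl, h4'⟩
        · omega
        · omega
        · rw [C.root_ext hn (α := γ') (β := γ) (by omega) (by omega),
            C.root_ext hn (α := δ') (β := δ) (by omega) (by omega)]

end Chart

/-! ## Folded multiplicities -/

lemma endSum_add (v w : RootLattice n) : endSum n (v + w) = endSum n v + endSum n w := by
  unfold endSum; rw [coord_add, coord_add]; ring

lemma endSum_nonneg (γ : PosRoot n) : 0 ≤ endSum n γ.1 := by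
  have h1 := coord_fin γ.1 ⟨n - 1, by omega⟩
  have h2 := coord_fin γ.1 (Fin.last n)
  have h3 := γ.2.2 ⟨n - 1, by omega⟩
  have h4 := γ.2.2 (Fin.last n)
  simp only [Fin.val_last] at h1 h2
  unfold endSum
  omega

lemma endSum_eq_two (hn : 2 ≤ n) {γ : PosRoot n} (h : foldedMult n γ = 2) : endSum n γ.1 = 2 := by
  have h1 := endSum_le_foldedMult hn γ
  by_contra hc
  have h2 := foldedMult_le_one hn γ (by omega)
  omega

/-! ### End-node multiplicities in a frame -/

namespace Frame

variable {c : ℕ → ℤ} (E : Frame n c)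

/-- The contribution of `e_k` to the sum of the coefficients at the two end nodes. -/
def half (k : ℤ) : ℤ := if E.idx k < n then E.sgn k else 0

lemma half_cases (k : ℤ) : E.half k = 0 ∨ E.half k = 1 ∨ E.half k = -1 := by
  unfold half; have := E.sgn_cases k; split_ifs <;> omega

lemma half_shift (k t : ℤ) : E.half (k + t * (n + 1)) = par t * E.half k := by
  unfold half; rw [E.idx_add, E.sgn_add]; split_ifs <;> ring

lemma half_add (k : ℤ) : E.half (k + (n + 1)) = -E.half k := by
  have := E.half_shift k 1
  rw [one_mul] at this
  rw [this]; simp [par]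

lemma half_sub (k : ℤ) : E.half (k - (n + 1)) = -E.half k := by
  have := E.half_add (k - (n + 1))
  rw [sub_add_cancel] at this
  omega

/-- Only index n contributes zero, and two distinct integers less than n + 1 apart have different
indices. -/
lemma half_ne_zero (hn : 2 ≤ n) (hc : IsSection n c) {k p : ℤ} (h : k ≠ p) (h1 : k - p < n + 1)
    (h2 : p - k < n + 1) : E.half k ≠ 0 ∨ E.half p ≠ 0 := by
  by_contra! hc'
  have hk := E.sgn_cases k
  have hp := E.sgn_cases p
  have ik := E.idx_le hn hc k
  have ip := E.idx_le hn hc p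
  unfold half at hc'
  refine E.idx_ne h h1 h2 ?_
  obtain ⟨e1, e2⟩ := hc'
  split_ifs at e1 e2 <;> omega

lemma exists_mem_Ico {k lo : ℤ} : ∃ t : ℤ, lo ≤ k + t * (n + 1) ∧ k + t * (n + 1) < lo + (n + 1) :=
  exists_lift (c := fun _ => lo) 0 k

end Frame

namespace Chart

variable {w : Word n} (C : Chart n w)

lemma endSum_eq (hn : 2 ≤ n) (γ : PosRoot n) :
    endSum n γ.1 = C.E.half (C.P γ) + C.E.half (C.R γ) := by
  rw [← sum_eps_eq_endSum hn, C.E.eps_of_coef hn C.isSection (C.coef_eq γ), sum_range_signedPair]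
  rfl

variable {C}

/-- Some translate of (p, r) is a positive root. Positivity of the end sum makes the translation
even, and `dom` with γ excludes all nonzero even ones. -/
lemma exists_of_half_pos (hn : 2 ≤ n) (γ : PosRoot n) {p r : ℤ} (h1 : r < p) (h2 : p < r + (n + 1))
    (h3 : p ≤ C.P γ + (n + 1)) (h4 : C.P γ ≤ p + (n + 1)) (h5 : r ≤ C.R γ + (n + 1))
    (h6 : C.R γ ≤ r + (n + 1)) (h : 0 < C.E.half p + C.E.half r) :
    ∃ δ, C.P δ = p ∧ C.R δ = r := by
  obtain ⟨t, δ, e1, e2⟩ := C.lift p r h1 h2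
  have h7 := C.endSum_eq hn δ
  rw [e1, e2, C.E.half_shift, C.E.half_shift, ← mul_add] at h7
  have h8 := endSum_nonneg δ
  have h9 : par t = 1 := by
    rcases par_cases t with h' | h'
    · exact h'
    · rw [h'] at h7; omega
  have ht : t = 0 ∨ 2 ≤ t ∨ t ≤ -2 := by
    by_contra! hc
    have : t = 1 ∨ t = -1 := by omega
    rcases this with rfl | rfl <;> simp [par] at h9
  have hM : (0 : ℤ) ≤ n + 1 := by omega
  rcases ht with rfl | ht | ht
  · exact ⟨δ, by omega, by omega⟩
  · have := mul_le_mul_of_nonneg_right ht hM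
    have := C.dom γ δ
    omega
  · have := mul_le_mul_of_nonneg_right ht hM
    have := C.dom δ γ
    omega

/-- Choose e_p and e_q of indices 0 and 1 with equal signs; positivity of the corresponding root
turns both contributions into 1. -/
lemma exists_endSum_eq_two (C : Chart n w) (hn : 2 ≤ n) : ∃ γ : PosRoot n, endSum n γ.1 = 2 := by
  obtain ⟨x, hx⟩ := C.E.exists_idx (show 0 ≤ n by omega)
  obtain ⟨y, hy⟩ := C.E.exists_idx (show 1 ≤ n by omega)
  obtain ⟨t, h1, h2⟩ := Frame.exists_mem_Ico (n := n) (k := y) (lo := x - (n + 1))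
  set r := y + t * (n + 1) with hr
  have hr' : C.E.idx r = 1 := by rw [hr, C.E.idx_add, hy]
  have hne : r ≠ x - (n + 1) := by
    intro h
    rw [h, C.E.idx_sub, hx] at hr'
    omega
  have hx' : C.E.half x = C.E.sgn x := if_pos (by omega)
  have hr2 : C.E.half r = C.E.sgn r := if_pos (by omega)
  have c1 := C.E.sgn_cases x
  have c2 := C.E.sgn_cases r
  obtain ⟨p, q, g1, g2, g3, g4⟩ : ∃ p q : ℤ, q < p ∧ p < q + (n + 1) ∧
      C.E.half p = C.E.half q ∧ (C.E.half q = 1 ∨ C.E.half q = -1) := by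
    by_cases h : C.E.half x = C.E.half r
    · exact ⟨x, r, by omega, by omega, h, by omega⟩
    · have := C.E.half_add r
      exact ⟨r + (n + 1), x, by omega, by omega, by omega, by omega⟩
  obtain ⟨t, δ, e1, e2⟩ := C.lift p q g1 g2
  have h7 := C.endSum_eq hn δ
  rw [e1, e2, C.E.half_shift, C.E.half_shift, ← mul_add] at h7
  have h8 := endSum_nonneg δ
  refine ⟨δ, ?_⟩
  rcases par_cases t with h' | h' <;> rw [h'] at h7 <;> omega

/-! ### Bounds for the generalized distance -/

/-- Any two of the four endpoints bound a positive root, so their contributions have non-negative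
sum, and at most one contribution is zero. Hence at most one differs from 1, and one of α, β has
both equal to 1. -/
lemma two_le_of_short (hn : 2 ≤ n) {α β : PosRoot n} (hs : C.P β < C.R α + (n + 1))
    (h1 : C.P α < C.R β) : 2 ≤ endSum n α.1 ∨ 2 ≤ endSum n β.1 := by
  have b1 := C.R_lt α
  have b2 := C.R_lt β
  have key : ∀ p r, r < p → C.P α ≤ p → p ≤ C.P β → C.R α ≤ r → r ≤ C.R β →
      0 ≤ C.E.half p + C.E.half r := by
    intro p r a1 a2 a3 a4 a5
    obtain ⟨γ, rfl, rfl⟩ := C.conv α β p r a1 (by omega) a2 a3 a4 a5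
    rw [← C.endSum_eq hn]
    exact endSum_nonneg γ
  have e1 := C.endSum_eq hn α
  have e2 := C.endSum_eq hn β
  have k1 := key (C.P α) (C.R α) (by omega) (by omega) (by omega) (by omega) (by omega)
  have k2 := key (C.P β) (C.R β) (by omega) (by omega) (by omega) (by omega) (by omega)
  have k3 := key (C.P β) (C.R α) (by omega) (by omega) (by omega) (by omega) (by omega)
  have k4 := key (C.R β) (C.R α) (by omega) (by omega) (by omega) (by omega) (by omega)
  have k5 := key (C.R β) (C.P α) (by omega) (by omega) (by omega) (by omega) (by omega)
  have k6 := key (C.P β) (C.P α) (by omega) (by omega) (by omega) (by omega) (by omega)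
  have z := fun {k p : ℤ} => C.E.half_ne_zero hn C.isSection (k := k) (p := p)
  have z3 := z (k := C.P β) (p := C.R α) (by omega) (by omega) (by omega)
  have z4 := z (k := C.R β) (p := C.R α) (by omega) (by omega) (by omega)
  have z5 := z (k := C.R β) (p := C.P α) (by omega) (by omega) (by omega)
  have z6 := z (k := C.P β) (p := C.P α) (by omega) (by omega) (by omega)
  have c1 := C.E.half_cases (C.P α)
  have c2 := C.E.half_cases (C.P β)
  have c3 := C.E.half_cases (C.R α)
  have c4 := C.E.half_cases (C.R β)
  omega

/-- The contributions of `R α` and `P β` are opposite. Positivity of α, β and of the crossing roots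
bounds those of `P α` and `R β` below by the absolute value of the former, and then both equal 1. -/
lemma two_le_of_middle (hn : 2 ≤ n) {α β : PosRoot n} (hs : C.P β = C.R α + (n + 1))
    (h1 : C.P α < C.R β) : 2 ≤ endSum n α.1 + endSum n β.1 := by
  have b1 := C.R_lt α
  have b2 := C.R_lt β
  obtain ⟨γ, g1, g2⟩ := C.conv α β (C.R β) (C.R α) (by omega) (by omega) (by omega) (by omega)
    (by omega) (by omega)
  obtain ⟨δ, d1, d2⟩ := C.conv α β (C.P β) (C.P α) (by omega) (by omega) (by omega) (by omega)
    (by omega) (by omega)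
  have e1 := C.endSum_eq hn α
  have e2 := C.endSum_eq hn β
  have e3 := C.endSum_eq hn γ
  have e4 := C.endSum_eq hn δ
  rw [g1, g2] at e3
  rw [d1, d2] at e4
  have k1 := endSum_nonneg α
  have k2 := endSum_nonneg β
  have k3 := endSum_nonneg γ
  have k4 := endSum_nonneg δ
  have e5 := C.E.half_add (C.R α)
  rw [← hs] at e5
  have z := fun {k p : ℤ} => C.E.half_ne_zero hn C.isSection (k := k) (p := p)
  have z1 := z (k := C.P α) (p := C.R α) (by omega) (by omega) (by omega)
  have z2 := z (k := C.R β) (p := C.R α) (by omega) (by omega) (by omega)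
  have c1 := C.E.half_cases (C.P α)
  have c3 := C.E.half_cases (C.R α)
  have c4 := C.E.half_cases (C.R β)
  omega

lemma exists_hasGDist_of_le (hn : 2 ≤ n) {α β : PosRoot n} (hne : α ≠ β) (hle : C.Le α β) :
    ∃ d, HasGDist n w (pair n α β) d ∧
      (¬ IsPosRoot n (α.1 + β.1) → d ≤ max (foldedMult n α) (foldedMult n β)) ∧
      ∀ γ : PosRoot n, γ.1 = α.1 + β.1 → d ≤ foldedMult n γ := by
  by_cases hp : IsSimpleSeq n w (pair n α β)
  · exact ⟨0, Or.inl ⟨hp, rfl⟩, fun _ => Nat.zero_le _, fun _ _ => Nat.zero_le _⟩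
  rcases pair_cases hn hne hle with h | ⟨s, h⟩ | ⟨h1, h2, s, h⟩
  · exact absurd h hp
  · exact ⟨1, h.hasGDist hp, fun _ => le_max_of_le_left (one_le_foldedMult hn α),
      fun γ _ => one_le_foldedMult hn γ⟩
  · refine ⟨2, h.hasGDist hp, ?_, ?_⟩
    · intro hroot
      rcases h2.lt_or_eq with h2 | h2
      · have a1 := endSum_le_foldedMult hn α
        have a2 := endSum_le_foldedMult hn β
        have a3 := two_le_of_short hn h2 h1
        omega
      -- In the middle case the root from `P α` to `R β` is the sum α + β, contrary to assumption.
      · exfalso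
        have b1 := C.R_lt α
        have b2 := C.R_lt β
        obtain ⟨γ, g1, g2⟩ := C.conv α β (C.R β) (C.P α) (by omega) (by omega) (by omega)
          (by omega) (by omega) (by omega)
        obtain ⟨t, -, -, h3⟩ := twoBelow_of_middle hn h2 h1 g1 g2
        have h4 := ((h3 (single n γ)).2 (Or.inr rfl)).1
        rw [wt_single, wt_pair] at h4
        exact hroot (h4 ▸ γ.2)
    · intro γ hγ
      have a1 := endSum_le_foldedMult hn γ
      rw [hγ, endSum_add] at a1
      have a2 := endSum_nonneg α
      have a3 := endSum_nonneg β
      rcases h2.lt_or_eq with h2 | h2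
      · have := two_le_of_short hn h2 h1
        omega
      · have := two_le_of_middle hn h2 h1
        omega

lemma exists_hasGDist (C : Chart n w) (hn : 2 ≤ n) {α β : PosRoot n} (hne : α ≠ β) :
    ∃ d, HasGDist n w (pair n α β) d ∧
      (¬ IsPosRoot n (α.1 + β.1) → d ≤ max (foldedMult n α) (foldedMult n β)) ∧
      ∀ γ : PosRoot n, γ.1 = α.1 + β.1 → d ≤ foldedMult n γ := by
  by_cases h1 : C.Le α β
  · exact exists_hasGDist_of_le hn hne h1
  by_cases h2 : C.Le β α
  · rw [pair_comm, add_comm, max_comm]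
    exact exists_hasGDist_of_le hn hne.symm h2
  exact ⟨0, Or.inl ⟨C.isSimpleSeq_of_incomparable hne h1 h2, rfl⟩, fun _ => Nat.zero_le _,
    fun _ _ => Nat.zero_le _⟩

lemma existsUnique_isSocle (C : Chart n w) (hn : 2 ≤ n) {α β : PosRoot n} (hne : α ≠ β) :
    ∃! s, IsSocle n w (pair n α β) s := by
  by_cases hp : IsSimpleSeq n w (pair n α β)
  · refine ⟨_, ⟨hp, Or.inr rfl⟩, ?_⟩
    rintro s ⟨-, h | h⟩
    · exact absurd h ((isSimpleSeq_pair_iff hne).1 hp s)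
    · exact h
  have key : ∀ {α β : PosRoot n}, α ≠ β → ¬ IsSimpleSeq n w (pair n α β) → C.Le α β →
      ∃! s, IsSocle n w (pair n α β) s := by
    intro α β hne hp hle
    rcases pair_cases hn hne hle with h | ⟨s, h⟩ | ⟨-, -, s, h⟩
    · exact absurd h hp
    · exact h.existsUnique_isSocle hp
    · exact h.existsUnique_isSocle hp
  by_cases h1 : C.Le α β
  · exact key hne hp h1
  by_cases h2 : C.Le β α
  · rw [pair_comm] at hp ⊢
    exact key hne.symm hp h2
  exact absurd (C.isSimpleSeq_of_incomparable hne h1 h2) hp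

/-! ### The radius -/

lemma coef_bounds (γ : PosRoot n) (k : ℤ) :
    C.E.chi k (C.P γ) + C.E.chi k (C.R γ) ≤ 1 := by
  have h1 := C.R_lt γ
  have h2 := C.P_lt γ
  have h3 : C.E.idx (C.P γ) ≠ C.E.idx (C.R γ) := C.E.idx_ne (by omega) (by omega) (by omega)
  have h4 := C.E.sgn_cases k
  have h5 := C.E.sgn_cases (C.P γ)
  have h6 := C.E.sgn_cases (C.R γ)
  unfold Frame.chi
  split_ifs with h7 h8 h8
  · exact absurd (h7.symm.trans h8) h3
  · rcases h4 with h4 | h4 <;> rw [h4] <;> omega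
  · rcases h4 with h4 | h4 <;> rw [h4] <;> omega
  · omega

lemma coef_eq_zero_of_three (γ : PosRoot n) {lo k₁ k₂ k₃ : ℤ} (h₁ : lo ≤ k₁ ∧ k₁ < lo + (n + 1))
    (h₂ : lo ≤ k₂ ∧ k₂ < lo + (n + 1)) (h₃ : lo ≤ k₃ ∧ k₃ < lo + (n + 1)) (h₁₂ : k₁ ≠ k₂)
    (h₁₃ : k₁ ≠ k₃) (h₂₃ : k₂ ≠ k₃) :
    C.E.chi k₁ (C.P γ) + C.E.chi k₁ (C.R γ) = 0 ∨ C.E.chi k₂ (C.P γ) + C.E.chi k₂ (C.R γ) = 0 ∨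
    C.E.chi k₃ (C.P γ) + C.E.chi k₃ (C.R γ) = 0 := by
  by_contra! hc
  have key : ∀ k, C.E.chi k (C.P γ) + C.E.chi k (C.R γ) ≠ 0 →
      C.E.idx k = C.E.idx (C.P γ) ∨ C.E.idx k = C.E.idx (C.R γ) := by
    intro k hk
    by_contra! h
    unfold Frame.chi at hk
    rw [if_neg h.1, if_neg h.2] at hk
    exact hk rfl
  have a1 := key _ hc.1
  have a2 := key _ hc.2.1
  have a3 := key _ hc.2.2
  have b1 := C.E.idx_ne h₁₂ (by omega) (by omega)
  have b2 := C.E.idx_ne h₁₃ (by omega) (by omega)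
  have b3 := C.E.idx_ne h₂₃ (by omega) (by omega)
  omega

lemma precB_single_of_eq (hn : 2 ≤ n) {α β γ : PosRoot n} (hne : α ≠ β)
    (hle : C.Le α β) {p r : ℤ} (h1 : r < p) (h2 : p < r + (n + 1)) (h3 : C.P α ≤ p)
    (h4 : p ≤ C.P β) (h5 : C.R α ≤ r) (h6 : r ≤ C.R β) (h7 : p ≠ C.P α ∨ r ≠ C.R α)
    (h8 : p ≠ C.P β ∨ r ≠ C.R β) (hγ : γ.1 = α.1 + β.1)
    (hW : ∀ k, C.E.chi k (C.P α) + C.E.chi k (C.R α) + (C.E.chi k (C.P β) + C.E.chi k (C.R β)) =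
      C.E.chi k p + C.E.chi k r) : precB n w (single n γ) (pair n α β) := by
  obtain ⟨δ, rfl, rfl⟩ := C.conv α β p r h1 h2 h3 h4 h5 h6
  have hb : C.Below α β (single n δ) := by
    refine Below.of_wtCoef hn (fun k => ?_) fun ε hε => ?_
    · rw [wtCoef_single, hW]
    · obtain rfl := single_pos_iff.1 hε
      exact ⟨h3, h5, h4, h6, h7, h8⟩
  have hδ : γ = δ := by
    have := hb.1
    rw [wt_single, wt_pair, ← hγ] at this
    exact Subtype.ext this.symm
  rw [C.precB_iff_below hne hle, hδ]
  exact hb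

/-- A root has nonzero coefficients at no more than two residues, each at most 1. So two of the four
endpoints must cancel, and the other two bound a root lying strictly between α and β. -/
lemma precB_single_of_le (hn : 2 ≤ n) {α β γ : PosRoot n} (hne : α ≠ β) (hle : C.Le α β)
    (hγ : γ.1 = α.1 + β.1) : precB n w (single n γ) (pair n α β) := by
  have hW : ∀ k, C.E.chi k (C.P γ) + C.E.chi k (C.R γ) = C.E.chi k (C.P α) + C.E.chi k (C.R α) +
      (C.E.chi k (C.P β) + C.E.chi k (C.R β)) := fun k => by
    rw [← wtCoef_single, ← wtCoef_pair, wtCoef, wtCoef, wt_single, wt_pair, hγ]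
  have b1 := C.R_lt α
  have b2 := C.R_lt β
  have b3 := hle.1
  have b4 := hle.2
  have b5 := C.P_lt α
  have b6 := C.P_lt β
  have b7 := C.dom α β
  have hhi := lt_of_le hle
  have key := fun (k : ℤ) (hk : C.R α ≤ k ∧ k ≤ C.P β) => And.intro
    (And.intro (chi_spec (C := C) (p := C.P α) hhi hk (by omega))
      (chi_spec (C := C) (p := C.R α) hhi hk (by omega)))
    (And.intro (chi_spec (C := C) (p := C.P β) hhi hk (by omega))
      (chi_spec (C := C) (p := C.R β) hhi hk (by omega)))
  have kP := key (C.P α) (by omega)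
  have kR := key (C.R α) (by omega)
  have wP := coef_bounds (C := C) γ (C.P α)
  have wR := coef_bounds (C := C) γ (C.R α)
  rw [hW] at wP wR
  rcases lt_trichotomy (C.P β) (C.R α + (n + 1)) with hs | hs | hs
  · exfalso
    have kP' := key (C.P β) (by omega)
    have h3 := coef_eq_zero_of_three (C := C) γ (lo := C.R α) (k₁ := C.P α) (k₂ := C.R α)
      (k₃ := C.P β) (by omega) (by omega) (by omega) (by omega) (by omega) (by omega)
    simp only [hW] at h3
    omega
  · have hcan : ∀ k, C.E.chi k (C.P β) = -C.E.chi k (C.R α) := fun k => by rw [hs, C.E.chi_add]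
    have hne' : C.R β ≠ C.P α := by omega
    rcases lt_or_gt_of_ne hne' with h | h
    · exact precB_single_of_eq hn hne hle (p := C.P α) (r := C.R β) (by omega) (by omega)
        (by omega) (by omega) (by omega) (by omega) (by omega) (by omega) hγ
        fun k => by rw [hcan]; omega
    · exact precB_single_of_eq hn hne hle (p := C.R β) (r := C.P α) (by omega) (by omega)
        (by omega) (by omega) (by omega) (by omega) (by omega) (by omega) hγ
        fun k => by rw [hcan]; omega
  · by_cases hx : C.P β = C.P α + (n + 1)
    · exact precB_single_of_eq hn hne hle (p := C.R β) (r := C.R α) (by omega) (by omega)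
        (by omega) (by omega) (by omega) (by omega) (by omega) (by omega) hγ
        fun k => by rw [hx, C.E.chi_add]; omega
    by_cases hz : C.R β = C.R α + (n + 1)
    · exact precB_single_of_eq hn hne hle (p := C.P β) (r := C.P α) (by omega) (by omega)
        (by omega) (by omega) (by omega) (by omega) (by omega) (by omega) hγ
        fun k => by rw [hz, C.E.chi_add]; omega
    · exfalso
      have kP' := key (C.P β - (n + 1)) (by omega)
      have h3 := coef_eq_zero_of_three (C := C) γ (lo := C.R α) (k₁ := C.P α) (k₂ := C.R α)
        (k₃ := C.P β - (n + 1)) (by omega) (by omega) (by omega) (by omega) (by omega) (by omega)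
      simp only [hW] at h3
      omega

/-- For incomparable roots no such cancellation is possible: three endpoints with distinct residues
would have nonzero coefficients. So α and β are comparable. -/
lemma precB_single_of_add_eq (C : Chart n w) (hn : 2 ≤ n) {α β γ : PosRoot n} (hne : α ≠ β)
    (hγ : γ.1 = α.1 + β.1) : precB n w (single n γ) (pair n α β) := by
  by_cases h1 : C.Le α β
  · exact precB_single_of_le hn hne h1 hγ
  by_cases h2 : C.Le β α
  · rw [pair_comm]
    exact precB_single_of_le hn hne.symm h2 (by rw [hγ, add_comm])
  exfalso
  have key : ∀ {α β : PosRoot n}, γ.1 = α.1 + β.1 → C.P α < C.P β → C.R β < C.R α → False := by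
    intro α β hγ h1 h2
    have hW : ∀ k, C.E.chi k (C.P γ) + C.E.chi k (C.R γ) =
        C.E.chi k (C.P α) + C.E.chi k (C.R α) +
        (C.E.chi k (C.P β) + C.E.chi k (C.R β)) := fun k => by
      rw [← wtCoef_single, ← wtCoef_pair, wtCoef, wtCoef, wt_single, wt_pair, hγ]
    have b1 := C.R_lt α
    have b6 := C.P_lt β
    have hhi : C.P β < C.R β + 2 * (n + 1) := by omega
    have key := fun (k : ℤ) (hk : C.R β ≤ k ∧ k ≤ C.P β) => And.intro
      (And.intro (chi_spec (C := C) (p := C.P α) hhi hk (by omega))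
        (chi_spec (C := C) (p := C.R α) hhi hk (by omega)))
      (And.intro (chi_spec (C := C) (p := C.P β) hhi hk (by omega))
        (chi_spec (C := C) (p := C.R β) hhi hk (by omega)))
    have k1 := key (C.P α) (by omega)
    have k2 := key (C.R α) (by omega)
    have k3 := key (C.P β) (by omega)
    have h3 := coef_eq_zero_of_three (C := C) γ (lo := C.R β) (k₁ := C.P α) (k₂ := C.R α)
      (k₃ := C.P β) (by omega) (by omega) (by omega) (by omega) (by omega) (by omega)
    simp only [hW] at h3
    omega
  unfold Le at h1 h2
  rcases lt_or_ge (C.P α) (C.P β) with h | h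
  · exact key hγ h (by omega)
  · exact key (hγ.trans (add_comm _ _)) (by omega : C.P β < C.P α) (by omega)

/-- A root of folded multiplicity `2` lies below a pair of generalized distance `2`. -/
lemma exists_twoBelow_of_endSum (C : Chart n w) (hn : 2 ≤ n) {γ : PosRoot n} (hγ : endSum n γ.1 = 2) :
    ∃ α β : PosRoot n, α ≠ β ∧ TwoBelow w (pair n α β) (single n γ) := by
  have hPR := C.endSum_eq hn γ
  have hP := C.E.half_cases (C.P γ)
  have hR := C.E.half_cases (C.R γ)
  have b1 := C.R_lt γ
  have b2 := C.P_lt γ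
  -- Since e_y has index n and contributes zero, e_{R γ} + e_y and e_{y+n+1} + e_{P γ} both have end
  -- sum 1, and they add up to γ.
  obtain ⟨x, hx⟩ := C.E.exists_idx le_rfl
  obtain ⟨t, h1, h2⟩ := Frame.exists_mem_Ico (n := n) (k := x) (lo := C.P γ - (n + 1))
  have h0 : C.E.half (x + t * (n + 1)) = 0 := if_neg (by rw [C.E.idx_add]; omega)
  set y := x + t * (n + 1)
  have h3 := C.E.half_add y
  have h4 := C.E.half_sub y
  have h5 : y ≠ C.P γ - (n + 1) := by
    intro h
    rw [h, C.E.half_sub] at h0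
    omega
  have h6 : y ≠ C.R γ := by
    intro h
    rw [h] at h0
    omega
  obtain ⟨β, e1, e2⟩ := exists_of_half_pos (C := C) hn γ (p := y + (n + 1)) (r := C.P γ) (by omega)
    (by omega) (by omega) (by omega) (by omega) (by omega) (by omega)
  by_cases h7 : y < C.R γ
  · obtain ⟨α, f1, f2⟩ := exists_of_half_pos (C := C) hn γ (p := C.R γ) (r := y) (by omega)
      (by omega) (by omega) (by omega) (by omega) (by omega) (by omega)
    exact ⟨α, β, ne_of_coord (C := C) (by omega),
      twoBelow_of_middle (C := C) hn (by omega) (by omega) (by omega) (by omega)⟩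
  -- For y beyond `R γ` the same construction with y - (n + 1) would give two roots that contradict
  -- `dom`.
  · obtain ⟨α, f1, f2⟩ := exists_of_half_pos (C := C) hn γ (p := C.R γ) (r := y - (n + 1)) (by omega)
      (by omega) (by omega) (by omega) (by omega) (by omega) (by omega)
    have := C.dom α β
    omega

/-- The upper bound is the distance bound for pairs whose sum is γ, as any pair above γ has this
sum. It is attained by a pair of distance 2 when the multiplicity is 2, and otherwise by any
decomposition, whose distance is positive because γ lies below it. -/
lemma hasRadius (C : Chart n w) (hn : 2 ≤ n) {γ : PosRoot n} (hγ : ∀ i, γ.1 ≠ simpleRoot n i) :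
    HasRadius n w γ (foldedMult n γ) := by
  have hadd : ∀ α β : PosRoot n, precB n w (single n γ) (pair n α β) → γ.1 = α.1 + β.1 := by
    intro α β h
    rw [← wt_single, h.1, wt_pair]
  refine ⟨?_, ?_⟩
  · have h1 := one_le_foldedMult hn γ
    have h2 := foldedMult_le_two hn γ
    obtain h | h : foldedMult n γ = 2 ∨ foldedMult n γ = 1 := by omega
    · obtain ⟨α, β, hne, hb⟩ := C.exists_twoBelow_of_endSum hn (endSum_eq_two hn h)
      obtain ⟨t, -, -, ht⟩ := id hb
      have hp := (ht (single n γ)).2 (Or.inr rfl)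
      rw [h]
      exact ⟨α, β, hne, hp, hb.hasGDist fun hs => (isSimpleSeq_pair_iff hne).1 hs _ hp⟩
    · obtain ⟨α, β, hne, hab⟩ := exists_decomposition hn γ hγ (by
        have := endSum_le_foldedMult hn γ
        omega)
      have hp := C.precB_single_of_add_eq hn hne hab
      obtain ⟨d, hd, -, hd'⟩ := C.exists_hasGDist hn hne
      have h3 := hd' γ hab
      have h4 : d ≠ 0 := by
        rintro rfl
        rcases hd with ⟨hs, -⟩ | ⟨hs, h5, -⟩
        · exact (isSimpleSeq_pair_iff hne).1 hs _ hp
        · obtain ⟨l, hl, -⟩ := h5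
          simp at hl
      obtain rfl : d = foldedMult n γ := by omega
      exact ⟨α, β, hne, hp, hd⟩
  · rintro d ⟨α, β, hne, hp, hd⟩
    obtain ⟨d', hd', -, h⟩ := C.exists_hasGDist hn hne
    rw [hasGDist_unique hd hd']
    exact h γ (hadd α β hp)

end Chart

end TwistedD
end

theorem theorem8p11 (n : ℕ) (hn : 2 ≤ n) (w : Word n) (hw : IsTwistedAdapted n w) :
    -- the generalized distance of pairs
    ((∀ α β : PosRoot n, α ≠ β → ∃ d : ℕ, HasGDist n w (pair n α β) d ∧
        (¬ IsPosRoot n (α.1 + β.1) → d ≤ max (foldedMult n α) (foldedMult n β)) ∧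
        (∀ γ : PosRoot n, γ.1 = α.1 + β.1 → d ≤ foldedMult n γ)) ∧
      IsGreatest (Set.range (foldedMult n)) 2) ∧
    -- the radius of non-simple positive roots
    (∀ γ : PosRoot n, (∀ i, γ.1 ≠ simpleRoot n i) → HasRadius n w γ (foldedMult n γ)) ∧
    -- the socle of pairs
    (∀ α β : PosRoot n, α ≠ β → ∃! s : RootSeq n, IsSocle n w (pair n α β) s) := by
  obtain ⟨C⟩ := exists_chart hn (hw.isTurn hn)
  refine ⟨⟨fun α β hne => C.exists_hasGDist hn hne, ?_, ?_⟩, fun γ hγ => C.hasRadius hn hγ,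
    fun α β hne => C.existsUnique_isSocle hn hne⟩
  · obtain ⟨γ, hγ⟩ := C.exists_endSum_eq_two hn
    have h1 := endSum_le_foldedMult hn γ
    have h2 := foldedMult_le_two hn γ
    exact ⟨γ, by omega⟩
  · rintro _ ⟨γ, rfl⟩
    exact foldedMult_le_two hn γ
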